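/- Let $d\ge 2$, let $U=\{e\in\mathbb Z^d:|e|_1=1\}$, and let $\mathcal P$ be the set of probability vectors on $U$, that is, of $(p(e))_{e\in U}\in[0,1]^U$ with $\sum_{e\in U}p(e)=1$. Let $\mathbb P$ be a Borel probability measure on the space of environments $\Omega=\mathcal P^{\mathbb Z^d}$ (with the product topology) such that * the coordinates $\omega(x)=(\omega(x,e))_{e\in U}$, $x\in\mathbb Z^d$, are independent and identically distributed under $\mathbb P$, and * (uniform ellipticity) there is $\kappa>0$ such that $\mathbb P[\min_{e\in U}\omega(x,e)\ge\kappa]=1$ for every $x\in\mathbb Z^d$. For $\omega\in\Omega$ let $P_{0,\omega}$ be the law on $(\mathbb Z^d)^{\mathbb N}$ of the Markov chain $(X_n)_{n\ge 0}$ with $X_0=0$ that jumps from $y$ to $y+e$ with probability $\omega(y,e)$ for $e\in U$, and let $P_0[\,\cdot\,]=\int_\Omega P_{0,\omega}[\,\cdot\,]\,\mathbb P(\mathrm d\omega)$ be the averaged law of the random walk in random environment. For $l$ in the Euclidean unit sphere $\mathbb S^{d-1}$ let $A_l=\{\lim_{n\to\infty}X_n\cdot l=\infty\}$. Then there exist a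 deterministic direction $\nu\in\mathbb S^{d-1}$ and deterministic $v_1,v_2\in[0,1]$ such that, $P_0$-almost surely, $$\lim_{n\to\infty}\frac{X_n}{n}=v_1\,\nu\,\mathbf 1_{A_\nu}-v_2\,\nu\,\mathbf 1_{A_{-\nu}}.$$ Moreover, the limiting velocity takes at most two values, and they are collinear: there are deterministic $w_1,w_2\in\mathbb R\nu$ such that, $P_0$-almost surely, $\lim_{n\to\infty}X_n/n\in\{w_1,w_2\}$. -/

import Mathlib

open MeasureTheory ProbabilityTheory Filter Topology

namespace RWRE

/-- The lattice `ℤ^d`. -/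
abbrev Site (d : ℕ) : Type := Fin d → ℤ

/-- The set `U` of the `2d` unit steps: the `e ∈ ℤ^d` with `|e|₁ = 1`. -/
abbrev Step (d : ℕ) : Type := {e : Site d // ∑ i, |e i| = 1}

instance instFiniteStep (d : ℕ) : Finite (Step d) := by
  refine Set.Finite.to_subtype (s := {e : Site d | ∑ i, |e i| = 1}) ?_
  refine (Set.Finite.pi' fun _ : Fin d => Set.finite_Icc (-1 : ℤ) 1).subset ?_
  intro e he i
  have h1 : |e i| ≤ ∑ j, |e j| :=
    Finset.single_le_sum (f := fun j => |e j|) (fun j _ => abs_nonneg _) (Finset.mem_univ i)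
  have he' : ∑ j, |e j| = 1 := he
  rw [he'] at h1
  exact abs_le.1 h1

noncomputable instance instFintypeStep (d : ℕ) : Fintype (Step d) := Fintype.ofFinite _

/-- The environment space: at each site a probability vector on the set of unit steps, with the
product `σ`-algebra (which is the Borel `σ`-algebra of the product topology). -/
abbrev Env (d : ℕ) : Type := Site d → stdSimplex ℝ (Step d)

/-- The path space `(ℤ^d)^ℕ`, with the `σ`-algebra generated by the coordinates. -/
abbrev Path (d : ℕ) : Type := ℕ → Site d

/-- The law of the position after one step from `y` in the environment `ω`. -/
noncomputable def stepLaw {d : ℕ} (ω : Env d) (y : Site d) : Measure (Site d) :=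
  ∑ e : Step d, ENNReal.ofReal (ω y e) • Measure.dirac (y + (e : Site d))

instance instIsProbabilityMeasureStepLaw {d : ℕ} (ω : Env d) (y : Site d) :
    IsProbabilityMeasure (stepLaw ω y) := by
  constructor
  simp only [stepLaw, Measure.coe_finsetSum, Finset.sum_apply, Measure.smul_apply, measure_univ,
    smul_eq_mul, mul_one]
  have h0 : ∀ e ∈ (Finset.univ : Finset (Step d)), 0 ≤ ω y e := fun e _ => (ω y).2.1 e
  have : ∑ e : Step d, (ω y) e = 1 := (ω y).2.2
  rw [← ENNReal.ofReal_sum_of_nonneg h0, this, ENNReal.ofReal_one]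

/-- The transition kernel from the history up to time `n` to the position at time `n + 1`: it
only looks at the present position. -/
noncomputable def stepKernel {d : ℕ} (ω : Env d) (n : ℕ) :
    Kernel (Π _ : Finset.Iic n, Site d) (Site d) where
  toFun h := stepLaw ω (h ⟨n, Finset.mem_Iic.2 le_rfl⟩)
  measurable' := measurable_of_countable _

instance instIsMarkovKernelStepKernel {d : ℕ} (ω : Env d) (n : ℕ) :
    IsMarkovKernel (stepKernel ω n) :=
  ⟨fun h => instIsProbabilityMeasureStepLaw ω (h ⟨n, Finset.mem_Iic.2 le_rfl⟩)⟩

/-- The quenched law `P_{x,ω}`: the law on path space of the Markov chain started in `x` with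
one-step transition probabilities `ω(y, e)` from `y` to `y + e`. -/
noncomputable def quenchedLaw {d : ℕ} (x : Site d) (ω : Env d) : Measure (Path d) :=
  Kernel.traj (X := fun _ => Site d) (stepKernel ω) 0 fun _ => x

instance instIsProbabilityMeasureQuenchedLaw {d : ℕ} (x : Site d) (ω : Env d) :
    IsProbabilityMeasure (quenchedLaw x ω) := by
  unfold quenchedLaw
  infer_instance

theorem measurable_stepLaw_apply {d : ℕ} (y : Site d) (s : Set (Site d)) :
    Measurable fun ω : Env d => stepLaw ω y s := by
  simp only [stepLaw, Measure.coe_finsetSum, Finset.sum_apply, Measure.smul_apply, smul_eq_mul]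
  refine Finset.measurable_sum _ fun e _ => Measurable.mul_const ?_ _
  refine ENNReal.measurable_ofReal.comp ?_
  exact (measurable_pi_apply e).comp (measurable_subtype_coe.comp (measurable_pi_apply y))

/-- The quenched law starts in `x`. -/
theorem quenchedLaw_cylinder_zero {d : ℕ} (x : Site d) (ω : Env d) (s : Set (Site d)) :
    quenchedLaw x ω {X | X 0 ∈ s} = Measure.dirac x s := by
  have h2 := Kernel.traj_map_frestrictLe_apply (X := fun _ => Site d) (κ := stepKernel ω) 0 0
    fun _ => x
  rw [Kernel.partialTraj_self, Kernel.id_apply] at h2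
  have hs : MeasurableSet
      {h : Π _ : Finset.Iic 0, Site d | h ⟨0, Finset.mem_Iic.2 le_rfl⟩ ∈ s} :=
    Set.Countable.measurableSet (Set.to_countable _)
  have h3 := congrArg
    (fun m => m {h : Π _ : Finset.Iic 0, Site d | h ⟨0, Finset.mem_Iic.2 le_rfl⟩ ∈ s}) h2
  beta_reduce at h3
  rw [Measure.map_apply (by fun_prop) hs, Measure.dirac_apply' _ hs] at h3
  rw [Measure.dirac_apply' _ (Set.Countable.measurableSet (Set.to_countable s))]
  exact h3

/-- The Markov property of the quenched law, on cylinders. -/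
theorem quenchedLaw_cylinder_succ {d : ℕ} (x : Site d) (ω : Env d) (n : ℕ) (y : Path d) :
    quenchedLaw x ω {X | ∀ i ≤ n + 1, X i = y i} =
      quenchedLaw x ω {X | ∀ i ≤ n, X i = y i} * stepLaw ω (y n) {y (n + 1)} := by
  have h := Kernel.partialTraj_compProd_eq_map_traj
    (X := fun _ => Site d) (κ := stepKernel ω) (Nat.zero_le n) (x₀ := fun _ => x)
  rw [← Kernel.traj_map_frestrictLe_apply] at h
  have h' := congrArg (fun m => m
    ({fun i : Finset.Iic n => y i} ×ˢ {y (n + 1)} : Set ((Π _ : Finset.Iic n, Site d) × Site d))) h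
  beta_reduce at h'
  rw [Measure.compProd_apply_prod (measurableSet_singleton _) (measurableSet_singleton _),
    Measure.restrict_singleton, lintegral_smul_measure, lintegral_dirac,
    Measure.map_apply (by fun_prop) (measurableSet_singleton _),
    Measure.map_apply (by fun_prop)
      ((measurableSet_singleton _).prod (measurableSet_singleton _)), smul_eq_mul] at h'
  have e1 : {X : Path d | ∀ i ≤ n, X i = y i} =
      Preorder.frestrictLe (π := fun _ => Site d) n ⁻¹' {fun i : Finset.Iic n => y i} := by
    ext X
    simp [funext_iff]
  have e2 : {X : Path d | ∀ i ≤ n + 1, X i = y i} =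
      (fun X : Path d => (Preorder.frestrictLe (π := fun _ => Site d) n X, X (n + 1))) ⁻¹'
        ({fun i : Finset.Iic n => y i} ×ˢ {y (n + 1)}) := by
    ext X
    simp only [Set.mem_ofPred_eq, Set.mem_preimage, Set.mem_prod, Set.mem_singleton_iff,
      funext_iff]
    constructor
    · exact fun hX => ⟨fun i => hX i (Nat.le_succ_of_le (Finset.mem_Iic.1 i.2)), hX _ le_rfl⟩
    · rintro ⟨hX, hX'⟩ i hi
      rcases Nat.le_succ_iff.1 hi with hi | rfl
      · exact hX ⟨i, Finset.mem_Iic.2 hi⟩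
      · exact hX'
  rw [e1, e2]
  exact h'.symm

theorem measurable_quenchedLaw {d : ℕ} (x : Site d) : Measurable (quenchedLaw x) := by
  have hcyl : ∀ (n : ℕ) (y : Path d),
      Measurable fun ω : Env d => quenchedLaw x ω {X | ∀ i ≤ n, X i = y i} := by
    intro n y
    induction n with
    | zero =>
      have h : ∀ ω : Env d, quenchedLaw x ω {X | ∀ i ≤ 0, X i = y i} =
          Measure.dirac x {y 0} := by
        intro ω
        rw [← quenchedLaw_cylinder_zero x ω]
        simp
      simp only [h, measurable_const]
    | succ n ih =>
      simp only [quenchedLaw_cylinder_succ]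
      exact ih.mul (measurable_stepLaw_apply _ _)
  refine Measurable.measure_of_isPiSystem_of_isProbabilityMeasure
    (S := measurableCylinders fun _ : ℕ => Site d)
    generateFrom_measurableCylinders.symm isPiSystem_measurableCylinders ?_
  intro t ht
  obtain ⟨N, S, mS, rfl⟩ : ∃ N S, MeasurableSet S ∧
      t = cylinder (α := fun _ : ℕ => Site d) (Finset.Iic N) S := by
    simpa [measurableCylinders_nat] using ht
  have hm : Measurable fun X : Path d => (Finset.Iic N).restrict X := by fun_prop
  have key : ∀ ω : Env d, quenchedLaw x ω (cylinder (α := fun _ : ℕ => Site d) (Finset.Iic N) S) =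
      ∑' h : S, quenchedLaw x ω {X | ∀ i ≤ N, X i =
        (fun j => if hj : j ∈ Finset.Iic N then (h : Π _ : Finset.Iic N, Site d) ⟨j, hj⟩ else 0) i}
      := by
    intro ω
    rw [cylinder, ← Measure.map_apply hm mS,
      ← Measure.tsum_indicator_apply_singleton _ _ mS, ← tsum_subtype S]
    refine tsum_congr fun h => ?_
    rw [Measure.map_apply hm (measurableSet_singleton _)]
    congr 1
    ext X
    simp only [Set.mem_preimage, Set.mem_singleton_iff, Set.mem_ofPred_eq, funext_iff]
    constructor
    · intro hX i hi
      have := hX ⟨i, Finset.mem_Iic.2 hi⟩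
      simpa [hi] using this
    · rintro hX ⟨i, hi⟩
      have := hX i (Finset.mem_Iic.1 hi)
      simpa [Finset.mem_Iic.1 hi] using this
  simp only [key]
  exact Measurable.tsum fun h => hcyl N _

/-- The quenched laws `ω ↦ P_{x,ω}` as a kernel from environments to paths. -/
noncomputable def quenchedKernel {d : ℕ} (x : Site d) : Kernel (Env d) (Path d) where
  toFun := quenchedLaw x
  measurable' := measurable_quenchedLaw x

instance instIsMarkovKernelQuenchedKernel {d : ℕ} (x : Site d) :
    IsMarkovKernel (quenchedKernel x) :=
  ⟨fun ω => instIsProbabilityMeasureQuenchedLaw x ω⟩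

/-- The averaged (annealed) law `P_x`: the marginal on path space of the semidirect product of
the law `P` of the environment and the quenched laws. -/
noncomputable def annealedLaw {d : ℕ} (P : Measure (Env d)) (x : Site d) : Measure (Path d) :=
  (P ⊗ₘ quenchedKernel x).snd

/-- The coordinates of the environment are independent and identically distributed. -/
def IsIID {d : ℕ} (P : Measure (Env d)) : Prop :=
  iIndepFun (fun (x : Site d) (ω : Env d) => ω x) P ∧
    ∀ x y : Site d, IdentDistrib (fun ω : Env d => ω x) (fun ω : Env d => ω y) P P

/-- Uniform ellipticity: for some `κ > 0`, at every site almost surely all the transition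
probabilities are at least `κ`. -/
def IsUniformlyElliptic {d : ℕ} (P : Measure (Env d)) : Prop :=
  ∃ κ : ℝ, 0 < κ ∧ ∀ x : Site d, ∀ᵐ ω ∂P, ∀ e : Step d, κ ≤ ω x e

/-- A lattice site as a point of Euclidean space `ℝ^d`. -/
noncomputable def toReal {d : ℕ} (x : Site d) : EuclideanSpace ℝ (Fin d) :=
  WithLp.toLp 2 fun i => (x i : ℝ)

/-- The event `A_l` that the walk is transient in direction `l`: `X_n · l → ∞`. -/
def transientEvent {d : ℕ} (l : EuclideanSpace ℝ (Fin d)) : Set (Path d) :=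
  {X | Tendsto (fun n => inner ℝ (toReal (X n)) l) atTop atTop}

/-- `X_n / n → w` as `n → ∞`. -/
def HasVelocity {d : ℕ} (X : Path d) (w : EuclideanSpace ℝ (Fin d)) : Prop :=
  Tendsto (fun n : ℕ => (n : ℝ)⁻¹ • toReal (X n)) atTop (𝓝 w)

end RWRE

/-! Fix a direction `l`. The speed of `X_n · l` is found separately on `A_l`, on `A_{-l}` and off
both.

On `A_l` there are regeneration times: strict height records below which the walk never falls later.
The past has only used the environment strictly below the record, the future only uses the rest, so
the i.i.d. environment decouples them. Conditionally on never going below height zero, the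
increments of time and height between regenerations are therefore identically distributed and
pairwise independent. The mean height increment is finite, because regeneration levels have positive
density (`IsElliptic.integrable_regenPair_snd`). The mean time may be infinite, and the speed is
then zero. The strong law gives a deterministic speed `v(l)` on `A_l` (`IsElliptic.exists_speed`).

If `A_l` is null, excursions above a fresh level end almost surely, so most levels are upcrossed
many times before the walk gets far beyond them. A step upcrosses at most one integer level, hence
the limsup of the speed is at most zero (`IsElliptic.ae_eventually_height_le`). If `A_l` or `A_{-l}`
has positive probability, their union has full probability (`IsElliptic.ae_mem_transientEvent_or`).
So the speed is zero off both events (`IsElliptic.ae_tendsto_zero_or`).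

Applied to the coordinate directions, this yields a velocity. If `w` and `z` are two possible
velocities, both having positive inner product with `l`, then both inner products equal `v(l)`.
Unless `w` and `z` are opposite, this holds for an open set of `l` and forces `w = z`
(`mem_span_of_inner_eq`). Thus all velocities lie on one line `ℝν`, and the speeds on `A_ν` and
`A_{-ν}` determine them. It is never needed that `A_l` itself has probability zero or one. -/

namespace RWRE

/-! ### Cylinders of paths -/

/-- The set of paths that agree with `y` up to time `n`. -/
def cyl {d : ℕ} (y : Path d) (n : ℕ) : Set (Path d) := {X | ∀ i ≤ n, X i = y i}

/-- The path after time `n`. -/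
def shiftPath {d : ℕ} (n : ℕ) (X : Path d) : Path d := fun i => X (n + i)

/-- The path after time `n`, seen from the position at time `n`. -/
def relShift {d : ℕ} (n : ℕ) (X : Path d) : Path d := fun i => X (n + i) - X n

/-- The paths that stay in `S` forever. -/
def stay {d : ℕ} (S : Set (Site d)) : Set (Path d) := {X | ∀ i, X i ∈ S}

/-- The paths that stay in `S` up to time `n`. -/
def stayUpTo {d : ℕ} (S : Set (Site d)) (n : ℕ) : Set (Path d) := {X | ∀ i ≤ n, X i ∈ S}

theorem self_mem_cyl {d : ℕ} (y : Path d) (n : ℕ) : y ∈ cyl y n := fun _ _ => rfl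

theorem cyl_eq_of_mem {d : ℕ} {x y : Path d} {n : ℕ} (h : x ∈ cyl y n) : cyl x n = cyl y n := by
  ext z
  exact ⟨fun hz i hi => (hz i hi).trans (h i hi), fun hz i hi => (hz i hi).trans (h i hi).symm⟩

theorem cyl_anti {d : ℕ} (y : Path d) {m n : ℕ} (h : m ≤ n) : cyl y n ⊆ cyl y m :=
  fun _ hz i hi => hz i (hi.trans h)

theorem measurable_coord {d : ℕ} (i : ℕ) : Measurable fun X : Path d => X i := measurable_pi_apply i

theorem measurableSet_coord {d : ℕ} (i : ℕ) (p : Site d → Prop) :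
    MeasurableSet {X : Path d | p (X i)} :=
  (measurable_coord i) (Set.to_countable {x | p x}).measurableSet

theorem measurableSet_cyl {d : ℕ} (y : Path d) (n : ℕ) : MeasurableSet (cyl y n) := by
  have : cyl y n = ⋂ i, ⋂ (_ : i ≤ n), {X : Path d | X i = y i} := by ext; simp [cyl]
  rw [this]
  exact .iInter fun i => .iInter fun _ => measurableSet_coord i (fun x => x = y i)

theorem measurableSet_stay {d : ℕ} (S : Set (Site d)) : MeasurableSet (stay S) := by
  have : stay S = ⋂ i, {X : Path d | X i ∈ S} := by ext; simp [stay]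
  rw [this]
  exact .iInter fun i => measurableSet_coord i (fun x => x ∈ S)

theorem measurableSet_stayUpTo {d : ℕ} (S : Set (Site d)) (n : ℕ) :
    MeasurableSet (stayUpTo S n) := by
  have : stayUpTo S n = ⋂ i, ⋂ (_ : i ≤ n), {X : Path d | X i ∈ S} := by ext; simp [stayUpTo]
  rw [this]
  exact .iInter fun i => .iInter fun _ => measurableSet_coord i (fun x => x ∈ S)

theorem measurable_shiftPath {d : ℕ} (n : ℕ) : Measurable (shiftPath (d := d) n) :=
  measurable_pi_lambda _ fun i => measurable_pi_apply (n + i)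

theorem measurable_relShift {d : ℕ} (n : ℕ) : Measurable (relShift (d := d) n) :=
  measurable_pi_lambda _ fun i => (measurable_pi_apply (n + i)).sub (measurable_pi_apply n)

theorem countable_range_cyl {d : ℕ} : (Set.range fun p : Path d × ℕ => cyl p.1 p.2).Countable := by
  have : (Set.range fun p : Path d × ℕ => cyl p.1 p.2) ⊆
      ⋃ n : ℕ, Set.range fun f : Finset.Iic n → Site d =>
        {X : Path d | ∀ i : Finset.Iic n, X i = f i} := by
    rintro _ ⟨⟨y, n⟩, rfl⟩
    refine Set.mem_iUnion.2 ⟨n, fun i => y i, ?_⟩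
    ext X
    simp [cyl]
  exact (Set.countable_iUnion fun n => Set.countable_range _).mono this

/-- A comparison of two measures on suitable cylinders around every point of `E'` gives a
comparison on `E'`. -/
theorem measure_le_of_cyl_le {d : ℕ} {m₁ m₂ : Measure (Path d)} {E' E : Set (Path d)}
    (h : ∀ X ∈ E', ∃ n, cyl X n ⊆ E ∧ m₁ (cyl X n) ≤ m₂ (cyl X n)) : m₁ E' ≤ m₂ E := by
  classical
  let p : Path d → ℕ → Prop := fun X n => cyl X n ⊆ E ∧ m₁ (cyl X n) ≤ m₂ (cyl X n)
  -- Around each point take the shortest admissible cylinder. Two cylinders are nested or disjoint,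
  -- so minimality makes the chosen ones pairwise disjoint, and there are only countably many.
  let s : Set (Set (Path d)) :=
    {C | ∃ X n, C = cyl X n ∧ p X n ∧ ∀ m < n, ¬ p X m}
  have hs : s.Countable := countable_range_cyl.mono (by
    rintro _ ⟨X, n, rfl, -⟩
    exact ⟨(X, n), rfl⟩)
  have hdisj : s.PairwiseDisjoint id := by
    have key : ∀ (X Y : Path d) (n m : ℕ), p X n → (∀ k < n, ¬ p X k) → p Y m →
        (∀ k < m, ¬ p Y k) → n ≤ m → (cyl X n ∩ cyl Y m).Nonempty → cyl X n = cyl Y m := by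
      rintro X Y n m hX hX' hY hY' hnm ⟨z, hz, hz'⟩
      have e : cyl X n = cyl Y n := by
        rw [← cyl_eq_of_mem hz, cyl_eq_of_mem (cyl_anti Y hnm hz')]
      have hpY : p Y n := by simpa only [p, e] using hX
      have : ¬ n < m := fun hlt => hY' n hlt hpY
      have hnm' : n = m := le_antisymm hnm (not_lt.1 this)
      rw [e, hnm']
    rintro _ ⟨X, n, rfl, hX, hX'⟩ _ ⟨Y, m, rfl, hY, hY'⟩ hne
    refine Set.disjoint_iff_inter_eq_empty.2 (Set.not_nonempty_iff_eq_empty.1 fun hne' => hne ?_)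
    rcases le_total n m with hnm | hnm
    · exact key X Y n m hX hX' hY hY' hnm hne'
    · exact (key Y X m n hY hY' hX hX' hnm (by rwa [Set.inter_comm])).symm
  have hsub : E' ⊆ ⋃ C ∈ s, C := by
    intro X hX
    have hX' := h X hX
    exact Set.mem_biUnion (x := cyl X (Nat.find hX'))
      ⟨X, _, rfl, Nat.find_spec hX', fun m hm => Nat.find_min hX' hm⟩ (self_mem_cyl _ _)
  have hmeas : ∀ C ∈ s, MeasurableSet C := by
    rintro _ ⟨X, n, rfl, -⟩
    exact measurableSet_cyl X n
  calc m₁ E' ≤ m₁ (⋃ C ∈ s, C) := measure_mono hsub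
    _ = ∑' C : s, m₁ C := measure_biUnion hs hdisj hmeas
    _ ≤ ∑' C : s, m₂ C := by
        refine ENNReal.tsum_le_tsum ?_
        rintro ⟨_, X, n, rfl, hX, -⟩
        exact hX.2
    _ = m₂ (⋃ C ∈ s, C) := (measure_biUnion hs hdisj hmeas).symm
    _ ≤ m₂ E := measure_mono (Set.iUnion₂_subset (by
        rintro _ ⟨X, n, rfl, hX, -⟩
        exact hX.1))

/-- Two measures that agree on the cylinders of length `n` around the points of `E` agree on `E`
if `E` depends on the path up to time `n` only. -/
theorem measure_eq_of_cyl_eq {d : ℕ} {m₁ m₂ : Measure (Path d)} {E : Set (Path d)} {n : ℕ}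
    (hE : ∀ X ∈ E, cyl X n ⊆ E) (h : ∀ X ∈ E, m₁ (cyl X n) = m₂ (cyl X n)) : m₁ E = m₂ E :=
  le_antisymm (measure_le_of_cyl_le fun X hX => ⟨n, hE X hX, (h X hX).le⟩)
    (measure_le_of_cyl_le fun X hX => ⟨n, hE X hX, (h X hX).ge⟩)

/-- Comparison of `μ.restrict B` with `c • μ`. The length of the cylinder may depend on the path, so
this plays the role of a strong Markov bound at a stopping time; `c = 0` yields null sets. `B` need
not be measurable. -/
theorem measure_inter_le_of_cyl {d : ℕ} {μ : Measure (Path d)} {E B : Set (Path d)} {c : ENNReal}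
    (h : ∀ X ∈ E ∩ B, ∃ n, cyl X n ⊆ E ∧ μ (cyl X n ∩ B) ≤ c * μ (cyl X n)) :
    μ (E ∩ B) ≤ c * μ E := by
  have h1 : (μ.restrict B) (E ∩ B) ≤ (c • μ) E := by
    refine measure_le_of_cyl_le fun X hX => ?_
    obtain ⟨n, hn, hn'⟩ := h X hX
    refine ⟨n, hn, ?_⟩
    rwa [Measure.restrict_apply (measurableSet_cyl X n)]
  rwa [Measure.restrict_eq_self _ Set.inter_subset_right] at h1

theorem measure_inter_eq_of_cyl {d : ℕ} {μ : Measure (Path d)} {E B : Set (Path d)} {c : ENNReal}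
    (hB : MeasurableSet B) {n : ℕ} (hE : ∀ X ∈ E, cyl X n ⊆ E)
    (h : ∀ X ∈ E, μ (cyl X n ∩ B) = c * μ (cyl X n)) :
    μ (E ∩ B) = c * μ E := by
  have h1 : (μ.restrict B) E = (c • μ) E := by
    refine measure_eq_of_cyl_eq (n := n) hE fun X hX => ?_
    rw [Measure.restrict_apply (measurableSet_cyl X n)]
    exact h X hX
  rwa [Measure.restrict_apply' hB] at h1

/-- A set whose density in infinitely many cylinders around each of its points is bounded away
from one is a null set. -/
theorem measure_eq_zero_of_frequently_cyl {d : ℕ} {μ : Measure (Path d)} [IsFiniteMeasure μ]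
    {H : Set (Path d)} {c : ENNReal} (hc : c < 1)
    (h : ∀ X ∈ H, ∃ᶠ n in atTop, μ (cyl X n ∩ H) ≤ c * μ (cyl X n)) : μ H = 0 := by
  have hopen : ∀ U : Set (Path d), IsOpen U → H ⊆ U → μ H ≤ c * μ U := by
    intro U hU hHU
    -- Long cylinders around a point of `U` lie in `U`, so one of the infinitely many good cylinders
    -- does.
    have := measure_inter_le_of_cyl (μ := μ) (E := U) (B := H) (c := c) (by
      rintro X ⟨hXU, hXH⟩
      have hev : ∀ᶠ n in atTop, cyl X n ⊆ U := by
        obtain ⟨I, u, hu, hIU⟩ := isOpen_pi_iff.1 hU X hXU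
        obtain ⟨N, hN⟩ := I.exists_le
        refine eventually_atTop.2 ⟨N, fun n hn Y hY => hIU fun i hi => ?_⟩
        rw [hY i ((hN i hi).trans hn)]
        exact (hu i hi).2
      obtain ⟨n, hn, hn'⟩ := ((h X hXH).and_eventually hev).exists
      exact ⟨n, hn', hn⟩)
    rwa [Set.inter_eq_right.2 hHU] at this
  have h2 : μ H ≤ c * μ H := by
    have hc' : c ≠ ⊤ := (hc.trans ENNReal.one_lt_top).ne
    -- Outer regularity lets `U` shrink to `H`; measurability of `H` is not required.
    refine ENNReal.le_of_forall_pos_le_add fun ε hε _ => ?_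
    have : μ.WeaklyRegular :=
      Measure.WeaklyRegular.of_pseudoMetrizableSpace_secondCountable_of_locallyFinite μ
    obtain ⟨U, hHU, hU, hlt⟩ := H.exists_isOpen_lt_add (μ := μ) (measure_ne_top μ H)
      (ENNReal.coe_ne_zero.2 hε.ne')
    calc μ H ≤ c * μ U := hopen U hU hHU
      _ ≤ c * (μ H + ε) := by gcongr
      _ = c * μ H + c * ε := mul_add _ _ _
      _ ≤ c * μ H + 1 * ε := by gcongr
      _ = c * μ H + ε := by rw [one_mul]
  by_contra hne
  have : c * μ H < 1 * μ H := (ENNReal.mul_lt_mul_iff_left hne (measure_ne_top μ H)).2 hc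
  rw [one_mul] at this
  exact absurd h2 (not_le.2 this)

/-- Finite measures on path space that agree on cylinders are equal. -/
theorem measure_ext_of_cyl {d : ℕ} {μ ν : Measure (Path d)} [IsFiniteMeasure μ]
    (h : ∀ y n, μ (cyl y n) = ν (cyl y n)) : μ = ν := by
  have hdet : ∀ n (E : Set (Path d)), (∀ X ∈ E, cyl X n ⊆ E) → μ E = ν E := fun n E hE =>
    measure_eq_of_cyl_eq hE fun X _ => h X n
  refine ext_of_generate_finite (measurableCylinders fun _ : ℕ => Site d)
    generateFrom_measurableCylinders.symm isPiSystem_measurableCylinders ?_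
    (hdet 0 _ fun _ _ => Set.subset_univ _)
  intro t ht
  obtain ⟨N, S, mS, rfl⟩ : ∃ N S, MeasurableSet S ∧
      t = cylinder (α := fun _ : ℕ => Site d) (Finset.Iic N) S := by
    simpa [measurableCylinders_nat] using ht
  refine hdet N _ fun X hX Y hY => ?_
  simp only [mem_cylinder] at hX ⊢
  have : (Finset.Iic N).restrict Y = (Finset.Iic N).restrict X := by
    ext1 i
    exact hY i (Finset.mem_Iic.1 i.2)
  rwa [this]

/-! ### The quenched law -/

theorem measurableSet_sites {d : ℕ} (s : Set (Site d)) : MeasurableSet s :=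
  (Set.to_countable s).measurableSet

theorem quenchedLaw_cyl_zero {d : ℕ} (x : Site d) (ω : Env d) (y : Path d) :
    quenchedLaw x ω (cyl y 0) = Measure.dirac x {y 0} := by
  rw [← quenchedLaw_cylinder_zero x ω]
  simp [cyl]

theorem quenchedLaw_cyl_succ {d : ℕ} (x : Site d) (ω : Env d) (n : ℕ) (y : Path d) :
    quenchedLaw x ω (cyl y (n + 1)) = quenchedLaw x ω (cyl y n) * stepLaw ω (y n) {y (n + 1)} :=
  quenchedLaw_cylinder_succ x ω n y

/-- The Markov property of the quenched law. -/
theorem quenchedLaw_cyl_inter_shiftPath {d : ℕ} (x : Site d) (ω : Env d) (y : Path d) (n : ℕ)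
    {F : Set (Path d)} (hF : MeasurableSet F) :
    quenchedLaw x ω (cyl y n ∩ shiftPath n ⁻¹' F) =
      quenchedLaw x ω (cyl y n) * quenchedLaw (y n) ω F := by
  have key : ((quenchedLaw x ω).restrict (cyl y n)).map (shiftPath n) =
      (quenchedLaw x ω (cyl y n)) • quenchedLaw (y n) ω := by
    refine measure_ext_of_cyl fun z m => ?_
    rw [Measure.map_apply (measurable_shiftPath n) (measurableSet_cyl z m),
      Measure.restrict_apply (measurable_shiftPath n (measurableSet_cyl z m)),
      Measure.smul_apply, smul_eq_mul]
    by_cases hz : z 0 = y n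
    · let w : Path d := fun i => if i ≤ n then y i else z (i - n)
      have hw1 : ∀ i ≤ n, w i = y i := fun i hi => by simp [w, hi]
      have hw2 : ∀ i, w (n + i) = z i := by
        intro i
        rcases Nat.eq_zero_or_pos i with rfl | hi
        · simp [w, hz]
        · simp [w, show ¬ n + i ≤ n by omega]
      have hset : ∀ m, shiftPath n ⁻¹' cyl z m ∩ cyl y n = cyl w (n + m) := by
        intro m
        ext X
        constructor
        · rintro ⟨h1, h2⟩ i hi
          rcases le_or_gt i n with hin | hin
          · rw [hw1 i hin, h2 i hin]
          · obtain ⟨j, rfl⟩ := Nat.exists_eq_add_of_lt hin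
            have := h1 (j + 1) (by omega)
            rw [show n + j + 1 = n + (j + 1) by omega, hw2]
            exact this
        · intro hX
          refine ⟨fun i hi => ?_, fun i hi => ?_⟩
          · rw [← hw2 i]
            exact hX _ (by omega)
          · rw [← hw1 i hi]
            exact hX i (by omega)
      rw [hset]
      induction m with
      | zero =>
        rw [quenchedLaw_cyl_zero]
        have : cyl w (n + 0) = cyl y n := by
          ext X
          exact ⟨fun h i hi => (h i hi).trans (hw1 i hi),
            fun h i hi => (h i hi).trans (hw1 i hi).symm⟩
        rw [this]
        simp [hz]
      | succ m ih =>
        rw [← add_assoc, quenchedLaw_cyl_succ, quenchedLaw_cyl_succ, ih, hw2 m, add_assoc, hw2,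
          mul_assoc]
    · have h0 : shiftPath n ⁻¹' cyl z m ∩ cyl y n = ∅ := by
        rw [← Set.not_nonempty_iff_eq_empty]
        rintro ⟨X, h1, h2⟩
        have e1 : X n = z 0 := h1 0 (Nat.zero_le m)
        exact hz (e1.symm.trans (h2 n le_rfl))
      have h1 : quenchedLaw (y n) ω (cyl z m) = 0 := by
        refine measure_mono_null (cyl_anti z (Nat.zero_le m)) ?_
        rw [quenchedLaw_cyl_zero, Measure.dirac_apply' _ (measurableSet_sites _)]
        simp [Ne.symm hz]
      rw [h0, h1]
      simp
  have := congrArg (fun m => m F) key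
  simp only [Measure.smul_apply, smul_eq_mul] at this
  rwa [Measure.map_apply (measurable_shiftPath n) hF,
    Measure.restrict_apply (measurable_shiftPath n hF), Set.inter_comm] at this

theorem stepLaw_congr {d : ℕ} {ω ω' : Env d} {x : Site d} (h : ω x = ω' x) :
    stepLaw ω x = stepLaw ω' x := by
  simp only [stepLaw, h]

theorem quenchedLaw_cyl_eq_prod {d : ℕ} (x : Site d) (ω : Env d) (y : Path d) (n : ℕ) :
    quenchedLaw x ω (cyl y n) =
      Measure.dirac x {y 0} * ∏ i ∈ Finset.range n, stepLaw ω (y i) {y (i + 1)} := by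
  induction n with
  | zero => simp [quenchedLaw_cyl_zero]
  | succ n ih => rw [quenchedLaw_cyl_succ, ih, Finset.prod_range_succ, mul_assoc]

theorem quenchedLaw_cyl_congr {d : ℕ} {ω ω' : Env d} (x : Site d) (y : Path d) (n : ℕ)
    (h : ∀ i < n, ω (y i) = ω' (y i)) : quenchedLaw x ω (cyl y n) = quenchedLaw x ω' (cyl y n) := by
  rw [quenchedLaw_cyl_eq_prod, quenchedLaw_cyl_eq_prod]
  congr 1
  exact Finset.prod_congr rfl fun i hi => by rw [stepLaw_congr (h i (Finset.mem_range.1 hi))]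

/-- A set of paths whose quenched probability, for the walk started in `x`, depends on the
environment in `S` only. -/
def IsLocal {d : ℕ} (S : Set (Site d)) (x : Site d) (F : Set (Path d)) : Prop :=
  ∀ ω ω' : Env d, (∀ z ∈ S, ω z = ω' z) → quenchedLaw x ω F = quenchedLaw x ω' F

theorem isLocal_of_subset_stayUpTo {d : ℕ} {S : Set (Site d)} {x : Site d} {F : Set (Path d)}
    {n : ℕ} (hF : ∀ X ∈ F, cyl X n ⊆ F) (hFS : F ⊆ stayUpTo S n) : IsLocal S x F :=
  fun _ _ h => measure_eq_of_cyl_eq hF fun X hX =>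
    quenchedLaw_cyl_congr x X n fun i hi => h _ (hFS hX i hi.le)

theorem isLocal_stayUpTo {d : ℕ} (S : Set (Site d)) (x : Site d) (n : ℕ) :
    IsLocal S x (stayUpTo S n) :=
  isLocal_of_subset_stayUpTo (n := n) (fun X hX Y hY i hi => by rw [hY i hi]; exact hX i hi)
    subset_rfl

/-- A path confined to `S` up to a finite time only reads the environment in `S`. Letting that time
tend to infinity gives equality of the restricted laws on cylinders, hence everywhere. -/
theorem isLocal_inter_stay {d : ℕ} (S : Set (Site d)) (x : Site d) {F : Set (Path d)}
    (hF : MeasurableSet F) : IsLocal S x (F ∩ stay S) := by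
  intro ω ω' h
  have key : (quenchedLaw x ω).restrict (stay S) = (quenchedLaw x ω').restrict (stay S) := by
    refine measure_ext_of_cyl fun y n => ?_
    rw [Measure.restrict_apply (measurableSet_cyl y n),
      Measure.restrict_apply (measurableSet_cyl y n)]
    have hset : cyl y n ∩ stay S = ⋂ m, cyl y n ∩ stayUpTo S (n + m) := by
      ext X
      simp only [Set.mem_inter_iff, Set.mem_iInter]
      constructor
      · exact fun hX m => ⟨hX.1, fun i _ => hX.2 i⟩
      · exact fun hX => ⟨(hX 0).1, fun i => (hX i).2 i (by omega)⟩
    have hanti : Antitone fun m => cyl y n ∩ stayUpTo S (n + m) := fun a b hab X hX =>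
      ⟨hX.1, fun i hi => hX.2 i (by omega)⟩
    have hlim : ∀ ω : Env d, Tendsto (fun m => quenchedLaw x ω (cyl y n ∩ stayUpTo S (n + m))) atTop
        (𝓝 (quenchedLaw x ω (cyl y n ∩ stay S))) := by
      intro ω
      rw [hset]
      exact tendsto_measure_iInter_atTop
        (fun m => ((measurableSet_cyl y n).inter (measurableSet_stayUpTo S _)).nullMeasurableSet)
        hanti ⟨0, measure_ne_top _ _⟩
    refine tendsto_nhds_unique (hlim ω) ?_
    refine (hlim ω').congr fun m => ?_
    refine (isLocal_of_subset_stayUpTo (n := n + m) ?_ Set.inter_subset_right ω ω' h).symm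
    rintro X ⟨hX1, hX2⟩ Y hY
    exact ⟨fun i hi => (hY i (by omega)).trans (hX1 i hi), fun i hi => by
      rw [hY i hi]; exact hX2 i hi⟩
  rw [← Measure.restrict_apply hF, ← Measure.restrict_apply hF, key]

theorem measurable_translate {d : ℕ} (x : Site d) :
    Measurable fun (X : Path d) (i : ℕ) => x + X i :=
  measurable_pi_lambda _ fun i =>
    (measurable_of_countable fun z : Site d => x + z).comp (measurable_coord i)

theorem quenchedLaw_translate {d : ℕ} (x : Site d) (ω : Env d) :
    quenchedLaw x ω = (quenchedLaw 0 fun z => ω (x + z)).map fun X i => x + X i := by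
  have hm := measurable_translate x
  refine measure_ext_of_cyl fun y n => ?_
  rw [Measure.map_apply hm (measurableSet_cyl y n)]
  have hset : (fun (X : Path d) (i : ℕ) => x + X i) ⁻¹' cyl y n = cyl (fun i => -x + y i) n := by
    ext X
    simp only [cyl, Set.mem_preimage, Set.mem_ofPred_eq]
    refine forall₂_congr fun i _ => ?_
    rw [eq_neg_add_iff_add_eq]
  rw [hset, quenchedLaw_cyl_eq_prod, quenchedLaw_cyl_eq_prod]
  congr 1
  · rw [Measure.dirac_apply' _ (measurableSet_sites _), Measure.dirac_apply' _ (measurableSet_sites _)]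
    by_cases h : y 0 = x
    · simp [h]
    · have : ¬ (0 : Site d) = -x + y 0 := fun h' => h (by
        rw [eq_neg_add_iff_add_eq, add_zero] at h'; exact h'.symm)
      simp [this, Ne.symm h]
  · refine Finset.prod_congr rfl fun i _ => ?_
    simp only [stepLaw, Measure.coe_finsetSum, Finset.sum_apply, Measure.smul_apply, smul_eq_mul,
      add_neg_cancel_left]
    refine Finset.sum_congr rfl fun e _ => ?_
    congr 1
    rw [Measure.dirac_apply' _ (measurableSet_sites _), Measure.dirac_apply' _ (measurableSet_sites _)]
    simp only [Set.indicator, Set.mem_singleton_iff, add_assoc, add_right_inj,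
      Pi.one_apply]

/-! ### The annealed law -/

variable {d : ℕ} {P : Measure (Env d)}

theorem measurable_quenchedLaw_apply (x : Site d) {F : Set (Path d)} (hF : MeasurableSet F) :
    Measurable fun ω : Env d => quenchedLaw x ω F :=
  (Measure.measurable_coe hF).comp (measurable_quenchedLaw x)

theorem annealedLaw_apply [IsProbabilityMeasure P] (x : Site d) {F : Set (Path d)}
    (hF : MeasurableSet F) : annealedLaw P x F = ∫⁻ ω, quenchedLaw x ω F ∂P := by
  rw [annealedLaw, Measure.snd_compProd, Measure.bind_apply hF (Kernel.aemeasurable _)]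
  rfl

instance [IsProbabilityMeasure P] (x : Site d) : IsProbabilityMeasure (annealedLaw P x) := by
  unfold annealedLaw
  infer_instance

theorem IsIID.map_translate [IsProbabilityMeasure P] (h : IsIID P) (x : Site d) :
    P.map (fun ω z => ω (x + z)) = P := by
  have h1 : iIndepFun (fun (z : Site d) (ω : Env d) => ω (x + z)) P :=
    h.1.precomp (g := fun z => x + z) (add_right_injective x)
  have h2 := (IdentDistrib.pi (fun z => h.2 (x + z) z) h1 h.1).map_eq
  simpa using h2

theorem IsIID.annealedLaw_eq_map [IsProbabilityMeasure P] (h : IsIID P) (x : Site d) :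
    annealedLaw P x = (annealedLaw P 0).map fun X i => x + X i := by
  have hm := measurable_translate x
  ext F hF
  rw [Measure.map_apply hm hF, annealedLaw_apply x hF, annealedLaw_apply 0 (hm hF)]
  conv_rhs => rw [← h.map_translate x]
  rw [lintegral_map (measurable_quenchedLaw_apply 0 (hm hF)) (by fun_prop)]
  refine lintegral_congr fun ω => ?_
  rw [quenchedLaw_translate, Measure.map_apply hm hF]

theorem IsIID.lintegral_mul [IsProbabilityMeasure P] (h : IsIID P) (S : Set (Site d))
    {f g : Env d → ENNReal} (hf : Measurable f) (hg : Measurable g)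
    (hfS : ∀ ω ω' : Env d, (∀ z ∉ S, ω z = ω' z) → f ω = f ω')
    (hgS : ∀ ω ω' : Env d, (∀ z ∈ S, ω z = ω' z) → g ω = g ω') :
    ∫⁻ ω, f ω * g ω ∂P = (∫⁻ ω, f ω ∂P) * ∫⁻ ω, g ω ∂P := by
  classical
  obtain ⟨ω₀⟩ : Nonempty (Env d) := by
    by_contra hne
    rw [not_nonempty_iff] at hne
    exact (IsProbabilityMeasure.ne_zero P) (Measure.eq_zero_of_isEmpty P)
  have hcoord : ∀ z : Site d,
      MeasurableSpace.comap (fun ω : Env d => ω z) inferInstance ≤ MeasurableSpace.pi :=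
    fun z => (measurable_pi_apply z).comap_le
  have hloc : ∀ (T : Set (Site d)) (f : Env d → ENNReal), Measurable f →
      (∀ ω ω' : Env d, (∀ z ∈ T, ω z = ω' z) → f ω = f ω') →
      Measurable[⨆ z ∈ T, MeasurableSpace.comap (fun ω : Env d => ω z) inferInstance] f := by
    intro T f hf hfT
    -- Freezing the environment off `T` at a reference `ω₀` turns pointwise dependence on `T` into
    -- measurability for the `σ`-algebra of the coordinates in `T`.
    have e : f = f ∘ fun ω z => if z ∈ T then ω z else ω₀ z := by
      ext ω
      exact hfT _ _ fun z hz => by simp [hz]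
    rw [e]
    refine hf.comp ?_
    refine @measurable_pi_lambda _ _ _ (_) _ _ fun z => ?_
    by_cases hz : z ∈ T
    · simp only [hz, if_true]
      exact Measurable.of_comap_le (le_iSup₂_of_le z hz le_rfl)
    · simp only [hz, if_false]
      exact measurable_const
  exact lintegral_mul_eq_lintegral_mul_lintegral_of_independent_measurableSpace
    (iSup₂_le fun z _ => hcoord z) (iSup₂_le fun z _ => hcoord z)
    (indep_iSup_of_disjoint (m := fun z => MeasurableSpace.comap (fun ω : Env d => ω z) inferInstance)
      hcoord h.1 (disjoint_compl_left (a := S)))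
    (hloc Sᶜ f hf hfS) (hloc S g hg hgS)

theorem stepLaw_apply_step (ω : Env d) (x : Site d) (e : Step d) :
    stepLaw ω x {x + (e : Site d)} = ENNReal.ofReal (ω x e) := by
  classical
  simp only [stepLaw, Measure.coe_finsetSum, Finset.sum_apply, Measure.smul_apply, smul_eq_mul]
  rw [Finset.sum_eq_single e]
  · simp
  · intro e' _ hne
    rw [Measure.dirac_apply' _ (measurableSet_sites _)]
    have : ¬ (e' : Site d) = e := fun h => hne (Subtype.ext h)
    simp [this]
  · simp

theorem stepLaw_apply_eq_zero (ω : Env d) {x z : Site d} (h : ∀ e : Step d, z ≠ x + (e : Site d)) :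
    stepLaw ω x {z} = 0 := by
  simp only [stepLaw, Measure.coe_finsetSum, Finset.sum_apply, Measure.smul_apply, smul_eq_mul]
  refine Finset.sum_eq_zero fun e _ => ?_
  rw [Measure.dirac_apply' _ (measurableSet_sites _)]
  simp [Ne.symm (h e)]

theorem IsUniformlyElliptic.exists_ennreal (h : IsUniformlyElliptic P) :
    ∃ κ : ENNReal, κ ≠ 0 ∧ κ ≤ 1 ∧
      ∀ᵐ ω ∂P, ∀ (x : Site d) (e : Step d), κ ≤ stepLaw ω x {x + (e : Site d)} := by
  obtain ⟨κ, hκ, hω⟩ := h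
  refine ⟨min (ENNReal.ofReal κ) 1, ?_, min_le_right _ _, ?_⟩
  · simp [hκ]
  · filter_upwards [ae_all_iff.2 hω] with ω h x e
    rw [stepLaw_apply_step]
    exact (min_le_left _ _).trans (ENNReal.ofReal_le_ofReal (h x e))

/-- The standing assumptions on the law of the environment, with an explicit ellipticity
constant. -/
structure IsElliptic (P : Measure (Env d)) (κ : ENNReal) : Prop where
  iid : IsIID P
  ne_zero : κ ≠ 0
  le_one : κ ≤ 1
  le_stepLaw : ∀ᵐ ω ∂P, ∀ (x : Site d) (e : Step d), κ ≤ stepLaw ω x {x + (e : Site d)}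

/-- The paths that start in the origin and make unit steps. -/
def walks (d : ℕ) : Set (Path d) := {X | X 0 = 0 ∧ ∀ n, ∃ e : Step d, X (n + 1) = X n + (e : Site d)}

theorem quenchedLaw_ae_walks (ω : Env d) : ∀ᵐ X ∂(quenchedLaw 0 ω), X ∈ walks d := by
  have h0 : ∀ᵐ X ∂(quenchedLaw 0 ω), X 0 = 0 := by
    have := quenchedLaw_cylinder_zero (0 : Site d) ω {0}ᶜ
    rw [Measure.dirac_apply' _ (measurableSet_sites _)] at this
    simpa [ae_iff] using this
  have hs : ∀ n, ∀ᵐ X ∂(quenchedLaw 0 ω), ∃ e : Step d, X (n + 1) = X n + (e : Site d) := by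
    intro n
    rw [ae_iff]
    have := measure_inter_le_of_cyl (μ := quenchedLaw 0 ω) (E := Set.univ)
      (B := {X : Path d | ¬ ∃ e : Step d, X (n + 1) = X n + (e : Site d)}) (c := 0) (by
        rintro X ⟨-, hX⟩
        refine ⟨n + 1, Set.subset_univ _, ?_⟩
        rw [zero_mul, nonpos_iff_eq_zero]
        refine measure_mono_null Set.inter_subset_left ?_
        rw [quenchedLaw_cyl_succ, stepLaw_apply_eq_zero ω (fun e he => hX ⟨e, he⟩), mul_zero])
    simpa using this
  filter_upwards [h0, ae_all_iff.2 hs] with X h1 h2 using ⟨h1, h2⟩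

theorem measurableSet_walks : MeasurableSet (walks d) := by
  have : walks d = {X | X 0 = 0} ∩ ⋂ n, ⋃ e : Step d, {X | X (n + 1) = X n + (e : Site d)} := by
    ext; simp [walks]
  rw [this]
  refine (measurableSet_coord 0 fun x => x = 0).inter (.iInter fun n => .iUnion fun e => ?_)
  have hm : Measurable fun X : Path d => (X n, X (n + 1)) :=
    (measurable_coord n).prodMk (measurable_coord (n + 1))
  exact hm (t := {p | p.2 = p.1 + (e : Site d)}) (Set.to_countable _).measurableSet

theorem annealedLaw_ae_walks [IsProbabilityMeasure P] :
    ∀ᵐ X ∂(annealedLaw P 0), X ∈ walks d := by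
  rw [ae_iff]
  change annealedLaw P 0 (walks d)ᶜ = 0
  rw [annealedLaw_apply 0 measurableSet_walks.compl]
  have : ∀ ω : Env d, quenchedLaw 0 ω (walks d)ᶜ = 0 := fun ω => quenchedLaw_ae_walks ω
  simp [this]

theorem measurable_stepLaw_prod (y : Path d) (s : Finset ℕ) :
    Measurable fun ω : Env d => ∏ i ∈ s, stepLaw ω (y i) {y (i + 1)} :=
  Finset.measurable_prod _ fun i _ => measurable_stepLaw_apply (y i) {y (i + 1)}

theorem annealedLaw_cyl_inter_shiftPath [IsProbabilityMeasure P] (x : Site d) (y : Path d) (n : ℕ)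
    {F : Set (Path d)} (hF : MeasurableSet F) :
    annealedLaw P x (cyl y n ∩ shiftPath n ⁻¹' F) =
      ∫⁻ ω, quenchedLaw x ω (cyl y n) * quenchedLaw (y n) ω F ∂P := by
  rw [annealedLaw_apply x ((measurableSet_cyl y n).inter (measurable_shiftPath n hF))]
  exact lintegral_congr fun ω => quenchedLaw_cyl_inter_shiftPath x ω y n hF

/-- If a path avoids `S` before time `n` and the event `F` only depends on the environment in `S`,
then the past and the future are independent under the annealed law. -/
theorem annealedLaw_cyl_inter_shiftPath_eq [IsProbabilityMeasure P] (hP : IsIID P) (x : Site d)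
    {S : Set (Site d)} (y : Path d) (n : ℕ) (hy : ∀ i < n, y i ∉ S) {F : Set (Path d)}
    (hF : MeasurableSet F) (hFS : IsLocal S (y n) F) :
    annealedLaw P x (cyl y n ∩ shiftPath n ⁻¹' F) =
      annealedLaw P x (cyl y n) * annealedLaw P (y n) F := by
  rw [annealedLaw_cyl_inter_shiftPath x y n hF, annealedLaw_apply x (measurableSet_cyl y n),
    annealedLaw_apply (y n) hF]
  exact hP.lintegral_mul S (measurable_quenchedLaw_apply x (measurableSet_cyl y n))
    (measurable_quenchedLaw_apply (y n) hF)
    (fun ω ω' h => quenchedLaw_cyl_congr x y n fun i hi => h _ (hy i hi)) hFS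

open Classical in
/-- If a path makes at most `m` visits to `S` before time `n` and the event `F` only depends on the
environment in `S`, then the past and the future are independent under the annealed law up to a
factor `κ ^ m`. -/
theorem IsElliptic.annealedLaw_cyl_inter_shiftPath_le [IsProbabilityMeasure P] {κ : ENNReal}
    (hP : IsElliptic P κ) (x : Site d)
    {S : Set (Site d)} (y : Path d) (n m : ℕ)
    (hy : ((Finset.range n).filter fun i => y i ∈ S).card ≤ m) {F : Set (Path d)}
    (hF : MeasurableSet F) (hFS : IsLocal S (y n) F) :
    κ ^ m * annealedLaw P x (cyl y n ∩ shiftPath n ⁻¹' F) ≤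
      annealedLaw P x (cyl y n) * annealedLaw P (y n) F := by
  by_cases hstep : ∀ i < n, ∃ e : Step d, y (i + 1) = y i + (e : Site d)
  swap
  · push Not at hstep
    obtain ⟨i, hi, he⟩ := hstep
    have h0 : annealedLaw P x (cyl y n) = 0 := by
      rw [annealedLaw_apply x (measurableSet_cyl y n)]
      refine (lintegral_congr fun ω => ?_).trans lintegral_zero
      rw [quenchedLaw_cyl_eq_prod, Finset.prod_eq_zero (Finset.mem_range.2 hi), mul_zero]
      exact stepLaw_apply_eq_zero ω he
    rw [measure_mono_null Set.inter_subset_left h0]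
    simp
  rw [annealedLaw_cyl_inter_shiftPath x y n hF, annealedLaw_apply x (measurableSet_cyl y n),
    annealedLaw_apply (y n) hF]
  -- `f` collects the transition factors at sites off `S`, and is independent of the future. `r`
  -- collects the at most `m` factors in `S`, so `κ ^ m ≤ r ≤ 1` almost surely: `r` is dropped, the
  -- rest factorizes, and `κ ^ m` pays for restoring it.
  let f : Env d → ENNReal := fun ω => Measure.dirac x {y 0} *
    ∏ i ∈ (Finset.range n).filter fun i => y i ∉ S, stepLaw ω (y i) {y (i + 1)}
  let r : Env d → ENNReal := fun ω =>
    ∏ i ∈ (Finset.range n).filter fun i => y i ∈ S, stepLaw ω (y i) {y (i + 1)}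
  have hf : Measurable f := (measurable_stepLaw_prod y _).const_mul _
  have hfr : ∀ ω, quenchedLaw x ω (cyl y n) = f ω * r ω := by
    intro ω
    rw [quenchedLaw_cyl_eq_prod, mul_assoc, mul_comm (∏ i ∈ _, _) (r ω),
      Finset.prod_filter_mul_prod_filter_not]
  have hr1 : ∀ ω, r ω ≤ 1 := fun ω => Finset.prod_le_one' fun i _ => prob_le_one
  have hrκ : ∀ᵐ ω ∂P, κ ^ m ≤ r ω := by
    filter_upwards [hP.le_stepLaw] with ω hω
    calc κ ^ m ≤ κ ^ ((Finset.range n).filter fun i => y i ∈ S).card :=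
          pow_le_pow_right_of_le_one' hP.le_one hy
      _ = ∏ i ∈ (Finset.range n).filter fun i => y i ∈ S, κ := by rw [Finset.prod_const]
      _ ≤ r ω := by
        refine Finset.prod_le_prod' fun i hi => ?_
        obtain ⟨e, he⟩ := hstep i (Finset.mem_range.1 (Finset.mem_filter.1 hi).1)
        rw [he]
        exact hω _ e
  have hind : ∫⁻ ω, f ω * quenchedLaw (y n) ω F ∂P =
      (∫⁻ ω, f ω ∂P) * ∫⁻ ω, quenchedLaw (y n) ω F ∂P := by
    refine hP.iid.lintegral_mul S hf (measurable_quenchedLaw_apply (y n) hF) ?_ hFS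
    intro ω ω' h
    simp only [f]
    congr 1
    refine Finset.prod_congr rfl fun i hi => ?_
    rw [stepLaw_congr (h _ (Finset.mem_filter.1 hi).2)]
  calc κ ^ m * ∫⁻ ω, quenchedLaw x ω (cyl y n) * quenchedLaw (y n) ω F ∂P
      ≤ κ ^ m * ∫⁻ ω, f ω * quenchedLaw (y n) ω F ∂P := by
        gcongr with ω
        rw [hfr]
        exact mul_le_of_le_one_right' (hr1 ω)
    _ = (κ ^ m * ∫⁻ ω, f ω ∂P) * ∫⁻ ω, quenchedLaw (y n) ω F ∂P := by rw [hind, mul_assoc]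
    _ = (∫⁻ ω, f ω * κ ^ m ∂P) * ∫⁻ ω, quenchedLaw (y n) ω F ∂P := by
        rw [lintegral_mul_const _ hf, mul_comm (κ ^ m)]
    _ ≤ (∫⁻ ω, quenchedLaw x ω (cyl y n) ∂P) * ∫⁻ ω, quenchedLaw (y n) ω F ∂P := by
        gcongr ?_ * _
        refine lintegral_mono_ae ?_
        filter_upwards [hrκ] with ω hω
        rw [hfr]
        gcongr

theorem IsElliptic.annealedLaw_cyl_inter_ne_step_le [IsProbabilityMeasure P] {κ : ENNReal}
    (hP : IsElliptic P κ) (x : Site d) (y : Path d) (n : ℕ) (e : Step d) :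
    annealedLaw P x (cyl y n ∩ {X | X (n + 1) ≠ y n + (e : Site d)}) ≤
      (1 - κ) * annealedLaw P x (cyl y n) := by
  have h1 : κ * annealedLaw P x (cyl y n) ≤
      annealedLaw P x (cyl y n ∩ {X | X (n + 1) = y n + (e : Site d)}) := by
    have hset : cyl y n ∩ {X | X (n + 1) = y n + (e : Site d)} =
        cyl (Function.update y (n + 1) (y n + (e : Site d))) (n + 1) := by
      ext X
      simp only [cyl, Set.mem_inter_iff, Set.mem_ofPred_eq]
      constructor
      · rintro ⟨h1, h2⟩ i hi
        rcases Nat.le_succ_iff.1 hi with hi | rfl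
        · rw [Function.update_of_ne (by omega), h1 i hi]
        · simpa using h2
      · intro h
        refine ⟨fun i hi => ?_, by simpa using h (n + 1) le_rfl⟩
        have := h i (by omega)
        rwa [Function.update_of_ne (by omega)] at this
    rw [hset, annealedLaw_apply x (measurableSet_cyl _ _),
      annealedLaw_apply x (measurableSet_cyl _ _),
      ← lintegral_const_mul _ (measurable_quenchedLaw_apply x (measurableSet_cyl y n))]
    refine lintegral_mono_ae ?_
    filter_upwards [hP.le_stepLaw] with ω hω
    rw [quenchedLaw_cyl_succ, mul_comm]
    have e1 : cyl (Function.update y (n + 1) (y n + (e : Site d))) n = cyl y n :=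
      cyl_eq_of_mem fun i hi => by rw [Function.update_of_ne (by omega)]
    rw [e1, Function.update_self, Function.update_of_ne (by omega)]
    gcongr
    exact hω _ e
  have h2 : annealedLaw P x (cyl y n) =
      annealedLaw P x (cyl y n ∩ {X | X (n + 1) = y n + (e : Site d)}) +
      annealedLaw P x (cyl y n ∩ {X | X (n + 1) ≠ y n + (e : Site d)}) :=
    (measure_inter_add_sdiff _ (measurableSet_coord (n + 1) fun z => z = y n + (e : Site d))).symm
  have h3 : annealedLaw P x (cyl y n ∩ {X | X (n + 1) = y n + (e : Site d)}) ≠ ⊤ :=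
    measure_ne_top _ _
  rw [ENNReal.sub_mul (fun _ _ => measure_ne_top _ _), one_mul]
  calc annealedLaw P x (cyl y n ∩ {X | X (n + 1) ≠ y n + (e : Site d)})
      = annealedLaw P x (cyl y n) -
        annealedLaw P x (cyl y n ∩ {X | X (n + 1) = y n + (e : Site d)}) := by
          rw [h2, ENNReal.add_sub_cancel_left h3]
    _ ≤ _ := tsub_le_tsub_left h1 _

/-! ### Heights in a direction -/

/-- The height of a site in direction `l`. -/
noncomputable def height (l : EuclideanSpace ℝ (Fin d)) (x : Site d) : ℝ := inner ℝ (toReal x) l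

theorem toReal_add (x y : Site d) : toReal (x + y) = toReal x + toReal y := by
  ext i; simp [toReal]

theorem toReal_zero : toReal (0 : Site d) = 0 := by
  ext i; simp [toReal]

theorem height_add (l : EuclideanSpace ℝ (Fin d)) (x y : Site d) :
    height l (x + y) = height l x + height l y := by
  simp [height, toReal_add, inner_add_left]

theorem height_zero (l : EuclideanSpace ℝ (Fin d)) : height l 0 = 0 := by
  simp [height, toReal_zero]

theorem height_sub (l : EuclideanSpace ℝ (Fin d)) (x y : Site d) :
    height l (x - y) = height l x - height l y := by
  rw [eq_sub_iff_add_eq, ← height_add, sub_add_cancel]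

theorem height_neg_dir (l : EuclideanSpace ℝ (Fin d)) (x : Site d) :
    height (-l) x = -height l x := by
  simp [height]

theorem height_smul_dir (c : ℝ) (l : EuclideanSpace ℝ (Fin d)) (x : Site d) :
    height (c • l) x = c * height l x := by
  simp [height, inner_smul_right]

theorem norm_toReal_step_le (e : Step d) : ‖toReal (e : Site d)‖ ≤ 1 := by
  rw [EuclideanSpace.norm_eq, Real.sqrt_le_one]
  have h1 : ∀ i, |(e : Site d) i| ≤ 1 := fun i =>
    (Finset.single_le_sum (f := fun j => |(e : Site d) j|) (fun j _ => abs_nonneg _)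
      (Finset.mem_univ i)).trans_eq e.2
  calc ∑ i, ‖toReal (e : Site d) i‖ ^ 2 ≤ ∑ i, ((|(e : Site d) i| : ℤ) : ℝ) := by
        refine Finset.sum_le_sum fun i _ => ?_
        have h2 : ((|(e : Site d) i| : ℤ) : ℝ) ≤ 1 := by exact_mod_cast h1 i
        have h3 : (0 : ℝ) ≤ ((|(e : Site d) i| : ℤ) : ℝ) := by positivity
        have h4 : ‖toReal (e : Site d) i‖ = ((|(e : Site d) i| : ℤ) : ℝ) := by
          simp [toReal]
        rw [h4]
        nlinarith
    _ = ((∑ i, |(e : Site d) i| : ℤ) : ℝ) := by push_cast; rfl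
    _ = 1 := by rw [e.2]; simp

theorem abs_height_step_le (l : EuclideanSpace ℝ (Fin d)) (e : Step d) :
    |height l (e : Site d)| ≤ ‖l‖ :=
  (abs_real_inner_le_norm _ _).trans
    (mul_le_of_le_one_left (norm_nonneg _) (norm_toReal_step_le e))

theorem exists_step_height_pos {l : EuclideanSpace ℝ (Fin d)} (hl : l ≠ 0) :
    ∃ e : Step d, 0 < height l (e : Site d) := by
  classical
  obtain ⟨i, hi⟩ : ∃ i, l i ≠ 0 := by
    by_contra! h
    exact hl (by ext i; simpa using h i)
  have key : ∀ s : ℤ, |s| = 1 → ∃ e : Step d, height l (e : Site d) = s * l i := by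
    intro s hs
    refine ⟨⟨Pi.single i s, ?_⟩, ?_⟩
    · rw [Finset.sum_eq_single i]
      · simpa using hs
      · intro j _ hj
        simp [hj]
      · simp
    · simp only [height, toReal, PiLp.inner_apply]
      rw [Finset.sum_eq_single i]
      · simp [mul_comm]
      · intro j _ hj
        simp [hj]
      · simp
  rcases lt_or_gt_of_ne hi with h | h
  · obtain ⟨e, he⟩ := key (-1) (by simp)
    exact ⟨e, by rw [he]; push_cast; linarith⟩
  · obtain ⟨e, he⟩ := key 1 (by simp)
    exact ⟨e, by rw [he]; push_cast; linarith⟩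

theorem height_succ_le {l : EuclideanSpace ℝ (Fin d)} {X : Path d} (hX : X ∈ walks d) (n : ℕ) :
    height l (X (n + 1)) ≤ height l (X n) + ‖l‖ := by
  obtain ⟨e, he⟩ := hX.2 n
  rw [he, height_add]
  linarith [(abs_le.1 (abs_height_step_le l e)).2]

theorem mem_transientEvent {l : EuclideanSpace ℝ (Fin d)} {X : Path d} :
    X ∈ transientEvent l ↔ Tendsto (fun n => height l (X n)) atTop atTop := Iff.rfl

theorem mem_transientEvent_neg {l : EuclideanSpace ℝ (Fin d)} {X : Path d} :
    X ∈ transientEvent (-l) ↔ Tendsto (fun n => height l (X n)) atTop atBot := by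
  rw [mem_transientEvent, ← tendsto_neg_atTop_iff]
  simp only [height_neg_dir]

/-! ### Asymptotic alternatives for the height -/

/-- Almost surely, the height is unbounded above or tends to `-∞`. -/
theorem IsElliptic.ae_frequently_le_height_or_tendsto_atBot [IsProbabilityMeasure P] {κ : ENNReal}
    (hP : IsElliptic P κ) {l : EuclideanSpace ℝ (Fin d)} (hl : l ≠ 0) :
    ∀ᵐ X ∂(annealedLaw P 0), (∀ b : ℝ, ∃ᶠ n in atTop, b ≤ height l (X n)) ∨
      Tendsto (fun n => height l (X n)) atTop atBot := by
  obtain ⟨e, he⟩ := exists_step_height_pos hl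
  set δ := height l (e : Site d) with hδ
  -- From height at least `j * δ` the step `e` reaches `(j + 1) * δ`, with conditional probability
  -- at least `κ`. Infinitely many such chances cannot all be missed, so being frequently above one
  -- band boundary propagates to the next.
  have hnull : ∀ (j : ℤ) (N : ℕ), ∀ᵐ X ∂(annealedLaw P 0),
      ¬ ((∃ᶠ n in atTop, j * δ ≤ height l (X n)) ∧ ∀ n ≥ N, height l (X n) < (j + 1) * δ) := by
    intro j N
    rw [ae_iff]
    simp only [not_not]
    refine measure_eq_zero_of_frequently_cyl (c := 1 - κ)
      (ENNReal.sub_lt_self ENNReal.one_ne_top one_ne_zero hP.ne_zero) ?_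
    rintro X ⟨hX1, hX2⟩
    refine (hX1.and_eventually (eventually_ge_atTop N)).mono fun n hn => ?_
    refine (measure_mono ?_).trans (hP.annealedLaw_cyl_inter_ne_step_le 0 X n e)
    rintro Y ⟨hY1, hY2, hY3⟩
    refine ⟨hY1, fun h => ?_⟩
    have h1 := hY3 (n + 1) (by omega)
    rw [h, height_add] at h1
    linarith [hn.1]
  filter_upwards [ae_all_iff.2 fun j => ae_all_iff.2 (hnull j)] with X hX
  by_cases hb : ∃ b : ℝ, ∃ᶠ n in atTop, b ≤ height l (X n)
  · left
    obtain ⟨b, hb⟩ := hb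
    have hstep : ∀ k : ℕ, ∃ᶠ n in atTop, ((⌊b / δ⌋ + k : ℤ) : ℝ) * δ ≤ height l (X n) := by
      intro k
      induction k with
      | zero =>
        refine hb.mono fun n hn => le_trans ?_ hn
        have := Int.floor_le (b / δ)
        rw [le_div_iff₀ he] at this
        simpa using this
      | succ k ih =>
        rw [frequently_atTop]
        intro N
        have := hX (⌊b / δ⌋ + k) N
        rw [not_and] at this
        have h2 := this ih
        push Not at h2
        obtain ⟨n, hn, hn'⟩ := h2
        refine ⟨n, hn, ?_⟩
        push_cast at hn' ⊢
        linarith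
    intro b'
    obtain ⟨k, hk⟩ := exists_nat_ge (b' / δ - ⌊b / δ⌋)
    refine (hstep k).mono fun n hn => le_trans ?_ hn
    rw [← div_le_iff₀ he]
    push_cast
    linarith
  · right
    push Not at hb
    rw [tendsto_atBot]
    intro b
    filter_upwards [hb b] with n hn using hn.le

/-- Almost surely, a height that is bounded below tends to `∞`. -/
theorem IsElliptic.ae_mem_transientEvent_of_bddBelow [IsProbabilityMeasure P] {κ : ENNReal}
    (hP : IsElliptic P κ) {l : EuclideanSpace ℝ (Fin d)} (hl : l ≠ 0) :
    ∀ᵐ X ∂(annealedLaw P 0), (∃ b : ℝ, ∀ᶠ n in atTop, b ≤ height l (X n)) →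
      X ∈ transientEvent l := by
  filter_upwards [hP.ae_frequently_le_height_or_tendsto_atBot (neg_ne_zero.2 hl)] with X hX
  rintro ⟨b, hb⟩
  rcases hX with hX | hX
  · exfalso
    obtain ⟨n, h1, h2⟩ := ((hX (-b + 1)).and_eventually hb).exists
    rw [height_neg_dir] at h1
    linarith
  · simp only [height_neg_dir] at hX
    exact tendsto_neg_atBot_iff.1 hX

/-- The paths that never go below height zero. -/
def stayUp (l : EuclideanSpace ℝ (Fin d)) : Set (Path d) := stay {x | 0 ≤ height l x}

theorem measurableSet_stayUp (l : EuclideanSpace ℝ (Fin d)) : MeasurableSet (stayUp l) :=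
  measurableSet_stay _

theorem relShift_mem_stayUp {l : EuclideanSpace ℝ (Fin d)} {X : Path d} {n : ℕ} :
    relShift n X ∈ stayUp l ↔ ∀ i, height l (X n) ≤ height l (X (n + i)) := by
  simp only [stayUp, stay, relShift, Set.mem_ofPred_eq, height_sub, sub_nonneg]

theorem cyl_inter_relShift_preimage (y : Path d) (n : ℕ) (F : Set (Path d)) :
    cyl y n ∩ relShift n ⁻¹' F = cyl y n ∩ shiftPath n ⁻¹' ((fun X i => -y n + X i) ⁻¹' F) := by
  ext X
  simp only [Set.mem_inter_iff, Set.mem_preimage]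
  refine and_congr_right fun h => ?_
  have : relShift n X = fun i => -y n + shiftPath n X i := by
    ext1 i
    simp only [relShift, shiftPath, h n le_rfl]
    abel
  rw [this]

theorem IsIID.annealedLaw_translate_preimage [IsProbabilityMeasure P] (hP : IsIID P)
    (x : Site d) {F : Set (Path d)} (hF : MeasurableSet F) :
    annealedLaw P x ((fun X i => -x + X i) ⁻¹' F) = annealedLaw P 0 F := by
  rw [hP.annealedLaw_eq_map x, Measure.map_apply (measurable_translate x)
    (measurable_translate (-x) hF)]
  congr 1
  ext X
  simp

/-- Staying above the starting height confines the walk to a half-space. This is what makes the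
future after a record independent of the past. -/
theorem isLocal_translate_inter_stayUp (l : EuclideanSpace ℝ (Fin d)) (x : Site d)
    {F : Set (Path d)} (hF : MeasurableSet F) :
    IsLocal {z | height l x ≤ height l z} x ((fun X i => -x + X i) ⁻¹' (F ∩ stayUp l)) := by
  have h2 : (fun (X : Path d) (i : ℕ) => -x + X i) ⁻¹' stayUp l =
      stay {z | height l x ≤ height l z} := by
    ext X
    simp only [stayUp, stay, Set.mem_preimage, Set.mem_ofPred_eq]
    refine forall_congr' fun i => ?_
    rw [neg_add_eq_sub, height_sub, sub_nonneg]
  rw [Set.preimage_inter, h2]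
  exact isLocal_inter_stay _ x (measurable_translate (-x) hF)

/-- The renewal property at a strict record of the height. -/
theorem IsIID.annealedLaw_cyl_inter_relShift [IsProbabilityMeasure P] (hP : IsIID P)
    {l : EuclideanSpace ℝ (Fin d)} {y : Path d} {n : ℕ}
    (hy : ∀ i < n, height l (y i) < height l (y n)) {F : Set (Path d)} (hF : MeasurableSet F) :
    annealedLaw P 0 (cyl y n ∩ relShift n ⁻¹' (F ∩ stayUp l)) =
      annealedLaw P 0 (F ∩ stayUp l) * annealedLaw P 0 (cyl y n) := by
  have hF' := hF.inter (measurableSet_stayUp l)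
  rw [cyl_inter_relShift_preimage, annealedLaw_cyl_inter_shiftPath_eq hP 0 y n
    (S := {z | height l (y n) ≤ height l z}) (fun i hi => not_le.2 (hy i hi))
    (measurable_translate _ hF') (isLocal_translate_inter_stayUp l (y n) hF),
    hP.annealedLaw_translate_preimage _ hF', mul_comm]

theorem IsIID.annealedLaw_cyl_diff_relShift_le [IsProbabilityMeasure P] (hP : IsIID P)
    {l : EuclideanSpace ℝ (Fin d)} {y : Path d} {n : ℕ}
    (hy : ∀ i < n, height l (y i) < height l (y n)) :
    annealedLaw P 0 (cyl y n \ relShift n ⁻¹' stayUp l) ≤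
      (1 - annealedLaw P 0 (stayUp l)) * annealedLaw P 0 (cyl y n) := by
  have h1 := hP.annealedLaw_cyl_inter_relShift hy MeasurableSet.univ
  rw [Set.univ_inter] at h1
  have h2 : annealedLaw P 0 (cyl y n ∩ relShift n ⁻¹' stayUp l) +
      annealedLaw P 0 (cyl y n \ relShift n ⁻¹' stayUp l) = annealedLaw P 0 (cyl y n) :=
    measure_inter_add_sdiff _ (measurable_relShift n (measurableSet_stayUp l))
  rw [ENNReal.sub_mul (fun _ _ => measure_ne_top _ _), one_mul, ← h1]
  exact ENNReal.le_sub_of_add_le_left (measure_ne_top _ _) h2.le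

/-- A transient path attains its minimal height and stays up from then on. If staying up were null,
it would remain null after any fixed time `n`, because past and future decouple at a cost `κ ^ n`.
-/
theorem IsElliptic.annealedLaw_stayUp_ne_zero [IsProbabilityMeasure P] {κ : ENNReal}
    (hP : IsElliptic P κ) {l : EuclideanSpace ℝ (Fin d)}
    (h : annealedLaw P 0 (transientEvent l) ≠ 0) : annealedLaw P 0 (stayUp l) ≠ 0 := by
  intro h0
  apply h
  refine measure_mono_null (t := ⋃ n, relShift n ⁻¹' stayUp l) ?_ (measure_iUnion_null fun n => ?_)
  · intro X hX
    rw [mem_transientEvent, ← Nat.cofinite_eq_atTop] at hX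
    obtain ⟨n, hn⟩ := hX.exists_forall_le
    exact Set.mem_iUnion.2 ⟨n, relShift_mem_stayUp.2 fun i => hn _⟩
  · have := measure_inter_le_of_cyl (μ := annealedLaw P 0) (E := Set.univ)
      (B := relShift n ⁻¹' stayUp l) (c := 0) (by
        rintro X -
        refine ⟨n, Set.subset_univ _, ?_⟩
        rw [zero_mul, nonpos_iff_eq_zero, cyl_inter_relShift_preimage]
        have h1 := hP.annealedLaw_cyl_inter_shiftPath_le 0
          (S := {z | height l (X n) ≤ height l z}) X n n
          ((Finset.card_filter_le _ _).trans_eq (Finset.card_range n))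
          (measurable_translate (-X n) (MeasurableSet.univ.inter (measurableSet_stayUp l)))
          (isLocal_translate_inter_stayUp l (X n) MeasurableSet.univ)
        rw [Set.univ_inter, hP.iid.annealedLaw_translate_preimage _ (measurableSet_stayUp l), h0,
          mul_zero, nonpos_iff_eq_zero, mul_eq_zero] at h1
        exact h1.resolve_left (pow_ne_zero _ hP.ne_zero))
    simpa using this

/-! ### Regeneration times and transience in one of two opposite directions -/

/-- A regeneration time: a strict record of the height, below which the path never falls later. -/
def IsRegen (l : EuclideanSpace ℝ (Fin d)) (X : Path d) (n : ℕ) : Prop :=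
  (∀ i < n, height l (X i) < height l (X n)) ∧ ∀ i, height l (X n) ≤ height l (X (n + i))

theorem exists_record_ge {u : ℕ → ℝ} (hu : ∀ b : ℝ, ∃ᶠ n in atTop, b ≤ u n) :
    ∃ᶠ n in atTop, ∀ i < n, u i < u n := by
  classical
  rw [frequently_atTop]
  intro N
  obtain ⟨M, hM⟩ := ((Set.finite_Iic N).image u).bddAbove
  have hex : ∃ n, M + 1 ≤ u n := (hu (M + 1)).exists
  refine ⟨Nat.find hex, ?_, fun i hi => ?_⟩
  · by_contra hlt
    have := hM ⟨Nat.find hex, (not_le.1 hlt).le, rfl⟩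
    linarith [Nat.find_spec hex]
  · linarith [not_le.1 (Nat.find_min hex hi), Nat.find_spec hex]

/-- Each strict record is a fresh trial: given the past, it is a regeneration with probability
`annealedLaw P 0 (stayUp l)`, which is positive. A path with infinitely many records cannot fail all
late trials. -/
theorem IsElliptic.ae_frequently_isRegen [IsProbabilityMeasure P] {κ : ENNReal}
    (hP : IsElliptic P κ) {l : EuclideanSpace ℝ (Fin d)}
    (h : annealedLaw P 0 (stayUp l) ≠ 0) :
    ∀ᵐ X ∂(annealedLaw P 0), (∀ b : ℝ, ∃ᶠ n in atTop, b ≤ height l (X n)) →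
      ∃ᶠ n in atTop, IsRegen l X n := by
  have hnull : ∀ N : ℕ, ∀ᵐ X ∂(annealedLaw P 0),
      ¬ ((∀ b : ℝ, ∃ᶠ n in atTop, b ≤ height l (X n)) ∧ ∀ n ≥ N, ¬ IsRegen l X n) := by
    intro N
    rw [ae_iff]
    simp only [not_not]
    refine measure_eq_zero_of_frequently_cyl (c := 1 - annealedLaw P 0 (stayUp l))
      (ENNReal.sub_lt_self ENNReal.one_ne_top one_ne_zero h) ?_
    rintro X ⟨hX1, hX2⟩
    refine ((exists_record_ge hX1).and_eventually (eventually_ge_atTop N)).mono ?_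
    rintro n ⟨hn, hnN⟩
    refine (measure_mono ?_).trans (hP.iid.annealedLaw_cyl_diff_relShift_le hn)
    rintro Y ⟨hY1, hY2, hY3⟩
    refine ⟨hY1, fun hY4 => hY3 n hnN ⟨fun i hi => ?_, relShift_mem_stayUp.1 hY4⟩⟩
    rw [hY1 i hi.le, hY1 n le_rfl]
    exact hn i hi
  filter_upwards [ae_all_iff.2 hnull] with X hX hu
  rw [frequently_atTop]
  intro N
  by_contra! hcon
  exact hX N ⟨hu, hcon⟩

/-- If transience in direction `l` has positive probability, then almost surely the walk is
transient in direction `l` or in direction `-l`. -/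
theorem IsElliptic.ae_mem_transientEvent_or [IsProbabilityMeasure P] {κ : ENNReal}
    (hP : IsElliptic P κ) {l : EuclideanSpace ℝ (Fin d)} (hl : l ≠ 0)
    (h : annealedLaw P 0 (transientEvent l) ≠ 0) :
    ∀ᵐ X ∂(annealedLaw P 0), X ∈ transientEvent l ∨ X ∈ transientEvent (-l) := by
  filter_upwards [hP.ae_frequently_isRegen (hP.annealedLaw_stayUp_ne_zero h),
    hP.ae_frequently_le_height_or_tendsto_atBot hl, hP.ae_mem_transientEvent_of_bddBelow hl]
    with X h1 h2 h3
  rcases h2 with h2 | h2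
  · left
    obtain ⟨n, hn⟩ := (h1 h2).exists
    refine h3 ⟨height l (X n), eventually_atTop.2 ⟨n, fun m hm => ?_⟩⟩
    obtain ⟨i, rfl⟩ := Nat.exists_eq_add_of_le hm
    exact hn.2 i
  · exact Or.inr (mem_transientEvent_neg.2 h2)

/-! ### Crossings of a level -/

/-- The number of upcrossings of the level `k` by `u` before time `n`. -/
noncomputable def upcrossings (k : ℝ) (u : ℕ → ℝ) (n : ℕ) : ℕ :=
  ((Finset.range n).filter fun i => u i < k ∧ k ≤ u (i + 1)).card

/-- The time spent by `u` above the level `k` before time `n`. -/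
noncomputable def occupation (k : ℝ) (u : ℕ → ℝ) (n : ℕ) : ℕ :=
  ((Finset.range n).filter fun i => k ≤ u i).card

theorem upcrossings_mono (k : ℝ) (u : ℕ → ℝ) : Monotone (upcrossings k u) := fun _ _ h =>
  Finset.card_le_card (Finset.filter_subset_filter _ (Finset.range_mono h))

theorem upcrossings_succ {k : ℝ} {u : ℕ → ℝ} {n : ℕ} (h : u n < k) (h' : k ≤ u (n + 1)) :
    upcrossings k u (n + 1) = upcrossings k u n + 1 := by
  simp [upcrossings, Finset.range_add_one, Finset.filter_insert, h, h']

theorem upcrossings_congr {k : ℝ} {u v : ℕ → ℝ} {n : ℕ} (h : ∀ i ≤ n, u i = v i) :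
    upcrossings k u n = upcrossings k v n := by
  unfold upcrossings
  congr 1
  refine Finset.filter_congr fun i hi => ?_
  have hi' := Finset.mem_range.1 hi
  rw [h i hi'.le, h (i + 1) hi']

theorem occupation_succ_of_lt {k : ℝ} {u : ℕ → ℝ} {n : ℕ} (h : u n < k) :
    occupation k u (n + 1) = occupation k u n := by
  simp [occupation, Finset.range_add_one, Finset.filter_insert, not_le.2 h]

theorem occupation_succ_of_le {k : ℝ} {u : ℕ → ℝ} {n : ℕ} (h : k ≤ u n) :
    occupation k u (n + 1) = occupation k u n + 1 := by
  simp [occupation, Finset.range_add_one, Finset.filter_insert, h]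

theorem occupation_add_le (k : ℝ) (u : ℕ → ℝ) (n i : ℕ) :
    occupation k u (n + i) ≤ occupation k u n + i := by
  induction i with
  | zero => simp
  | succ i ih =>
    rcases lt_or_ge (u (n + i)) k with h | h
    · rw [← add_assoc, occupation_succ_of_lt h]; omega
    · rw [← add_assoc, occupation_succ_of_le h]; omega

/-- Above the level the height gains at most one per unit of occupation time, and each new excursion
starts below `k + 1`. -/
theorem lt_add_occupation {k : ℝ} {u : ℕ → ℝ} (h0 : u 0 < k) (hu : ∀ n, u (n + 1) ≤ u n + 1)
    (n : ℕ) : u n < k + occupation k u n + 1 := by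
  induction n with
  | zero =>
    have : (0 : ℝ) ≤ occupation k u 0 := by positivity
    linarith
  | succ n ih =>
    rcases lt_or_ge (u n) k with h | h
    · have : (0 : ℝ) ≤ occupation k u (n + 1) := by positivity
      linarith [hu n]
    · rw [occupation_succ_of_le h]
      push_cast
      linarith [hu n]

/-- If the `j`-th excursion above the level `k` lasts at most `M j` steps for all `j < c`, as long
as the previous ones do, then the occupation time is controlled by the number of upcrossings. -/
theorem occupation_le {k : ℝ} {u : ℕ → ℝ} (h0 : u 0 < k) {m M : ℕ → ℕ} {c : ℕ}
    (hm : ∀ j, m (j + 1) = m j + M j)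
    (h : ∀ n, u n < k → k ≤ u (n + 1) → upcrossings k u n < c →
      occupation k u n ≤ m (upcrossings k u n) → ∃ i ≤ M (upcrossings k u n), u (n + 1 + i) < k)
    (n : ℕ) (hn : upcrossings k u n ≤ c) : occupation k u n ≤ m (upcrossings k u n) := by
  have hmono : Monotone m := monotone_nat_of_le_succ fun j => by rw [hm]; omega
  induction n using Nat.strong_induction_on with
  | _ n ih =>
    rcases n with _ | n
    · simp [occupation]
    rcases lt_or_ge (u n) k with hk | hk
    · rw [occupation_succ_of_lt hk]
      have hle := upcrossings_mono k u (Nat.le_succ n)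
      exact (ih n (Nat.lt_succ_self n) (hle.trans hn)).trans (hmono hle)
    -- `σ` is the last time before `n` below the level, so the excursion running at time `n` started
    -- at `σ + 1`.
    · obtain ⟨σ, hσn, hσ, hσ'⟩ : ∃ σ < n, u σ < k ∧ ∀ i, σ < i → i ≤ n → k ≤ u i := by
        refine ⟨Nat.findGreatest (fun σ => u σ < k) n, ?_, ?_, ?_⟩
        · have hle := Nat.findGreatest_le (P := fun σ => u σ < k) n
          have hsp := Nat.findGreatest_spec (P := fun σ => u σ < k) (Nat.zero_le n) h0
          refine lt_of_le_of_ne hle fun he => ?_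
          rw [he] at hsp
          linarith
        · exact Nat.findGreatest_spec (P := fun σ => u σ < k) (Nat.zero_le n) h0
        · intro i hi hin
          exact not_lt.1 (Nat.findGreatest_is_greatest hi hin)
      have hent : k ≤ u (σ + 1) := hσ' _ (Nat.lt_succ_self σ) hσn
      have hup := upcrossings_succ hσ hent
      have hup' : upcrossings k u σ + 1 ≤ upcrossings k u (n + 1) :=
        hup ▸ upcrossings_mono k u (by omega)
      have hocc := ih σ (by omega) (by omega)
      obtain ⟨i, hi, hi'⟩ := h σ hσ hent (by omega) hocc
      have hin : n < σ + 1 + i := by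
        by_contra hcon
        have := hσ' (σ + 1 + i) (by omega) (by omega)
        linarith
      have h1 := occupation_add_le k u (σ + 1) (n - σ)
      rw [show σ + 1 + (n - σ) = n + 1 by omega, occupation_succ_of_lt hσ] at h1
      calc occupation k u (n + 1) ≤ m (upcrossings k u σ) + M (upcrossings k u σ) := by omega
        _ = m (upcrossings k u σ + 1) := (hm _).symm
        _ ≤ m (upcrossings k u (n + 1)) := hmono hup'

/-- The sum over integer levels of the number of upcrossings is at most the number of steps. -/
theorem sum_upcrossings_le {u : ℕ → ℝ} (hu : ∀ n, u (n + 1) ≤ u n + 1) {ι : Type*}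
    (s : Finset ι) (k : ι → ℕ) (hk : Set.InjOn k s) (n : ℕ) :
    ∑ a ∈ s, upcrossings (k a) u n ≤ n := by
  classical
  simp only [upcrossings, Finset.card_filter]
  rw [Finset.sum_comm]
  refine (Finset.sum_le_card_nsmul _ _ 1 fun i _ => ?_).trans (by simp)
  rw [← Finset.card_filter, Finset.card_le_one]
  intro a ha b hb
  simp only [Finset.mem_filter] at ha hb
  refine hk ha.1 hb.1 ?_
  have h1 : (k a : ℝ) < k b + 1 := by linarith [hu i, ha.2.2, hb.2.1]
  have h2 : (k b : ℝ) < k a + 1 := by linarith [hu i, hb.2.2, ha.2.1]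
  have h1' : k a < k b + 1 := by exact_mod_cast h1
  have h2' : k b < k a + 1 := by exact_mod_cast h2
  omega

/-- The event that the height `k + L` is reached with at most `c` upcrossings of `k` before. -/
def fewCrossings (l : EuclideanSpace ℝ (Fin d)) (k L : ℝ) (c : ℕ) : Set (Path d) :=
  {X | ∃ t, k + L ≤ height l (X t) ∧ upcrossings k (fun n => height l (X n)) t ≤ c}

/-- The event that the `j`-th excursion above the level `k` lasts longer than `M` steps, while the
time spent there before is at most `m`. -/
def longExcursion (l : EuclideanSpace ℝ (Fin d)) (k : ℝ) (j m M : ℕ) : Set (Path d) :=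
  {X | ∃ n, height l (X n) < k ∧ k ≤ height l (X (n + 1)) ∧
    upcrossings k (fun i => height l (X i)) n = j ∧
    occupation k (fun i => height l (X i)) n ≤ m ∧ ∀ i ≤ M, k ≤ height l (X (n + 1 + i))}

/-- Climbing `L` above the level takes more than `m c` units of occupation time. If the first `c`
excursions are all short, `occupation_le` does not leave that much. -/
theorem fewCrossings_inter_walks_subset {l : EuclideanSpace ℝ (Fin d)} (hl : ‖l‖ ≤ 1) {k L : ℝ}
    (hk : 0 < k) {m M : ℕ → ℕ} {c : ℕ} (hm : ∀ j, m (j + 1) = m j + M j) (hL : (m c : ℝ) + 1 ≤ L) :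
    fewCrossings l k L c ∩ walks d ⊆
      ⋃ j ∈ Finset.range c, longExcursion l k j (m j) (M j) ∩ walks d := by
  rintro X ⟨⟨t, ht, htc⟩, hX⟩
  by_contra hcon
  have h0 : height l (X 0) < k := by rwa [hX.1, height_zero]
  have hu : ∀ n, height l (X (n + 1)) ≤ height l (X n) + 1 := fun n =>
    (height_succ_le hX n).trans (by linarith)
  have h1 := occupation_le (u := fun n => height l (X n)) (c := c) (M := M) (m := m) h0 hm (by
    intro n hn hn' hc ho
    by_contra hne
    push Not at hne
    exact hcon (Set.mem_biUnion (Finset.mem_coe.2 (Finset.mem_range.2 hc))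
      ⟨⟨n, hn, hn', rfl, ho, hne⟩, hX⟩)) t htc
  have h2 := lt_add_occupation (u := fun n => height l (X n)) h0 hu t
  have h3 : m (upcrossings k (fun n => height l (X n)) t) ≤ m c :=
    (monotone_nat_of_le_succ fun j => by rw [hm]; omega : Monotone m) htc
  have h4 : (occupation k (fun n => height l (X n)) t : ℝ) ≤ m c := by exact_mod_cast h1.trans h3
  linarith

/-- At the entry into the excursion, the half-space above `k` has been visited at most `m` times.
Decoupling the excursion from the past therefore costs `κ ^ m`, which the factor in `hε` absorbs. -/
theorem IsElliptic.annealedLaw_cyl_inter_longExcursion_le [IsProbabilityMeasure P] {κ : ENNReal}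
    (hP : IsElliptic P κ) {l : EuclideanSpace ℝ (Fin d)} (hl : ‖l‖ ≤ 1) {k : ℝ} (j m M : ℕ)
    {y : Path d} {n₀ : ℕ} (hy : ∀ i < n₀, height l (y i) < k) {ε : ENNReal}
    (hε : annealedLaw P 0 (stayUpTo {x | -1 ≤ height l x} M) ≤ ε * κ ^ m) :
    annealedLaw P 0 (cyl y n₀ ∩ (longExcursion l k j m M ∩ walks d)) ≤
      ε * annealedLaw P 0 (cyl y n₀) := by
  classical
  refine measure_inter_le_of_cyl ?_
  rintro X ⟨hXy, ⟨n, hn1, hn2, hn3, hn4, hn5⟩, hX⟩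
  have hn₀ : n₀ ≤ n + 1 := by
    by_contra hcon
    have := hy (n + 1) (by omega)
    rw [← hXy (n + 1) (by omega)] at this
    linarith
  refine ⟨n + 1, fun Y hY => by
    have := cyl_anti X hn₀ hY
    rwa [cyl_eq_of_mem hXy] at this, ?_⟩
  let S : Set (Site d) := {z | k ≤ height l z}
  have hsub : cyl X (n + 1) ∩ (longExcursion l k j m M ∩ walks d) ⊆
      cyl X (n + 1) ∩ shiftPath (n + 1) ⁻¹' stayUpTo S M := by
    rintro Y ⟨hY, ⟨n', h1, h2, h3, -, h5⟩, -⟩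
    refine ⟨hY, fun i hi => ?_⟩
    have e1 : height l (Y n) < k := by rwa [hY n (Nat.le_succ n)]
    have e2 : k ≤ height l (Y (n + 1)) := by rwa [hY (n + 1) le_rfl]
    have e3 : upcrossings k (fun i => height l (Y i)) n = j := by
      rw [← hn3]
      exact upcrossings_congr fun i hi => by rw [hY i (by omega)]
    -- The entry step raises the upcrossing count above `j`, so only one time can start the
    -- excursion with index `j`.
    have hnn : n = n' := by
      rcases lt_trichotomy n n' with hlt | heq | hlt
      · exfalso
        have a := upcrossings_succ (u := fun i => height l (Y i)) e1 e2
        have b := upcrossings_mono k (fun i => height l (Y i)) (Nat.succ_le_of_lt hlt)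
        simp only [Nat.succ_eq_add_one] at b
        omega
      · exact heq
      · exfalso
        have a := upcrossings_succ (u := fun i => height l (Y i)) h1 h2
        have b := upcrossings_mono k (fun i => height l (Y i)) (Nat.succ_le_of_lt hlt)
        simp only [Nat.succ_eq_add_one] at b
        omega
    subst hnn
    exact h5 i hi
  have hB := hP.annealedLaw_cyl_inter_shiftPath_le 0 (S := S) X (n + 1) m (by
    refine le_trans (le_of_eq ?_) ((occupation_succ_of_lt (u := fun i => height l (X i)) hn1).trans_le
      hn4)
    unfold occupation
    congr) (measurableSet_stayUpTo S M) (isLocal_stayUpTo S (X (n + 1)) M)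
  -- The entry site lies less than one above `k`; this is why `hε` concerns paths above relative
  -- height `-1`.
  have htop : height l (X (n + 1)) < k + 1 := by linarith [height_succ_le (l := l) hX n]
  have hlaw : annealedLaw P (X (n + 1)) (stayUpTo S M) ≤ ε * κ ^ m := by
    refine le_trans ?_ hε
    rw [hP.iid.annealedLaw_eq_map, Measure.map_apply (measurable_translate _)
      (measurableSet_stayUpTo S M)]
    refine measure_mono fun Y hY i hi => ?_
    have : k ≤ height l (X (n + 1) + Y i) := hY i hi
    rw [height_add] at this
    simp only [Set.mem_ofPred_eq]
    linarith
  have hκ : κ ^ m ≠ 0 := pow_ne_zero _ hP.ne_zero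
  have hκ' : κ ^ m ≠ ⊤ := ENNReal.pow_ne_top (hP.le_one.trans_lt ENNReal.one_lt_top).ne
  refine (measure_mono hsub).trans ?_
  rw [← ENNReal.mul_le_mul_iff_right hκ hκ']
  refine hB.trans ?_
  calc _ ≤ annealedLaw P 0 (cyl X (n + 1)) * (ε * κ ^ m) := by gcongr
    _ = _ := by ring

theorem IsElliptic.tendsto_annealedLaw_stayUpTo [IsProbabilityMeasure P] {κ : ENNReal}
    (hP : IsElliptic P κ) {l : EuclideanSpace ℝ (Fin d)} (hl : l ≠ 0)
    (h : annealedLaw P 0 (transientEvent l) = 0) :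
    Tendsto (fun M => annealedLaw P 0 (stayUpTo {x | -1 ≤ height l x} M)) atTop (𝓝 0) := by
  have h0 : annealedLaw P 0 (stay {x | -1 ≤ height l x}) = 0 := by
    have h1 := hP.ae_mem_transientEvent_of_bddBelow hl
    rw [ae_iff] at h1
    refine measure_mono_null ?_ (measure_union_null h h1)
    intro X hX
    by_cases hX' : X ∈ transientEvent l
    · exact Or.inl hX'
    · exact Or.inr fun h2 => hX' (h2 ⟨-1, Eventually.of_forall hX⟩)
  have hset : stay {x | -1 ≤ height l x} = ⋂ M, stayUpTo {x | -1 ≤ height l x} M := by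
    ext X
    simp only [Set.mem_iInter]
    exact ⟨fun hX M i _ => hX i, fun hX i => hX i i le_rfl⟩
  rw [← h0, hset]
  exact tendsto_measure_iInter_atTop (fun M => (measurableSet_stayUpTo _ M).nullMeasurableSet)
    (fun a b hab X hX i hi => hX i (hi.trans hab)) ⟨0, measure_ne_top _ _⟩

/-- If the walk is not transient in direction `l`, then at a fresh level few crossings are
unlikely. -/
theorem IsElliptic.exists_annealedLaw_cyl_inter_fewCrossings_le [IsProbabilityMeasure P]
    {κ : ENNReal} (hP : IsElliptic P κ) {l : EuclideanSpace ℝ (Fin d)} (hl0 : l ≠ 0)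
    (hl : ‖l‖ ≤ 1) (h : annealedLaw P 0 (transientEvent l) = 0) (c : ℕ) {ε : ENNReal}
    (hε : ε ≠ 0) :
    ∃ L : ℕ, 0 < L ∧ ∀ k : ℝ, 0 < k → ∀ (y : Path d) (n₀ : ℕ), (∀ i < n₀, height l (y i) < k) →
      annealedLaw P 0 (cyl y n₀ ∩ fewCrossings l k L c) ≤ ε * annealedLaw P 0 (cyl y n₀) := by
  -- The allowed length is chosen after the time `m` already spent above the level, so that it beats
  -- `κ ^ m`. The `c` excursions share `ε`; for `c = 0` the later sum is empty.
  have hex : ∀ m : ℕ, ∃ M : ℕ, annealedLaw P 0 (stayUpTo {x | -1 ≤ height l x} M) ≤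
      ε / c * κ ^ m := by
    intro m
    have hpos : 0 < ε / c * κ ^ m :=
      pos_iff_ne_zero.2 (mul_ne_zero (ENNReal.div_ne_zero.2 ⟨hε, ENNReal.natCast_ne_top c⟩)
        (pow_ne_zero _ hP.ne_zero))
    exact (((hP.tendsto_annealedLaw_stayUpTo hl0 h).eventually_lt_const hpos).exists).imp
      fun M hM => hM.le
  choose f hf using hex
  -- `m j` bounds the time spent above the level by `j` excursions of permitted length.
  let m : ℕ → ℕ := fun j => Nat.rec 0 (fun _ a => a + f a) j
  have hm : ∀ j, m (j + 1) = m j + f (m j) := fun j => rfl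
  refine ⟨m c + 1, Nat.succ_pos _, fun k hk y n₀ hy => ?_⟩
  have hwalk : annealedLaw P 0 (walks d)ᶜ = 0 := annealedLaw_ae_walks
  have hsub : cyl y n₀ ∩ fewCrossings l k ((m c + 1 : ℕ) : ℝ) c ⊆ (walks d)ᶜ ∪
      ⋃ j ∈ Finset.range c, cyl y n₀ ∩ (longExcursion l k j (m j) (f (m j)) ∩ walks d) := by
    rintro X ⟨hX1, hX2⟩
    by_cases hX : X ∈ walks d
    · right
      have h1 := fewCrossings_inter_walks_subset hl hk (m := m) (M := fun j => f (m j)) hm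
        (by push_cast; exact le_rfl) ⟨hX2, hX⟩
      simp only [Set.mem_iUnion] at h1 ⊢
      obtain ⟨j, hj, hjX⟩ := h1
      exact ⟨j, hj, hX1, hjX⟩
    · exact Or.inl hX
  calc annealedLaw P 0 (cyl y n₀ ∩ fewCrossings l k ((m c + 1 : ℕ) : ℝ) c)
      ≤ annealedLaw P 0 (walks d)ᶜ + ∑ j ∈ Finset.range c,
        annealedLaw P 0 (cyl y n₀ ∩ (longExcursion l k j (m j) (f (m j)) ∩ walks d)) :=
        (measure_mono hsub).trans ((measure_union_le _ _).trans
          (by gcongr; exact measure_biUnion_finset_le _ _))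
    _ ≤ 0 + ∑ j ∈ Finset.range c, ε / c * annealedLaw P 0 (cyl y n₀) := by
        rw [hwalk]
        gcongr with j _
        exact hP.annealedLaw_cyl_inter_longExcursion_le hl j (m j) (f (m j)) hy (hf (m j))
    _ = (c * (ε / c)) * annealedLaw P 0 (cyl y n₀) := by
        rw [zero_add, Finset.sum_const, Finset.card_range, nsmul_eq_mul, mul_assoc]
    _ ≤ ε * annealedLaw P 0 (cyl y n₀) := by
        gcongr
        exact ENNReal.mul_div_le

/-- `fewCrossings` is decided when the height `k + L` is reached. -/
theorem cyl_subset_fewCrossings {l : EuclideanSpace ℝ (Fin d)} {k L : ℝ} {c : ℕ} {X : Path d}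
    (hX : X ∈ fewCrossings l k L c) {n : ℕ} (hn : k + L ≤ height l (X n)) :
    cyl X n ⊆ fewCrossings l k L c := by
  classical
  intro Y hY
  obtain ⟨t, ht, htc⟩ := hX
  have hmin : min t n ≤ n := min_le_right _ _
  refine ⟨min t n, ?_, ?_⟩
  · rw [hY _ hmin]
    rcases min_choice t n with h | h <;> rw [h] <;> assumption
  · rw [upcrossings_congr (v := fun i => height l (X i)) fun i hi => by
      rw [hY i (hi.trans hmin)]]
    exact (upcrossings_mono _ _ (min_le_left _ _)).trans htc

/-- The levels are `L` apart, so the events at lower levels are decided by the time the largest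
level is first reached. There the hypothesis applies conditionally on the past and contributes one
more factor `ε`. -/
theorem annealedLaw_biInter_fewCrossings_le [IsProbabilityMeasure P]
    {l : EuclideanSpace ℝ (Fin d)} {L c : ℕ} {ε : ENNReal}
    (h : ∀ k : ℝ, 0 < k → ∀ (y : Path d) (n₀ : ℕ), (∀ i < n₀, height l (y i) < k) →
      annealedLaw P 0 (cyl y n₀ ∩ fewCrossings l k L c) ≤ ε * annealedLaw P 0 (cyl y n₀))
    (i : ℕ) (J : Finset ℕ) :
    annealedLaw P 0 (⋂ j ∈ J, fewCrossings l ((L * j + i + 1 : ℕ) : ℝ) L c) ≤ ε ^ J.card := by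
  classical
  induction J using Finset.induction_on_max with
  | empty => simp
  | insert a J ha ih =>
    have haJ : a ∉ J := fun hmem => lt_irrefl _ (ha a hmem)
    rw [Finset.card_insert_of_notMem haJ, Finset.set_biInter_insert, Set.inter_comm, pow_succ']
    refine (measure_inter_le_of_cyl (c := ε) ?_).trans (by gcongr)
    rintro X ⟨hX1, hX2⟩
    have hex : ∃ n, ((L * a + i + 1 : ℕ) : ℝ) ≤ height l (X n) := by
      obtain ⟨t, ht, -⟩ := hX2
      exact ⟨t, le_trans (by linarith [(Nat.cast_nonneg L : (0 : ℝ) ≤ L)]) ht⟩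
    refine ⟨Nat.find hex, ?_, h _ (by positivity) X _ fun i hi =>
      not_le.1 (Nat.find_min hex hi)⟩
    refine Set.subset_iInter₂ fun j hj => cyl_subset_fewCrossings (Set.mem_iInter₂.1 hX1 j hj) ?_
    refine le_trans ?_ (Nat.find_spec hex)
    have : L * (j + 1) ≤ L * a := Nat.mul_le_mul_left _ (ha j hj)
    have h2 : L * j + i + 1 + L ≤ L * a + i + 1 := by rw [mul_add] at this; omega
    exact_mod_cast h2

open Classical in
-- Union bound and Borel–Cantelli: there are at most `2 ^ r` index sets, and one with at least `r /
-- 4` elements has probability at most `4⁻¹ ^ r`. This is where `ε = 4⁻¹ ^ 4` comes from.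
theorem ae_eventually_card_fewCrossings [IsProbabilityMeasure P]
    {l : EuclideanSpace ℝ (Fin d)} {L c : ℕ}
    (h : ∀ k : ℝ, 0 < k → ∀ (y : Path d) (n₀ : ℕ), (∀ i < n₀, height l (y i) < k) →
      annealedLaw P 0 (cyl y n₀ ∩ fewCrossings l k L c) ≤
        (4⁻¹ : ENNReal) ^ 4 * annealedLaw P 0 (cyl y n₀)) (i : ℕ) :
    ∀ᵐ X ∂(annealedLaw P 0), ∀ᶠ r in atTop, 4 * ((Finset.range r).filter fun j =>
      X ∈ fewCrossings l ((L * j + i + 1 : ℕ) : ℝ) L c).card < r := by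
  have hbound : ∀ r : ℕ, annealedLaw P 0 {X | r ≤ 4 * ((Finset.range r).filter fun j =>
      X ∈ fewCrossings l ((L * j + i + 1 : ℕ) : ℝ) L c).card} ≤ (2⁻¹ : ENNReal) ^ r := by
    intro r
    have hsub : {X | r ≤ 4 * ((Finset.range r).filter fun j =>
        X ∈ fewCrossings l ((L * j + i + 1 : ℕ) : ℝ) L c).card} ⊆
        ⋃ J ∈ (Finset.range r).powerset.filter fun J => r ≤ 4 * J.card,
          ⋂ j ∈ J, fewCrossings l ((L * j + i + 1 : ℕ) : ℝ) L c := by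
      intro X hX
      refine Set.mem_biUnion (x := (Finset.range r).filter fun j =>
        X ∈ fewCrossings l ((L * j + i + 1 : ℕ) : ℝ) L c) ?_ ?_
      · rw [Finset.mem_coe, Finset.mem_filter, Finset.mem_powerset]
        exact ⟨Finset.filter_subset _ _, hX⟩
      · exact Set.mem_iInter₂.2 fun j hj => (Finset.mem_filter.1 hj).2
    calc _ ≤ ∑ J ∈ (Finset.range r).powerset.filter fun J => r ≤ 4 * J.card,
          annealedLaw P 0 (⋂ j ∈ J, fewCrossings l ((L * j + i + 1 : ℕ) : ℝ) L c) :=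
          (measure_mono hsub).trans (measure_biUnion_finset_le _ _)
      _ ≤ ∑ J ∈ (Finset.range r).powerset.filter fun J => r ≤ 4 * J.card, (4⁻¹ : ENNReal) ^ r := by
          refine Finset.sum_le_sum fun J hJ => ?_
          refine (annealedLaw_biInter_fewCrossings_le h i J).trans ?_
          rw [← pow_mul]
          exact pow_le_pow_right_of_le_one' (by simp) (Finset.mem_filter.1 hJ).2
      _ ≤ (2 : ENNReal) ^ r * (4⁻¹ : ENNReal) ^ r := by
          rw [Finset.sum_const, nsmul_eq_mul]
          gcongr
          have := (Finset.card_filter_le (Finset.range r).powerset fun J => r ≤ 4 * J.card)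
          rw [Finset.card_powerset, Finset.card_range] at this
          exact_mod_cast this
      _ = (2⁻¹ : ENNReal) ^ r := by
          rw [← mul_pow]
          congr 1
          rw [show (4 : ENNReal) = 2 * 2 by norm_num, ENNReal.mul_inv (by simp) (by simp),
            ← mul_assoc, ENNReal.mul_inv_cancel (by simp) (by simp), one_mul]
  have hsum : ∑' r : ℕ, annealedLaw P 0 {X | r ≤ 4 * ((Finset.range r).filter fun j =>
      X ∈ fewCrossings l ((L * j + i + 1 : ℕ) : ℝ) L c).card} ≠ ⊤ := by
    refine ne_top_of_le_ne_top ?_ (ENNReal.tsum_le_tsum hbound)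
    rw [ENNReal.tsum_geometric]
    simp
  filter_upwards [ae_eventually_notMem hsum] with X hX
  filter_upwards [hX] with r hr
  exact not_le.1 hr

open Classical in
theorem eventually_lt_of_card_fewCrossings {l : EuclideanSpace ℝ (Fin d)} (hl : ‖l‖ ≤ 1) {L c : ℕ}
    (hL : 0 < L) {X : Path d} (hX : X ∈ walks d)
    (h : ∀ i < L, ∀ᶠ r in atTop, 4 * ((Finset.range r).filter fun j =>
      X ∈ fewCrossings l ((L * j + i + 1 : ℕ) : ℝ) L c).card < r) {α : ℝ} (hα : 0 < α)
    (hc : 4 ≤ α * c) : ∀ᶠ n : ℕ in atTop, height l (X n) < α * n := by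
  have hall : ∀ᶠ r in atTop, ∀ i ∈ Finset.range L, 4 * ((Finset.range r).filter fun j =>
      X ∈ fewCrossings l ((L * j + i + 1 : ℕ) : ℝ) L c).card < r :=
    (eventually_all_finset _).2 fun i hi => h i (Finset.mem_range.1 hi)
  obtain ⟨R, hR⟩ := eventually_atTop.1 hall
  have hu : ∀ n, height l (X (n + 1)) ≤ height l (X n) + 1 := fun n =>
    (height_succ_le hX n).trans (by linarith)
  have hL' : (0 : ℝ) < L := by exact_mod_cast hL
  have hlarge : ∀ᶠ n : ℕ in atTop, (L : ℝ) * (R + 4) ≤ α * n :=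
    (tendsto_natCast_atTop_atTop.const_mul_atTop hα).eventually_ge_atTop _
  filter_upwards [hlarge] with n hn
  by_contra hcon
  push Not at hcon
  set v := height l (X n) with hv
  have hvL : (R : ℝ) + 4 ≤ v / L := by
    rw [le_div_iff₀ hL']
    linarith
  set q := ⌊v / L⌋₊ with hq
  have hqR : R + 4 ≤ q := Nat.le_floor (by push_cast; exact hvL)
  obtain ⟨r, hr⟩ : ∃ r, q = r + 1 := ⟨q - 1, by omega⟩
  have hrv : (L : ℝ) * (r + 1) ≤ v := by
    have h1 : ((q : ℕ) : ℝ) ≤ v / L := Nat.floor_le (by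
      have : (0 : ℝ) ≤ R := Nat.cast_nonneg R
      linarith)
    rw [hr, le_div_iff₀ hL'] at h1
    push_cast at h1
    linarith
  have hrv' : v < L * (r + 2) := by
    have h1 : v / L < (q : ℝ) + 1 := Nat.lt_floor_add_one _
    rw [hr, div_lt_iff₀ hL'] at h1
    push_cast at h1
    linarith
  -- In each residue class modulo `L`, more than three quarters of the `r` levels have not been left
  -- behind with at most `c` upcrossings. All these levels plus `L` lie below `v`, so each such
  -- level has at least `c + 1` upcrossings before time `n`.
  have hmany : ∀ i ∈ Finset.range L, (c + 1) * (3 * r) ≤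
      4 * ∑ j ∈ Finset.range r,
        upcrossings ((L * j + i + 1 : ℕ) : ℝ) (fun n => height l (X n)) n := by
    intro i hi
    have h1 := hR r (by omega) i hi
    have h2 := Finset.card_filter_add_card_filter_not (s := Finset.range r) fun j =>
      X ∈ fewCrossings l ((L * j + i + 1 : ℕ) : ℝ) L c
    rw [Finset.card_range] at h2
    have h3 : ((Finset.range r).filter fun j =>
        X ∉ fewCrossings l ((L * j + i + 1 : ℕ) : ℝ) L c).card * (c + 1) ≤
        ∑ j ∈ Finset.range r,
          upcrossings ((L * j + i + 1 : ℕ) : ℝ) (fun n => height l (X n)) n := by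
      rw [← smul_eq_mul]
      refine (Finset.card_nsmul_le_sum _ _ _ fun j hj => ?_).trans
        (Finset.sum_le_sum_of_subset (Finset.filter_subset _ _))
      rw [Finset.mem_filter, Finset.mem_range] at hj
      by_contra hlt
      refine hj.2 ⟨n, le_trans ?_ hrv, by omega⟩
      have h4 : L * (j + 1) ≤ L * r := Nat.mul_le_mul_left _ hj.1
      have h5 : L * j + i + 1 + L ≤ L * (r + 1) := by
        have := Finset.mem_range.1 hi
        rw [mul_add] at h4 ⊢
        omega
      exact_mod_cast h5
    calc (c + 1) * (3 * r) ≤ (c + 1) * (4 * ((Finset.range r).filter fun j =>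
        X ∉ fewCrossings l ((L * j + i + 1 : ℕ) : ℝ) L c).card) :=
          Nat.mul_le_mul_left _ (by omega)
      _ = 4 * (((Finset.range r).filter fun j =>
        X ∉ fewCrossings l ((L * j + i + 1 : ℕ) : ℝ) L c).card * (c + 1)) := by ring
      _ ≤ _ := Nat.mul_le_mul_left _ h3
  -- The levels `L * j + i + 1` with `i < L` are distinct integers, so their upcrossings use
  -- different steps. With `α * n ≤ v < L * (r + 2)` and `4 ≤ α * c` this leads to `r < 1`.
  have htotal : L * ((c + 1) * (3 * r)) ≤ 4 * n := by
    have h1 := Finset.card_nsmul_le_sum _ _ _ hmany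
    rw [Finset.card_range, smul_eq_mul, ← Finset.mul_sum, ← Finset.sum_product'] at h1
    refine h1.trans (Nat.mul_le_mul_left _ ?_)
    refine sum_upcrossings_le hu _ (fun p : ℕ × ℕ => L * p.2 + p.1 + 1) ?_ n
    rintro ⟨i, j⟩ hp ⟨i', j'⟩ hp' heq
    simp only [Finset.coe_product, Finset.coe_range, Set.mem_prod, Set.mem_Iio] at hp hp'
    have heq' : L * j + i = L * j' + i' := Nat.succ_injective heq
    have e1 : i = i' := by
      have := congrArg (· % L) heq'
      simpa [Nat.mul_add_mod, Nat.mod_eq_of_lt hp.1, Nat.mod_eq_of_lt hp'.1] using this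
    subst e1
    have e2 : j = j' := Nat.eq_of_mul_eq_mul_left hL (by omega)
    rw [e2]
  have htotal' : (L : ℝ) * ((c + 1) * (3 * r)) ≤ 4 * n := by exact_mod_cast htotal
  have hr1 : (1 : ℝ) ≤ r := by
    have : 1 ≤ r := by omega
    exact_mod_cast this
  have h1 : α * ((L : ℝ) * ((c + 1) * (3 * r))) ≤ α * (4 * n) :=
    mul_le_mul_of_nonneg_left htotal' hα.le
  have h2 : 4 * ((L : ℝ) * (3 * r)) ≤ (α * c) * (L * (3 * r)) := by gcongr
  have h3 : 0 ≤ α * ((L : ℝ) * (3 * r)) := by positivity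
  have h4 : (L : ℝ) * 1 ≤ L * r := by gcongr
  nlinarith

/-- If the walk is almost surely not transient in direction `l`, then its speed in that direction
is at most zero. -/
theorem IsElliptic.ae_eventually_height_le [IsProbabilityMeasure P]
    {κ : ENNReal} (hP : IsElliptic P κ) {l : EuclideanSpace ℝ (Fin d)} (hl : l ≠ 0)
    (h : annealedLaw P 0 (transientEvent l) = 0) :
    ∀ᵐ X ∂(annealedLaw P 0), ∀ α > 0, ∀ᶠ n : ℕ in atTop, height l (X n) ≤ α * n := by
  have unit : ∀ l : EuclideanSpace ℝ (Fin d), ‖l‖ = 1 →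
      annealedLaw P 0 (transientEvent l) = 0 → ∀ (q : ℕ), ∀ᵐ X ∂(annealedLaw P 0),
        ∀ᶠ n : ℕ in atTop, height l (X n) < (1 / (q + 1) : ℝ) * n := by
    intro l hl h q
    -- The number `4 * (q + 1)` of crossings is what the speed bound `α = 1 / (q + 1)` requires.
    obtain ⟨L, hL, hLk⟩ := hP.exists_annealedLaw_cyl_inter_fewCrossings_le
      (norm_ne_zero_iff.1 (by rw [hl]; exact one_ne_zero)) hl.le h (4 * (q + 1))
      (ε := (4⁻¹ : ENNReal) ^ 4) (by simp)
    filter_upwards [annealedLaw_ae_walks, ae_all_iff.2 (ae_eventually_card_fewCrossings hLk)]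
      with X hX hX'
    refine eventually_lt_of_card_fewCrossings hl.le hL hX (fun i _ => hX' i) (by positivity) ?_
    push_cast
    field_simp
    exact le_rfl
  have hn : 0 < ‖l‖ := norm_pos_iff.2 hl
  have hnull : annealedLaw P 0 (transientEvent (‖l‖⁻¹ • l)) = 0 := by
    refine measure_mono_null (fun X hX => ?_) h
    rw [mem_transientEvent] at hX ⊢
    simp only [height_smul_dir] at hX
    refine (hX.const_mul_atTop hn).congr fun n => ?_
    field_simp
  filter_upwards [ae_all_iff.2 (unit (‖l‖⁻¹ • l) (by
    rw [norm_smul, norm_inv, norm_norm, inv_mul_cancel₀ hn.ne']) hnull)] with X hX α hα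
  obtain ⟨q, hq⟩ := exists_nat_one_div_lt (div_pos hα hn)
  filter_upwards [hX q] with n hn'
  rw [height_smul_dir] at hn'
  have h1 : ‖l‖⁻¹ * height l (X n) ≤ α / ‖l‖ * n :=
    hn'.le.trans (mul_le_mul_of_nonneg_right hq.le (Nat.cast_nonneg n))
  calc height l (X n) = ‖l‖ * (‖l‖⁻¹ * height l (X n)) := by field_simp
    _ ≤ ‖l‖ * (α / ‖l‖ * n) := by gcongr
    _ = α * n := by field_simp

/-! ### The strong law with infinite mean -/

/-- Truncate at `b`: the averages dominate those of `min (Y i) b`, whose limits grow without bound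
in `b` by monotone convergence. -/
theorem tendsto_sum_div_atTop_of_not_integrable {Ω : Type*} [MeasurableSpace Ω] {μ : Measure Ω}
    [IsProbabilityMeasure μ] (Y : ℕ → Ω → ℝ) (hY : Measurable (Y 0)) (h0 : ∀ i ω, 0 ≤ Y i ω)
    (hint : ¬ Integrable (Y 0) μ) (hindep : Pairwise fun i j => IndepFun (Y i) (Y j) μ)
    (hident : ∀ i, IdentDistrib (Y i) (Y 0) μ μ) :
    ∀ᵐ ω ∂μ, Tendsto (fun n : ℕ => (∑ i ∈ Finset.range n, Y i ω) / n) atTop atTop := by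
  have htop : ∫⁻ ω, ENNReal.ofReal (Y 0 ω) ∂μ = ⊤ := by
    by_contra hne
    refine hint ⟨hY.aestronglyMeasurable, ?_⟩
    rw [hasFiniteIntegral_iff_ofReal (Eventually.of_forall (h0 0))]
    exact lt_top_iff_ne_top.2 hne
  have hcut : ∀ b : ℕ, Measurable fun x : ℝ => min x b := fun b => measurable_id.min measurable_const
  have hintb : ∀ b : ℕ, Integrable (fun ω => min (Y 0 ω) b) μ := by
    intro b
    refine Integrable.of_bound ((hcut b).comp hY).aestronglyMeasurable b
      (Eventually.of_forall fun ω => ?_)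
    rw [Real.norm_of_nonneg (le_min (h0 0 ω) (Nat.cast_nonneg b))]
    exact min_le_right _ _
  have hslln : ∀ b : ℕ, ∀ᵐ ω ∂μ, Tendsto (fun n : ℕ =>
      (∑ i ∈ Finset.range n, min (Y i ω) b) / n) atTop (𝓝 (∫ ω, min (Y 0 ω) b ∂μ)) := fun b =>
    strong_law_ae_real (fun i ω => min (Y i ω) b) (hintb b)
      (fun i j hij => (hindep hij).comp (hcut b) (hcut b)) fun i => (hident i).comp (hcut b)
  have hlarge : ∀ M : ℝ, ∃ b : ℕ, M < ∫ ω, min (Y 0 ω) b ∂μ := by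
    intro M
    have hmono : Tendsto (fun b : ℕ => ∫⁻ ω, ENNReal.ofReal (min (Y 0 ω) b) ∂μ) atTop
        (𝓝 (∫⁻ ω, ENNReal.ofReal (Y 0 ω) ∂μ)) := by
      refine lintegral_tendsto_of_tendsto_of_monotone
        (fun b => (((hcut b).comp hY).ennreal_ofReal).aemeasurable)
        (Eventually.of_forall fun ω b b' hb => ENNReal.ofReal_le_ofReal
          (min_le_min_left _ (by exact_mod_cast hb))) (Eventually.of_forall fun ω => ?_)
      refine tendsto_const_nhds.congr' ?_
      obtain ⟨b, hb⟩ := exists_nat_ge (Y 0 ω)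
      filter_upwards [eventually_ge_atTop b] with b' hb'
      rw [min_eq_left (hb.trans (by exact_mod_cast hb'))]
    rw [htop] at hmono
    obtain ⟨b, hb⟩ := (hmono.eventually_const_lt (ENNReal.ofReal_lt_top (r := M))).exists
    refine ⟨b, ?_⟩
    rw [← ofReal_integral_eq_lintegral_ofReal (hintb b) (Eventually.of_forall fun ω =>
      le_min (h0 0 ω) (Nat.cast_nonneg b))] at hb
    exact lt_of_not_ge fun hle => not_lt.2 (ENNReal.ofReal_le_ofReal hle) hb
  filter_upwards [ae_all_iff.2 hslln] with ω hω
  rw [tendsto_atTop]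
  intro M
  obtain ⟨b, hb⟩ := hlarge M
  filter_upwards [(hω b).eventually_const_lt hb] with n hn
  refine hn.le.trans ?_
  gcongr with i _
  exact min_le_left _ _

/-! ### Interpolation along a sequence of times -/

theorem exists_mem_Ico_of_strictMono {N : ℕ → ℕ} (hN : StrictMono N) (h0 : N 0 = 0) (n : ℕ) :
    ∃ k, N k ≤ n ∧ n < N (k + 1) := by
  have hex : ∃ k, n < N (k + 1) := ⟨n, lt_of_lt_of_le (Nat.lt_succ_self n) (hN.le_apply)⟩
  classical
  refine ⟨Nat.find hex, ?_, Nat.find_spec hex⟩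
  rcases hk : Nat.find hex with _ | k
  · rw [h0]; exact Nat.zero_le n
  · exact not_lt.1 (Nat.find_min hex (hk ▸ Nat.lt_succ_self k))

/-- Both bounds are products of `u (N k) / k`, `k / N k` and ratios of consecutive integers. The
ratio `N (k + 1) / N k` never enters; this matters when `ρ = 0`, where it need not tend to one. -/
theorem tendsto_div_of_interpolation {u : ℕ → ℝ} {N : ℕ → ℕ} (hN : StrictMono N) (h0 : N 0 = 0)
    (hu0 : ∀ n, 0 ≤ u n) (hu : ∀ k n, N k ≤ n → n < N (k + 1) → u (N k) ≤ u n ∧ u n ≤ u (N (k + 1)))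
    {a ρ : ℝ} (hρ : Tendsto (fun k : ℕ => (k : ℝ) / N k) atTop (𝓝 ρ))
    (ha : Tendsto (fun k : ℕ => u (N k) / k) atTop (𝓝 a)) :
    Tendsto (fun n : ℕ => u n / n) atTop (𝓝 (a * ρ)) := by
  choose K hK1 hK2 using exists_mem_Ico_of_strictMono hN h0
  have hKtop : Tendsto K atTop atTop := by
    rw [tendsto_atTop]
    intro b
    filter_upwards [eventually_ge_atTop (N b)] with n hn
    have := hN.lt_iff_lt.1 (lt_of_le_of_lt hn (hK2 n))
    omega
  have h1 : Tendsto (fun k : ℕ => ((k : ℝ) + 1) / k) atTop (𝓝 1) := by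
    have := tendsto_natCast_div_add_atTop (1 : ℝ)
    have h2 := this.inv₀ one_ne_zero
    rw [inv_one] at h2
    exact h2.congr fun k => by rw [inv_div]
  have h1' : Tendsto (fun k : ℕ => (k : ℝ) / (k + 1)) atTop (𝓝 1) :=
    tendsto_natCast_div_add_atTop (1 : ℝ)
  have ha' : Tendsto (fun k : ℕ => u (N (k + 1)) / ((k : ℝ) + 1)) atTop (𝓝 a) := by
    have := ha.comp (tendsto_add_atTop_nat 1)
    exact this.congr fun k => by simp
  have hρ' : Tendsto (fun k : ℕ => ((k : ℝ) + 1) / N (k + 1)) atTop (𝓝 ρ) := by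
    have := hρ.comp (tendsto_add_atTop_nat 1)
    exact this.congr fun k => by simp
  have hpos : ∀ {k : ℕ}, 0 < k → (0 : ℝ) < N k := fun {k} hk => by
    have : N 0 < N k := hN hk
    rw [h0] at this
    exact_mod_cast this
  have hupper : Tendsto (fun k : ℕ => u (N (k + 1)) / N k) atTop (𝓝 (a * ρ)) := by
    have := (ha'.mul h1).mul hρ
    rw [mul_one] at this
    refine this.congr' ?_
    filter_upwards [eventually_gt_atTop 0] with k hk
    have h2 := hpos hk
    have h3 : (0 : ℝ) < k := by exact_mod_cast hk
    field_simp
  have hlower : Tendsto (fun k : ℕ => u (N k) / N (k + 1)) atTop (𝓝 (a * ρ)) := by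
    have := (ha.mul h1').mul hρ'
    rw [mul_one] at this
    refine this.congr' ?_
    filter_upwards [eventually_gt_atTop 0] with k hk
    have h2 := hpos (Nat.succ_pos k)
    have h3 : (0 : ℝ) < k := by exact_mod_cast hk
    field_simp
  refine tendsto_of_tendsto_of_tendsto_of_le_of_le' (hlower.comp hKtop) (hupper.comp hKtop) ?_ ?_
  · filter_upwards [eventually_gt_atTop 0] with n hn
    have hn' : (0 : ℝ) < n := by exact_mod_cast hn
    have h4 : (n : ℝ) ≤ N (K n + 1) := by exact_mod_cast (hK2 n).le
    exact div_le_div₀ (hu0 _) (hu _ n (hK1 n) (hK2 n)).1 hn' h4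
  · filter_upwards [hKtop.eventually_gt_atTop 0] with n hn
    have h4 : (N (K n) : ℝ) ≤ n := by exact_mod_cast hK1 n
    exact div_le_div₀ (hu0 _) (hu _ n (hK1 n) (hK2 n)).2 (hpos hn) h4

/-! ### The regeneration structure -/

/-- The first positive regeneration time (zero if there is none). -/
noncomputable def regenTime (l : EuclideanSpace ℝ (Fin d)) (X : Path d) : ℕ :=
  sInf {n | 0 < n ∧ IsRegen l X n}

/-- The path seen from its first positive regeneration time. -/
noncomputable def regenShift (l : EuclideanSpace ℝ (Fin d)) (X : Path d) : Path d :=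
  relShift (regenTime l X) X

/-- The first positive regeneration time and the height reached then. -/
noncomputable def regenPair (l : EuclideanSpace ℝ (Fin d)) (X : Path d) : ℕ × ℝ :=
  (regenTime l X, height l (X (regenTime l X)))

/-- The paths whose first `n` steps look as if `n` were the first positive regeneration time. -/
def preRegen (l : EuclideanSpace ℝ (Fin d)) (n : ℕ) : Set (Path d) :=
  {X | (∀ i ≤ n, 0 ≤ height l (X i)) ∧ (∀ i < n, height l (X i) < height l (X n)) ∧
    ∀ i, 0 < i → i < n → ¬ ((∀ j < i, height l (X j) < height l (X i)) ∧
      ∀ j, i ≤ j → j ≤ n → height l (X i) ≤ height l (X j))}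

/-- Positivity of `n` excludes the value `0` that `sInf` takes on the empty set. -/
theorem regenTime_eq_iff {l : EuclideanSpace ℝ (Fin d)} {X : Path d} {n : ℕ} (hn : 0 < n) :
    regenTime l X = n ↔ IsRegen l X n ∧ ∀ i, 0 < i → i < n → ¬ IsRegen l X i := by
  constructor
  · rintro rfl
    have hne : {n | 0 < n ∧ IsRegen l X n}.Nonempty := Nat.nonempty_of_pos_sInf hn
    exact ⟨(Nat.sInf_mem hne).2, fun i hi hin hreg => Nat.notMem_of_lt_sInf hin ⟨hi, hreg⟩⟩
  · rintro ⟨h1, h2⟩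
    refine le_antisymm (Nat.sInf_le ⟨hn, h1⟩) ?_
    by_contra hlt
    have hne : {n | 0 < n ∧ IsRegen l X n}.Nonempty := ⟨n, hn, h1⟩
    have := Nat.sInf_mem hne
    exact h2 _ this.1 (not_le.1 hlt) this.2

theorem isRegen_regenTime {l : EuclideanSpace ℝ (Fin d)} {X : Path d} (h : 0 < regenTime l X) :
    IsRegen l X (regenTime l X) := ((regenTime_eq_iff h).1 rfl).1

/-- Since the future of a regeneration stays above its height, whether an earlier record gets
undercut is already decided at time `n`. The event thus splits into a condition on the past and
staying up afterwards. -/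
theorem mem_stayUp_and_regenTime_eq_iff {l : EuclideanSpace ℝ (Fin d)} {X : Path d} {n : ℕ}
    (hn : 0 < n) : X ∈ stayUp l ∧ regenTime l X = n ↔
      X ∈ preRegen l n ∧ relShift n X ∈ stayUp l := by
  rw [regenTime_eq_iff hn, relShift_mem_stayUp]
  constructor
  · rintro ⟨h1, h2, h3⟩
    refine ⟨⟨fun i _ => h1 i, h2.1, fun i hi hin hcon => h3 i hi hin ⟨hcon.1, fun j => ?_⟩⟩, h2.2⟩
    rcases le_or_gt (i + j) n with hj | hj
    · exact hcon.2 _ (by omega) hj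
    · obtain ⟨k, hk⟩ := Nat.exists_eq_add_of_lt hj
      rw [show i + j = n + (k + 1) by omega]
      exact (hcon.2 n hin.le le_rfl).trans (h2.2 _)
  · rintro ⟨⟨h1, h2, h3⟩, h4⟩
    refine ⟨fun i => ?_, ⟨h2, h4⟩, fun i hi hin hreg => h3 i hi hin ⟨hreg.1, fun j hj _ => ?_⟩⟩
    · rcases le_or_gt i n with hj | hj
      · exact h1 i hj
      · obtain ⟨k, rfl⟩ := Nat.exists_eq_add_of_le hj.le
        exact (h1 n le_rfl).trans (h4 k)
    · obtain ⟨k, rfl⟩ := Nat.exists_eq_add_of_le hj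
      exact hreg.2 k

theorem cyl_subset_preRegen {l : EuclideanSpace ℝ (Fin d)} {X : Path d} {n : ℕ}
    (hX : X ∈ preRegen l n) : cyl X n ⊆ preRegen l n := by
  rintro Y hY
  refine ⟨fun i hi => by rw [hY i hi]; exact hX.1 i hi,
    fun i hi => by rw [hY i hi.le, hY n le_rfl]; exact hX.2.1 i hi, fun i hi hin hcon => ?_⟩
  refine hX.2.2 i hi hin ⟨fun j hj => ?_, fun j hj hjn => ?_⟩
  · rw [← hY j (by omega), ← hY i hin.le]
    exact hcon.1 j hj
  · rw [← hY j hjn, ← hY i hin.le]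
    exact hcon.2 j hj hjn

theorem measurableSet_height_rel (l : EuclideanSpace ℝ (Fin d)) (i j : ℕ) (r : ℝ → ℝ → Prop) :
    MeasurableSet {X : Path d | r (height l (X i)) (height l (X j))} := by
  have hm : Measurable fun X : Path d => (X i, X j) :=
    (measurable_coord i).prodMk (measurable_coord j)
  exact hm (t := {p | r (height l p.1) (height l p.2)}) (Set.to_countable _).measurableSet

theorem measurableSet_isRegen (l : EuclideanSpace ℝ (Fin d)) (n : ℕ) :
    MeasurableSet {X : Path d | IsRegen l X n} := by
  simp only [IsRegen, Set.ofPred_and, Set.ofPred_forall]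
  exact (MeasurableSet.iInter fun i => .iInter fun _ => measurableSet_height_rel l i n (· < ·)).inter
    (.iInter fun i => measurableSet_height_rel l n (n + i) (· ≤ ·))

theorem measurable_regenTime (l : EuclideanSpace ℝ (Fin d)) : Measurable (regenTime l) := by
  have hpos : ∀ n, 0 < n → MeasurableSet (regenTime l ⁻¹' {n}) := by
    intro n hn
    have : regenTime l ⁻¹' {n} = {X | IsRegen l X n} ∩
        ⋂ i, ⋂ (_ : 0 < i), ⋂ (_ : i < n), {X | IsRegen l X i}ᶜ := by
      ext X
      simp [regenTime_eq_iff hn]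
    rw [this]
    exact (measurableSet_isRegen l n).inter (.iInter fun i => .iInter fun _ => .iInter fun _ =>
      (measurableSet_isRegen l i).compl)
  refine measurable_to_countable' fun n => ?_
  rcases Nat.eq_zero_or_pos n with rfl | hn
  · have : regenTime l ⁻¹' {0} = (⋃ n, regenTime l ⁻¹' {n + 1})ᶜ := by
      ext X
      simp only [Set.mem_preimage, Set.mem_singleton_iff, Set.mem_compl_iff, Set.mem_iUnion,
        not_exists]
      constructor
      · intro h n
        omega
      · intro h
        by_contra h0
        exact h (regenTime l X - 1) (by omega)
    rw [this]
    exact (MeasurableSet.iUnion fun n => hpos (n + 1) (Nat.succ_pos n)).compl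
  · exact hpos n hn

theorem measurable_coord_at {f : Path d → ℕ} (hf : Measurable f) :
    Measurable fun X : Path d => X (f X) := by
  have h : Measurable fun p : ℕ × Path d => p.2 p.1 :=
    measurable_from_prod_countable_right fun n => measurable_pi_apply n
  exact h.comp (hf.prodMk measurable_id)

theorem measurable_regenShift (l : EuclideanSpace ℝ (Fin d)) : Measurable (regenShift l) :=
  measurable_pi_lambda _ fun i =>
    (measurable_coord_at ((measurable_regenTime l).add_const i)).sub
      (measurable_coord_at (measurable_regenTime l))

theorem measurable_regenPair (l : EuclideanSpace ℝ (Fin d)) : Measurable (regenPair l) :=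
  (measurable_regenTime l).prodMk ((measurable_of_countable (height l)).comp
    (measurable_coord_at (measurable_regenTime l)))

/-! ### Independence of the regeneration increments -/

/-- The annealed law conditioned on never going below height zero. -/
noncomputable def upLaw (P : Measure (Env d)) (l : EuclideanSpace ℝ (Fin d)) : Measure (Path d) :=
  (annealedLaw P 0)[|stayUp l]

theorem isProbabilityMeasure_upLaw [IsProbabilityMeasure P] {l : EuclideanSpace ℝ (Fin d)}
    (h : annealedLaw P 0 (stayUp l) ≠ 0) : IsProbabilityMeasure (upLaw P l) :=
  cond_isProbabilityMeasure h

theorem upLaw_absolutelyContinuous (l : EuclideanSpace ℝ (Fin d)) :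
    upLaw P l ≪ annealedLaw P 0 := cond_absolutelyContinuous

theorem upLaw_ae_mem_stayUp (l : EuclideanSpace ℝ (Fin d)) :
    ∀ᵐ X ∂(upLaw P l), X ∈ stayUp l := ae_cond_mem (measurableSet_stayUp l)

theorem annealedLaw_ae_of_upLaw_ae [IsProbabilityMeasure P] {l : EuclideanSpace ℝ (Fin d)}
    {p : Path d → Prop} (h : ∀ᵐ X ∂(upLaw P l), p X) :
    ∀ᵐ X ∂(annealedLaw P 0), X ∈ stayUp l → p X := by
  rw [ae_iff, upLaw, cond_apply (measurableSet_stayUp l), mul_eq_zero] at h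
  rw [ae_iff]
  refine measure_mono_null (fun X hX => ?_)
    (h.resolve_left (ENNReal.inv_ne_zero.2 (measure_ne_top _ _)))
  simpa using hX

theorem IsElliptic.upLaw_ae_regenTime_pos [IsProbabilityMeasure P] {κ : ENNReal}
    (hP : IsElliptic P κ) {l : EuclideanSpace ℝ (Fin d)} (hl : l ≠ 0)
    (h : annealedLaw P 0 (stayUp l) ≠ 0) : ∀ᵐ X ∂(upLaw P l), 0 < regenTime l X := by
  filter_upwards [upLaw_ae_mem_stayUp l,
    (upLaw_absolutelyContinuous l).ae_le (hP.ae_mem_transientEvent_of_bddBelow hl),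
    (upLaw_absolutelyContinuous l).ae_le (hP.ae_frequently_isRegen h)] with X h1 h2 h3
  have h4 := h3 fun b => ((h2 ⟨0, Eventually.of_forall h1⟩).eventually_ge_atTop b).frequently
  obtain ⟨n, hn, hn'⟩ := (frequently_atTop.1 h4) 1
  exact (Nat.sInf_mem (s := {n | 0 < n ∧ IsRegen l X n}) ⟨n, hn, hn'⟩).1

/-- Split according to the value of the regeneration time. Each possible value is a strict record,
so the renewal property applies, and the factor for the future is the same for all values. -/
theorem IsElliptic.annealedLaw_stayUp_inter_regen [IsProbabilityMeasure P] {κ : ENNReal}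
    (hP : IsElliptic P κ) {l : EuclideanSpace ℝ (Fin d)} (hl : l ≠ 0)
    (h : annealedLaw P 0 (stayUp l) ≠ 0) {s : Set (ℕ × ℝ)} (hs : MeasurableSet s)
    {F : Set (Path d)} (hF : MeasurableSet F) :
    annealedLaw P 0 (stayUp l ∩ (regenPair l ⁻¹' s ∩ regenShift l ⁻¹' F)) =
      annealedLaw P 0 (F ∩ stayUp l) * ∑' n : ℕ, annealedLaw P 0
        (preRegen l (n + 1) ∩ {X | (n + 1, height l (X (n + 1))) ∈ s}) := by
  set A := stayUp l ∩ (regenPair l ⁻¹' s ∩ regenShift l ⁻¹' F) with hA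
  have hAm : MeasurableSet A := (measurableSet_stayUp l).inter
    ((measurable_regenPair l hs).inter (measurable_regenShift l hF))
  have h1 : annealedLaw P 0 A =
      annealedLaw P 0 (⋃ n : ℕ, A ∩ regenTime l ⁻¹' {n + 1}) := by
    rw [← Set.inter_iUnion]
    refine measure_congr ?_
    have hpos := annealedLaw_ae_of_upLaw_ae (hP.upLaw_ae_regenTime_pos hl h)
    filter_upwards [hpos] with X hX
    refine propext ⟨fun hXA => ⟨hXA, Set.mem_iUnion.2 ⟨regenTime l X - 1, ?_⟩⟩, fun hXA => hXA.1⟩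
    have := hX hXA.1
    simp only [Set.mem_preimage, Set.mem_singleton_iff]
    omega
  rw [h1, measure_iUnion (fun i j hij => Set.disjoint_left.2 fun X hX hX' => hij (by
    have a1 : regenTime l X = i + 1 := hX.2
    have a2 : regenTime l X = j + 1 := hX'.2
    omega)) (fun n => hAm.inter (measurable_regenTime l (measurableSet_singleton _))),
    ← ENNReal.tsum_mul_left]
  refine tsum_congr fun n => ?_
  have hset : A ∩ regenTime l ⁻¹' {n + 1} =
      (preRegen l (n + 1) ∩ {X | (n + 1, height l (X (n + 1))) ∈ s}) ∩
        relShift (n + 1) ⁻¹' (F ∩ stayUp l) := by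
    ext X
    have hiff := mem_stayUp_and_regenTime_eq_iff (l := l) (X := X) (Nat.succ_pos n)
    constructor
    · rintro ⟨⟨hX1, hX2, hX3⟩, hX4⟩
      have hX4' : regenTime l X = n + 1 := hX4
      have := hiff.1 ⟨hX1, hX4⟩
      simp only [Set.mem_preimage, regenPair, regenShift, hX4'] at hX2 hX3
      exact ⟨⟨this.1, hX2⟩, hX3, this.2⟩
    · rintro ⟨⟨hX1, hX2⟩, hX3, hX4⟩
      have := hiff.2 ⟨hX1, hX4⟩
      have hX4' : regenTime l X = n + 1 := this.2
      refine ⟨⟨this.1, ?_, ?_⟩, this.2⟩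
      · simpa only [Set.mem_preimage, Set.mem_ofPred_eq, regenPair, hX4'] using hX2
      · simpa only [Set.mem_preimage, regenShift, hX4'] using hX3
  rw [hset]
  refine measure_inter_eq_of_cyl (n := n + 1)
    (measurable_relShift (n + 1) (hF.inter (measurableSet_stayUp l))) ?_ ?_
  · rintro X ⟨hX1, hX2⟩ Y hY
    refine ⟨cyl_subset_preRegen hX1 hY, ?_⟩
    simp only [Set.mem_ofPred_eq] at hX2 ⊢
    rwa [hY (n + 1) le_rfl]
  · rintro X ⟨hX1, -⟩
    exact hP.iid.annealedLaw_cyl_inter_relShift hX1.2.1 hF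

theorem IsElliptic.upLaw_regen [IsProbabilityMeasure P] {κ : ENNReal}
    (hP : IsElliptic P κ) {l : EuclideanSpace ℝ (Fin d)} (hl : l ≠ 0)
    (h : annealedLaw P 0 (stayUp l) ≠ 0) {s : Set (ℕ × ℝ)} (hs : MeasurableSet s)
    {F : Set (Path d)} (hF : MeasurableSet F) :
    upLaw P l (regenPair l ⁻¹' s ∩ regenShift l ⁻¹' F) =
      upLaw P l (regenPair l ⁻¹' s) * upLaw P l F := by
  have h1 := hP.annealedLaw_stayUp_inter_regen hl h hs hF
  have h2 := hP.annealedLaw_stayUp_inter_regen hl h hs MeasurableSet.univ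
  rw [Set.preimage_univ, Set.inter_univ, Set.univ_inter] at h2
  have htop : annealedLaw P 0 (stayUp l) ≠ ⊤ := measure_ne_top _ _
  rw [upLaw, cond_apply (measurableSet_stayUp l), cond_apply (measurableSet_stayUp l),
    cond_apply (measurableSet_stayUp l), h1, h2, Set.inter_comm F]
  rw [← mul_assoc ((annealedLaw P 0) (stayUp l))⁻¹ ((annealedLaw P 0) (stayUp l)),
    ENNReal.inv_mul_cancel h htop]
  ring

theorem IsElliptic.measurePreserving_regenShift [IsProbabilityMeasure P] {κ : ENNReal}
    (hP : IsElliptic P κ) {l : EuclideanSpace ℝ (Fin d)} (hl : l ≠ 0)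
    (h : annealedLaw P 0 (stayUp l) ≠ 0) :
    MeasurePreserving (regenShift l) (upLaw P l) (upLaw P l) := by
  have := isProbabilityMeasure_upLaw h
  refine ⟨measurable_regenShift l, ?_⟩
  ext F hF
  rw [Measure.map_apply (measurable_regenShift l) hF]
  have := hP.upLaw_regen hl h MeasurableSet.univ hF
  simpa using this

theorem IsElliptic.indepFun_regenPair [IsProbabilityMeasure P] {κ : ENNReal}
    (hP : IsElliptic P κ) {l : EuclideanSpace ℝ (Fin d)} (hl : l ≠ 0)
    (h : annealedLaw P 0 (stayUp l) ≠ 0) :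
    IndepFun (regenPair l) (regenShift l) (upLaw P l) := by
  rw [indepFun_iff_measure_inter_preimage_eq_mul]
  intro s F hs hF
  rw [hP.upLaw_regen hl h hs hF, (hP.measurePreserving_regenShift hl h).measure_preimage
    hF.nullMeasurableSet]

theorem indepFun_comp_measurePreserving {Ω α β : Type*} [MeasurableSpace Ω] [MeasurableSpace α]
    [MeasurableSpace β] {μ : Measure Ω} {T : Ω → Ω} (hT : MeasurePreserving T μ μ) {f : Ω → α}
    {g : Ω → β} (hf : Measurable f) (hg : Measurable g) (h : IndepFun f g μ) :
    IndepFun (f ∘ T) (g ∘ T) μ := by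
  rw [indepFun_iff_measure_inter_preimage_eq_mul] at h ⊢
  intro s t hs ht
  rw [Set.preimage_comp, Set.preimage_comp, ← Set.preimage_inter,
    hT.measure_preimage ((hf hs).inter (hg ht)).nullMeasurableSet,
    hT.measure_preimage (hf hs).nullMeasurableSet, hT.measure_preimage (hg ht).nullMeasurableSet,
    h s t hs ht]

/-- Independence of `f` and `T` gives that of `f` and any later `f ∘ T^[k + 1]`; invariance moves
the pair along the orbit. Pairwise independence suffices for the strong law. -/
theorem pairwise_indepFun_comp_iterate {Ω α : Type*} [MeasurableSpace Ω] [MeasurableSpace α]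
    {μ : Measure Ω} {T : Ω → Ω} (hT : MeasurePreserving T μ μ) {f : Ω → α}
    (hf : Measurable f) (h : IndepFun f T μ) :
    Pairwise fun i j : ℕ => IndepFun (f ∘ T^[i]) (f ∘ T^[j]) μ := by
  have key : ∀ i k : ℕ, IndepFun (f ∘ T^[i]) (f ∘ T^[i + (k + 1)]) μ := by
    intro i k
    have h1 : IndepFun f (f ∘ T^[k + 1]) μ :=
      h.comp (φ := id) (ψ := f ∘ T^[k]) measurable_id (hf.comp (hT.measurable.iterate k))
    have h2 := indepFun_comp_measurePreserving (hT.iterate i) hf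
      (hf.comp (hT.measurable.iterate (k + 1))) h1
    rwa [Function.comp_assoc, ← Function.iterate_add, add_comm (k + 1) i] at h2
  intro i j hij
  rcases lt_or_gt_of_ne hij with hlt | hlt
  · obtain ⟨k, rfl⟩ := Nat.exists_eq_add_of_lt hlt
    exact key i k
  · obtain ⟨k, rfl⟩ := Nat.exists_eq_add_of_lt hlt
    exact (key j k).symm

/-- The `k`-th regeneration time. -/
noncomputable def regenCum (l : EuclideanSpace ℝ (Fin d)) (X : Path d) (k : ℕ) : ℕ :=
  ∑ j ∈ Finset.range k, regenTime l ((regenShift l)^[j] X)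

/-- The paths with infinitely many regeneration times, of which zero is the first. -/
structure IsGood (l : EuclideanSpace ℝ (Fin d)) (X : Path d) : Prop where
  mem_walks : X ∈ walks d
  mem_stayUp : ∀ k, (regenShift l)^[k] X ∈ stayUp l
  regenTime_pos : ∀ k, 0 < regenTime l ((regenShift l)^[k] X)

theorem relShift_relShift (m n : ℕ) (X : Path d) :
    relShift m (relShift n X) = relShift (n + m) X := by
  ext1 i
  simp only [relShift, sub_sub_sub_cancel_right, add_assoc]

theorem IsElliptic.upLaw_ae_isGood [IsProbabilityMeasure P] {κ : ENNReal}
    (hP : IsElliptic P κ) {l : EuclideanSpace ℝ (Fin d)} (hl : l ≠ 0)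
    (h : annealedLaw P 0 (stayUp l) ≠ 0) : ∀ᵐ X ∂(upLaw P l), IsGood l X := by
  have hS := hP.measurePreserving_regenShift hl h
  filter_upwards [(upLaw_absolutelyContinuous l).ae_le annealedLaw_ae_walks,
    ae_all_iff.2 fun k => (hS.iterate k).quasiMeasurePreserving.ae (upLaw_ae_mem_stayUp l),
    ae_all_iff.2 fun k => (hS.iterate k).quasiMeasurePreserving.ae
      (hP.upLaw_ae_regenTime_pos hl h)] with X h1 h2 h3
  exact ⟨h1, h2, h3⟩

namespace IsGood

variable {l : EuclideanSpace ℝ (Fin d)} {X : Path d}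

theorem iterate_eq (hX : IsGood l X) (k : ℕ) :
    (regenShift l)^[k] X = relShift (regenCum l X k) X := by
  induction k with
  | zero =>
    ext1 i
    simp [regenCum, relShift, hX.mem_walks.1]
  | succ k ih =>
    rw [Function.iterate_succ_apply', regenShift, regenCum, Finset.sum_range_succ, ← regenCum]
    conv_lhs => rw [ih]
    rw [relShift_relShift, ← ih]

theorem regenCum_succ (k : ℕ) :
    regenCum l X (k + 1) = regenCum l X k + regenTime l ((regenShift l)^[k] X) := by
  rw [regenCum, Finset.sum_range_succ, ← regenCum]

theorem strictMono_regenCum (hX : IsGood l X) : StrictMono (regenCum l X) :=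
  strictMono_nat_of_lt_succ fun k => by
    rw [regenCum_succ]
    have := hX.regenTime_pos k
    omega

theorem regenCum_zero : regenCum l X 0 = 0 := by simp [regenCum]

theorem height_regenCum_le (hX : IsGood l X) {k n : ℕ} (hn : regenCum l X k ≤ n) :
    height l (X (regenCum l X k)) ≤ height l (X n) := by
  obtain ⟨i, rfl⟩ := Nat.exists_eq_add_of_le hn
  have := hX.mem_stayUp k
  rw [hX.iterate_eq] at this
  exact relShift_mem_stayUp.1 this i

theorem height_nonneg (hX : IsGood l X) (n : ℕ) : 0 ≤ height l (X n) := hX.mem_stayUp 0 n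

theorem height_lt_regenCum (hX : IsGood l X) {k n : ℕ} (hn : regenCum l X k ≤ n)
    (hn' : n < regenCum l X (k + 1)) :
    height l (X n) < height l (X (regenCum l X (k + 1))) := by
  obtain ⟨i, rfl⟩ := Nat.exists_eq_add_of_le hn
  rw [regenCum_succ] at hn' ⊢
  have h1 := (isRegen_regenTime (hX.regenTime_pos k)).1 i (by omega)
  rw [hX.iterate_eq] at h1 ⊢
  simp only [relShift, height_sub] at h1 ⊢
  linarith

/-- The absolute value changes nothing on good paths; it makes the summands nonnegative on all
paths, as the strong law with infinite mean demands. -/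
theorem sum_regenPair_snd (hX : IsGood l X) (k : ℕ) :
    ∑ j ∈ Finset.range k, |(regenPair l ((regenShift l)^[j] X)).2| =
      height l (X (regenCum l X k)) := by
  induction k with
  | zero => simp [regenCum_zero, hX.mem_walks.1, height_zero]
  | succ k ih =>
    have h0 : 0 ≤ (regenPair l ((regenShift l)^[k] X)).2 := hX.mem_stayUp k _
    rw [Finset.sum_range_succ, ih, abs_of_nonneg h0, regenCum_succ]
    have e := congrFun (hX.iterate_eq k) (regenTime l ((regenShift l)^[k] X))
    simp only [regenPair]
    rw [e]
    simp only [relShift, height_sub]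
    ring

/-- A regeneration strictly between two consecutive `regenCum` would be a positive regeneration of
the shifted path before its first one. -/
theorem exists_eq_regenCum (hX : IsGood l X) {n : ℕ} (hn : IsRegen l X n) :
    ∃ j, n = regenCum l X j := by
  obtain ⟨k, h1, h2⟩ := exists_mem_Ico_of_strictMono hX.strictMono_regenCum regenCum_zero n
  refine ⟨k, ?_⟩
  by_contra hne
  obtain ⟨i, rfl⟩ := Nat.exists_eq_add_of_le h1
  rw [regenCum_succ] at h2
  have h3 := ((regenTime_eq_iff (hX.regenTime_pos k)).1 rfl).2 i (by omega) (by omega)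
  apply h3
  rw [hX.iterate_eq]
  refine ⟨fun j hj => ?_, fun j => ?_⟩
  · simp only [relShift, height_sub]
    linarith [hn.1 (regenCum l X k + j) (by omega)]
  · simp only [relShift, height_sub]
    have := hn.2 j
    rw [add_assoc] at this
    linarith

end IsGood

/-! ### Density of regeneration levels and the mean height increment -/

/-- The event that the first visit above the level `k` happens at a regeneration time. -/
def regenLevel (l : EuclideanSpace ℝ (Fin d)) (k : ℝ) : Set (Path d) :=
  {X | ∃ n, (∀ i < n, height l (X i) < k) ∧ k ≤ height l (X n) ∧
    ∀ i, height l (X n) ≤ height l (X (n + i))}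

theorem measurableSet_regenLevel (l : EuclideanSpace ℝ (Fin d)) (k : ℝ) :
    MeasurableSet (regenLevel l k) := by
  simp only [regenLevel, Set.ofPred_exists, Set.ofPred_and, Set.ofPred_forall]
  exact .iUnion fun n => (MeasurableSet.iInter fun i => .iInter fun _ =>
    measurableSet_coord i fun x => height l x < k).inter
      ((measurableSet_coord n fun x => k ≤ height l x).inter
        (.iInter fun i => measurableSet_height_rel l n (n + i) (· ≤ ·)))

theorem IsElliptic.le_upLaw_regenLevel [IsProbabilityMeasure P] {κ : ENNReal}
    (hP : IsElliptic P κ) {l : EuclideanSpace ℝ (Fin d)} (hl : l ≠ 0)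
    (h : annealedLaw P 0 (stayUp l) ≠ 0) (k : ℝ) :
    annealedLaw P 0 (stayUp l) ≤ upLaw P l (regenLevel l k) := by
  classical
  set p := annealedLaw P 0 (stayUp l) with hp
  have hp1 : p ≤ 1 := prob_le_one
  have hptop : p ≠ ⊤ := measure_ne_top _ _
  -- `E`: the level `k` is reached before the height becomes negative. It has probability at least
  -- `p`, and the passage is a regeneration with conditional probability at least `p`. Hence `p * p`
  -- for the joint event, and conditioning divides by `p`.
  let E : Set (Path d) := {X | ∃ n, (∀ i ≤ n, 0 ≤ height l (X i)) ∧
    (∀ i < n, height l (X i) < k) ∧ k ≤ height l (X n)}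
  have hE : p ≤ annealedLaw P 0 E := by
    refine measure_mono_ae ?_
    filter_upwards [hP.ae_mem_transientEvent_of_bddBelow hl] with X hX hXup
    have hex : ∃ n, k ≤ height l (X n) :=
      ((hX ⟨0, Eventually.of_forall hXup⟩).eventually_ge_atTop k).exists
    exact ⟨Nat.find hex, fun i _ => hXup i, fun i hi => not_le.1 (Nat.find_min hex hi),
      Nat.find_spec hex⟩
  have hdiff : annealedLaw P 0 (E ∩ (regenLevel l k)ᶜ) ≤ (1 - p) * annealedLaw P 0 E := by
    refine measure_inter_le_of_cyl ?_
    rintro X ⟨⟨n, h1, h2, h3⟩, -⟩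
    refine ⟨n, fun Y hY => ⟨n, fun i hi => by rw [hY i hi]; exact h1 i hi,
      fun i hi => by rw [hY i hi.le]; exact h2 i hi, by rwa [hY n le_rfl]⟩, ?_⟩
    refine (measure_mono ?_).trans (hP.iid.annealedLaw_cyl_diff_relShift_le (y := X) (n := n)
      (l := l) fun i hi => (h2 i hi).trans_le h3)
    rintro Y ⟨hY, hY'⟩
    refine ⟨hY, fun hY2 => hY' ⟨n, fun i hi => by rw [hY i hi.le]; exact h2 i hi,
      by rwa [hY n le_rfl], relShift_mem_stayUp.1 hY2⟩⟩
  have hsub : E ∩ regenLevel l k ⊆ stayUp l ∩ regenLevel l k := by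
    rintro X ⟨⟨n, h1, h2, h3⟩, ⟨m, h4, h5, h6⟩⟩
    refine ⟨fun i => ?_, ⟨m, h4, h5, h6⟩⟩
    have hnm : n = m := by
      rcases lt_trichotomy n m with hlt | heq | hlt
      · exact absurd (h4 n hlt) (not_lt.2 h3)
      · exact heq
      · exact absurd (h2 m hlt) (not_lt.2 h5)
    subst hnm
    rcases le_or_gt i n with hi | hi
    · exact h1 i hi
    · obtain ⟨j, rfl⟩ := Nat.exists_eq_add_of_le hi.le
      exact (h1 n le_rfl).trans (h6 j)
  have hlow : p * annealedLaw P 0 E ≤ annealedLaw P 0 (E ∩ regenLevel l k) := by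
    have h1 : annealedLaw P 0 (E ∩ regenLevel l k) + annealedLaw P 0 (E \ regenLevel l k) =
        annealedLaw P 0 E := measure_inter_add_sdiff _ (measurableSet_regenLevel l k)
    have h2 : (1 - p) * annealedLaw P 0 E ≠ ⊤ :=
      ENNReal.mul_ne_top (ne_top_of_le_ne_top ENNReal.one_ne_top tsub_le_self)
        (measure_ne_top _ _)
    refine (ENNReal.add_le_add_iff_right h2).1 ?_
    rw [← add_mul, add_tsub_cancel_of_le hp1, one_mul, ← h1]
    gcongr
    rw [h1]
    exact hdiff
  rw [upLaw, cond_apply (measurableSet_stayUp l), ← hp]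
  calc p = p⁻¹ * (p * p) := by rw [← mul_assoc, ENNReal.inv_mul_cancel h hptop, one_mul]
    _ ≤ p⁻¹ * annealedLaw P 0 (stayUp l ∩ regenLevel l k) := by
        gcongr
        calc p * p ≤ p * annealedLaw P 0 E := by gcongr
          _ ≤ _ := hlow
          _ ≤ _ := measure_mono hsub

open Classical in
/-- If `q` of the levels `1, …, m` are regeneration levels, then the `q`-th regeneration happens
at height at most `m + 1`. -/
theorem IsGood.height_regenCum_card_le {l : EuclideanSpace ℝ (Fin d)} (hl : ‖l‖ ≤ 1)
    {X : Path d} (hX : IsGood l X) (m : ℕ) :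
    height l (X (regenCum l X ((Finset.range m).filter fun k : ℕ =>
      X ∈ regenLevel l ((k : ℝ) + 1)).card)) ≤ m + 1 := by
  set A := (Finset.range m).filter fun k : ℕ => X ∈ regenLevel l ((k : ℝ) + 1) with hA
  have hex : ∀ k ∈ A, ∃ j, 1 ≤ j ∧ (k : ℝ) + 1 ≤ height l (X (regenCum l X j)) ∧
      height l (X (regenCum l X j)) < (k : ℝ) + 2 := by
    intro k hk
    obtain ⟨n, h1, h2, h3⟩ := (Finset.mem_filter.1 hk).2
    obtain ⟨j, rfl⟩ := hX.exists_eq_regenCum ⟨fun i hi => (h1 i hi).trans_le h2, h3⟩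
    have hpos : (0 : ℝ) < k + 1 := by positivity
    have hj : 1 ≤ j := by
      by_contra hj0
      have : j = 0 := by omega
      subst this
      rw [IsGood.regenCum_zero, hX.mem_walks.1, height_zero] at h2
      linarith
    refine ⟨j, hj, h2, ?_⟩
    obtain ⟨n, hn⟩ : ∃ n, regenCum l X j = n + 1 :=
      ⟨regenCum l X j - 1, by have := hX.strictMono_regenCum.le_apply (x := j); omega⟩
    rw [hn] at h1 ⊢
    have := height_succ_le (l := l) hX.mem_walks n
    linarith [h1 n (Nat.lt_succ_self n)]
  choose! f hf1 hf2 hf3 using hex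
  have hinj : Set.InjOn f A := by
    intro a ha b hb hab
    have h1 := hf2 a ha
    have h2 := hf3 b hb
    have h3 := hf2 b hb
    have h4 := hf3 a ha
    rw [hab] at h1 h4
    have h5 : a < b + 1 := by
      have : (a : ℝ) < b + 1 := by linarith
      exact_mod_cast this
    have h6 : b < a + 1 := by
      have : (b : ℝ) < a + 1 := by linarith
      exact_mod_cast this
    omega
  rcases Nat.eq_zero_or_pos A.card with h0 | h0
  · rw [h0, IsGood.regenCum_zero, hX.mem_walks.1, height_zero]
    positivity
  -- Distinct levels have distinct positive regeneration indices, so by pigeonhole some index is at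
  -- least the number of levels.
  obtain ⟨a, ha, haq⟩ : ∃ a ∈ A, A.card ≤ f a := by
    by_contra! hcon
    have hsub : A.image f ⊆ Finset.Ico 1 A.card := by
      intro j hj
      obtain ⟨a, ha, rfl⟩ := Finset.mem_image.1 hj
      exact Finset.mem_Ico.2 ⟨hf1 a ha, hcon a ha⟩
    have := Finset.card_le_card hsub
    rw [Finset.card_image_of_injOn hinj, Nat.card_Ico] at this
    omega
  have ham : (a : ℝ) + 1 ≤ m := by
    exact_mod_cast Finset.mem_range.1 (Finset.mem_filter.1 ha).1
  have h1 := hX.height_regenCum_le (hX.strictMono_regenCum.monotone haq)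
  linarith [hf3 a ha]

/-- With infinite mean, regeneration heights would grow faster than linearly, so the fraction of
regeneration levels among `1, …, m` would tend to zero. Its expectation, however, is at least
`annealedLaw P 0 (stayUp l)`. -/
theorem IsElliptic.integrable_regenPair_snd [IsProbabilityMeasure P] {κ : ENNReal}
    (hP : IsElliptic P κ) {l : EuclideanSpace ℝ (Fin d)} (hl0 : l ≠ 0) (hl : ‖l‖ ≤ 1)
    (h : annealedLaw P 0 (stayUp l) ≠ 0) :
    Integrable (fun X => |(regenPair l X).2|) (upLaw P l) := by
  classical
  have := isProbabilityMeasure_upLaw h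
  by_contra hint
  have hS := hP.measurePreserving_regenShift hl0 h
  have hf : Measurable fun q : ℕ × ℝ => |q.2| := measurable_snd.abs
  have hg : Measurable fun X : Path d => |(regenPair l X).2| := hf.comp (measurable_regenPair l)
  have hlim := tendsto_sum_div_atTop_of_not_integrable
    (fun j => (fun X : Path d => |(regenPair l X).2|) ∘ (regenShift l)^[j]) hg
    (fun _ _ => abs_nonneg _) hint
    (pairwise_indepFun_comp_iterate hS hg ((hP.indepFun_regenPair hl0 h).comp hf measurable_id))
    (fun j => ⟨(hg.comp (hS.measurable.iterate j)).aemeasurable, hg.aemeasurable, by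
      rw [← Measure.map_map hg (hS.measurable.iterate j), (hS.iterate j).map_eq]; rfl⟩)
  let q : ℕ → Path d → ℝ := fun m X =>
    (∑ k ∈ Finset.range m, (regenLevel l ((k : ℝ) + 1)).indicator (fun _ => (1 : ℝ)) X) / m
  have hqcard : ∀ m X, q m X = ((Finset.range m).filter fun k : ℕ =>
      X ∈ regenLevel l ((k : ℝ) + 1)).card / m := by
    intro m X
    simp only [q, Set.indicator, Finset.sum_boole]
  have hq0 : ∀ᵐ X ∂(upLaw P l), Tendsto (fun m => q m X) atTop (𝓝 0) := by
    filter_upwards [hlim, hP.upLaw_ae_isGood hl0 h] with X hX hgood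
    simp only [Function.comp_apply, hgood.sum_regenPair_snd] at hX
    rw [Metric.tendsto_atTop]
    intro ε hε
    obtain ⟨j₀, hj₀⟩ := eventually_atTop.1 (hX.eventually_ge_atTop (4 / ε))
    obtain ⟨m₀, hm₀⟩ := exists_nat_gt ((j₀ + 1 : ℝ) / ε)
    refine ⟨m₀ + 1, fun m hm => ?_⟩
    have hm' : (0 : ℝ) < m := by
      have : 0 < m := by omega
      exact_mod_cast this
    have hm1 : (1 : ℝ) ≤ m := by
      have : 1 ≤ m := by omega
      exact_mod_cast this
    rw [Real.dist_0_eq_abs, hqcard, abs_of_nonneg (by positivity), div_lt_iff₀ hm']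
    set c := ((Finset.range m).filter fun k : ℕ => X ∈ regenLevel l ((k : ℝ) + 1)).card with hc
    rcases lt_or_ge c (j₀ + 1) with hcj | hcj
    · have h1 : (c : ℝ) < j₀ + 1 := by exact_mod_cast hcj
      have h2 : ((m₀ : ℕ) : ℝ) ≤ m := by
        have : m₀ ≤ m := by omega
        exact_mod_cast this
      rw [div_lt_iff₀ hε] at hm₀
      nlinarith
    · have h1 := hj₀ c (by omega)
      have h2 := hgood.height_regenCum_card_le hl m
      rw [← hc] at h2
      have hc0 : (0 : ℝ) < c := by
        have : 0 < c := by omega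
        exact_mod_cast this
      rw [le_div_iff₀ hc0, div_mul_eq_mul_div, div_le_iff₀ hε] at h1
      nlinarith
  have hqm : ∀ m, Measurable (q m) := fun m => (Finset.measurable_sum _ fun k _ =>
    measurable_const.indicator (measurableSet_regenLevel l _)).div_const _
  have hint0 : Tendsto (fun m => ∫ X, q m X ∂(upLaw P l)) atTop (𝓝 0) := by
    have := tendsto_integral_of_dominated_convergence (μ := upLaw P l) (F := q) (f := fun _ => 0)
      (fun _ => (1 : ℝ)) (fun m => (hqm m).aestronglyMeasurable) (integrable_const 1)
      (fun m => Eventually.of_forall fun X => by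
        rw [hqcard, Real.norm_of_nonneg (by positivity)]
        refine div_le_one_of_le₀ ?_ (Nat.cast_nonneg m)
        exact_mod_cast (Finset.card_filter_le _ _).trans_eq (Finset.card_range m)) hq0
    simpa using this
  have hlow : ∀ m : ℕ, 0 < m →
      (annealedLaw P 0 (stayUp l)).toReal ≤ ∫ X, q m X ∂(upLaw P l) := by
    intro m hm
    have hm' : (0 : ℝ) < m := by exact_mod_cast hm
    simp only [q]
    rw [integral_div, integral_finsetSum _ fun k _ =>
      (integrable_const (1 : ℝ)).indicator (measurableSet_regenLevel l _), le_div_iff₀ hm']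
    calc (annealedLaw P 0 (stayUp l)).toReal * m
        = ∑ k ∈ Finset.range m, (annealedLaw P 0 (stayUp l)).toReal := by
          rw [Finset.sum_const, Finset.card_range, nsmul_eq_mul, mul_comm]
      _ ≤ _ := by
          refine Finset.sum_le_sum fun k _ => ?_
          rw [integral_indicator (measurableSet_regenLevel l _), setIntegral_const, smul_eq_mul,
            mul_one]
          exact ENNReal.toReal_mono (measure_ne_top _ _) (hP.le_upLaw_regenLevel hl0 h _)
  have hcon : (annealedLaw P 0 (stayUp l)).toReal ≤ 0 :=
    ge_of_tendsto hint0 ((eventually_gt_atTop 0).mono hlow)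
  exact absurd hcon (not_le.2 (ENNReal.toReal_pos h (measure_ne_top _ _)))

/-! ### The speed in a direction of transience -/

theorem IsElliptic.exists_tendsto_height_regenCum [IsProbabilityMeasure P] {κ : ENNReal}
    (hP : IsElliptic P κ) {l : EuclideanSpace ℝ (Fin d)} (hl0 : l ≠ 0) (hl : ‖l‖ ≤ 1)
    (h : annealedLaw P 0 (stayUp l) ≠ 0) :
    ∃ a : ℝ, ∀ᵐ X ∂(upLaw P l),
      Tendsto (fun k : ℕ => height l (X (regenCum l X k)) / k) atTop (𝓝 a) := by
  have hS := hP.measurePreserving_regenShift hl0 h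
  have hf : Measurable fun q : ℕ × ℝ => |q.2| := measurable_snd.abs
  have hg : Measurable fun X : Path d => |(regenPair l X).2| := hf.comp (measurable_regenPair l)
  have hlim := strong_law_ae_real
    (fun j => (fun X : Path d => |(regenPair l X).2|) ∘ (regenShift l)^[j])
    (hP.integrable_regenPair_snd hl0 hl h)
    (pairwise_indepFun_comp_iterate hS hg ((hP.indepFun_regenPair hl0 h).comp hf measurable_id))
    (fun j => ⟨(hg.comp (hS.measurable.iterate j)).aemeasurable, hg.aemeasurable, by
      rw [← Measure.map_map hg (hS.measurable.iterate j), (hS.iterate j).map_eq]; rfl⟩)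
  refine ⟨∫ X, ((fun X : Path d => |(regenPair l X).2|) ∘ (regenShift l)^[0]) X ∂(upLaw P l), ?_⟩
  filter_upwards [hlim, hP.upLaw_ae_isGood hl0 h] with X hX hgood
  simpa only [Function.comp_apply, hgood.sum_regenPair_snd] using hX

/-- The limit is the reciprocal of the mean regeneration time, and zero if that mean is infinite.
Working with the reciprocal makes moment bounds unnecessary. -/
theorem IsElliptic.exists_tendsto_div_regenCum [IsProbabilityMeasure P] {κ : ENNReal}
    (hP : IsElliptic P κ) {l : EuclideanSpace ℝ (Fin d)} (hl0 : l ≠ 0)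
    (h : annealedLaw P 0 (stayUp l) ≠ 0) :
    ∃ ρ : ℝ, ∀ᵐ X ∂(upLaw P l),
      Tendsto (fun k : ℕ => (k : ℝ) / regenCum l X k) atTop (𝓝 ρ) := by
  have := isProbabilityMeasure_upLaw h
  have hS := hP.measurePreserving_regenShift hl0 h
  have hf : Measurable fun q : ℕ × ℝ => (q.1 : ℝ) :=
    (measurable_of_countable fun n : ℕ => (n : ℝ)).comp measurable_fst
  have hg : Measurable fun X : Path d => (regenTime l X : ℝ) := hf.comp (measurable_regenPair l)
  have hindep := pairwise_indepFun_comp_iterate hS hg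
    ((hP.indepFun_regenPair hl0 h).comp hf measurable_id)
  have hident : ∀ j : ℕ, IdentDistrib ((fun X : Path d => (regenTime l X : ℝ)) ∘ (regenShift l)^[j])
      ((fun X : Path d => (regenTime l X : ℝ)) ∘ (regenShift l)^[0]) (upLaw P l) (upLaw P l) :=
    fun j => ⟨(hg.comp (hS.measurable.iterate j)).aemeasurable, hg.aemeasurable, by
      rw [← Measure.map_map hg (hS.measurable.iterate j), (hS.iterate j).map_eq]; rfl⟩
  have hsum : ∀ X k, (∑ j ∈ Finset.range k, ((fun X : Path d => (regenTime l X : ℝ)) ∘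
      (regenShift l)^[j]) X) = regenCum l X k := by
    intro X k
    simp [regenCum]
  by_cases hint : Integrable (fun X : Path d => (regenTime l X : ℝ)) (upLaw P l)
  · have hlim := strong_law_ae_real
      (fun j => (fun X : Path d => (regenTime l X : ℝ)) ∘ (regenShift l)^[j]) hint hindep hident
    refine ⟨(∫ X, ((fun X : Path d => (regenTime l X : ℝ)) ∘ (regenShift l)^[0]) X
      ∂(upLaw P l))⁻¹, ?_⟩
    filter_upwards [hlim, hP.upLaw_ae_isGood hl0 h] with X hX hgood
    simp only [hsum] at hX
    have hge : (1 : ℝ) ≤ ∫ X, ((fun X : Path d => (regenTime l X : ℝ)) ∘ (regenShift l)^[0]) X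
        ∂(upLaw P l) := by
      refine ge_of_tendsto hX ?_
      filter_upwards [eventually_gt_atTop 0] with k hk
      have hk' : (0 : ℝ) < k := by exact_mod_cast hk
      rw [le_div_iff₀ hk', one_mul]
      exact_mod_cast hgood.strictMono_regenCum.le_apply
    exact (hX.inv₀ (by linarith)).congr fun k => by rw [inv_div]
  · have hlim := tendsto_sum_div_atTop_of_not_integrable
      (fun j => (fun X : Path d => (regenTime l X : ℝ)) ∘ (regenShift l)^[j]) hg
      (fun _ _ => Nat.cast_nonneg _) hint hindep hident
    refine ⟨0, ?_⟩
    filter_upwards [hlim] with X hX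
    simp only [hsum] at hX
    exact hX.inv_tendsto_atTop.congr fun k => by simp [inv_div]

theorem IsElliptic.exists_upLaw_speed [IsProbabilityMeasure P] {κ : ENNReal}
    (hP : IsElliptic P κ) {l : EuclideanSpace ℝ (Fin d)} (hl0 : l ≠ 0) (hl : ‖l‖ ≤ 1)
    (h : annealedLaw P 0 (stayUp l) ≠ 0) :
    ∃ v : ℝ, ∀ᵐ X ∂(upLaw P l), Tendsto (fun n : ℕ => height l (X n) / n) atTop (𝓝 v) := by
  obtain ⟨a, ha⟩ := hP.exists_tendsto_height_regenCum hl0 hl h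
  obtain ⟨ρ, hρ⟩ := hP.exists_tendsto_div_regenCum hl0 h
  refine ⟨a * ρ, ?_⟩
  filter_upwards [ha, hρ, hP.upLaw_ae_isGood hl0 h] with X h1 h2 hX
  exact tendsto_div_of_interpolation hX.strictMono_regenCum IsGood.regenCum_zero hX.height_nonneg
    (fun k n hn hn' => ⟨hX.height_regenCum_le hn, (hX.height_lt_regenCum hn hn').le⟩) h2 h1

theorem tendsto_div_of_tendsto_shift {u : ℕ → ℝ} {n : ℕ} {v : ℝ}
    (h : Tendsto (fun i : ℕ => (u (n + i) - u n) / i) atTop (𝓝 v)) :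
    Tendsto (fun m : ℕ => u m / m) atTop (𝓝 v) := by
  rw [← tendsto_add_atTop_iff_nat n]
  have h1 : Tendsto (fun i : ℕ => (i : ℝ) / (i + n)) atTop (𝓝 1) :=
    tendsto_natCast_div_add_atTop (n : ℝ)
  have h2 : Tendsto (fun i : ℕ => u n / ((i + n : ℕ) : ℝ)) atTop (𝓝 0) :=
    (tendsto_natCast_atTop_atTop.comp (tendsto_add_atTop_nat n)).const_div_atTop (u n)
  have h3 := (h.mul h1).add h2
  rw [mul_one, add_zero] at h3
  refine h3.congr' ?_
  filter_upwards [eventually_gt_atTop 0] with i hi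
  have hi' : (0 : ℝ) < i := by exact_mod_cast hi
  have hin : (0 : ℝ) < i + n := by positivity
  rw [add_comm n i]
  push_cast
  field_simp
  ring

/-- The speed does not see a finite initial piece. A transient path almost surely regenerates, and
after a strict record a path that stays up avoids the null sets of `upLaw`. -/
theorem IsElliptic.exists_speed_of_norm_le [IsProbabilityMeasure P] {κ : ENNReal}
    (hP : IsElliptic P κ) {l : EuclideanSpace ℝ (Fin d)} (hl0 : l ≠ 0) (hl : ‖l‖ ≤ 1) :
    ∃ v : ℝ, ∀ᵐ X ∂(annealedLaw P 0), X ∈ transientEvent l →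
      Tendsto (fun n : ℕ => height l (X n) / n) atTop (𝓝 v) := by
  by_cases htr : annealedLaw P 0 (transientEvent l) = 0
  · refine ⟨0, ?_⟩
    have : ∀ᵐ X ∂(annealedLaw P 0), X ∉ transientEvent l := measure_eq_zero_iff_ae_notMem.1 htr
    filter_upwards [this] with X hX hX'
    exact absurd hX' hX
  have h := hP.annealedLaw_stayUp_ne_zero htr
  obtain ⟨v, hv⟩ := hP.exists_upLaw_speed hl0 hl h
  refine ⟨v, ?_⟩
  have hv' := annealedLaw_ae_of_upLaw_ae hv
  rw [ae_iff] at hv'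
  -- The renewal property needs a measurable exceptional set.
  obtain ⟨T, hT, hTm, hT0⟩ := exists_measurable_superset_of_null hv'
  have hnull : ∀ n, annealedLaw P 0 {X | (∀ i < n, height l (X i) < height l (X n)) ∧
      relShift n X ∈ T ∩ stayUp l} = 0 := by
    intro n
    have := measure_inter_le_of_cyl (μ := annealedLaw P 0) (E := Set.univ)
      (B := {X | (∀ i < n, height l (X i) < height l (X n)) ∧ relShift n X ∈ T ∩ stayUp l})
      (c := 0) (by
        rintro X ⟨-, hX, -⟩
        refine ⟨n, Set.subset_univ _, ?_⟩
        rw [zero_mul, nonpos_iff_eq_zero]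
        refine measure_mono_null (t := cyl X n ∩ relShift n ⁻¹' (T ∩ stayUp l))
          (fun Y hY => ⟨hY.1, hY.2.2⟩) ?_
        rw [hP.iid.annealedLaw_cyl_inter_relShift hX hTm,
          measure_mono_null Set.inter_subset_left hT0, zero_mul])
    simpa using this
  have hnull' : ∀ᵐ X ∂(annealedLaw P 0), ∀ n,
      ¬ ((∀ i < n, height l (X i) < height l (X n)) ∧ relShift n X ∈ T ∩ stayUp l) := by
    refine ae_all_iff.2 fun n => ?_
    rw [ae_iff]
    simpa only [not_not] using hnull n
  filter_upwards [hnull', hP.ae_frequently_isRegen h] with X hX hreg htrX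
  obtain ⟨n, hn⟩ := (hreg fun b =>
    ((mem_transientEvent.1 htrX).eventually_ge_atTop b).frequently).exists
  have hup : relShift n X ∈ stayUp l := relShift_mem_stayUp.2 hn.2
  have hnT : relShift n X ∉ T := fun hmem => hX n ⟨hn.1, hmem, hup⟩
  have hlim : Tendsto (fun i : ℕ => height l (relShift n X i) / i) atTop (𝓝 v) := by
    by_contra hcon
    exact hnT (hT fun himp => hcon (himp hup))
  simp only [relShift, height_sub] at hlim
  exact tendsto_div_of_tendsto_shift (u := fun n => height l (X n)) hlim

theorem transientEvent_smul {c : ℝ} (hc : 0 < c) (l : EuclideanSpace ℝ (Fin d)) :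
    transientEvent (c • l) = transientEvent l := by
  ext X
  simp only [mem_transientEvent, height_smul_dir]
  exact tendsto_const_mul_atTop_of_pos hc

/-- On the event of transience in direction `l`, the speed in that direction is deterministic. -/
theorem IsElliptic.exists_speed [IsProbabilityMeasure P] {κ : ENNReal}
    (hP : IsElliptic P κ) {l : EuclideanSpace ℝ (Fin d)} (hl : l ≠ 0) :
    ∃ v : ℝ, ∀ᵐ X ∂(annealedLaw P 0), X ∈ transientEvent l →
      Tendsto (fun n : ℕ => height l (X n) / n) atTop (𝓝 v) := by
  have hn : 0 < ‖l‖ := norm_pos_iff.2 hl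
  obtain ⟨v, hv⟩ := hP.exists_speed_of_norm_le (l := ‖l‖⁻¹ • l)
    (smul_ne_zero (inv_ne_zero hn.ne') hl)
    (by rw [norm_smul, norm_inv, norm_norm, inv_mul_cancel₀ hn.ne'])
  refine ⟨‖l‖ * v, ?_⟩
  filter_upwards [hv] with X hX htr
  rw [transientEvent_smul (inv_pos.2 hn)] at hX
  refine ((hX htr).const_mul ‖l‖).congr fun n => ?_
  rw [height_smul_dir]
  field_simp

/-- Off the events of transience in directions `l` and `-l`, the speed in direction `l` is zero. -/
theorem IsElliptic.ae_tendsto_zero_or [IsProbabilityMeasure P] {κ : ENNReal}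
    (hP : IsElliptic P κ) {l : EuclideanSpace ℝ (Fin d)} (hl : l ≠ 0) :
    ∀ᵐ X ∂(annealedLaw P 0), X ∉ transientEvent l → X ∉ transientEvent (-l) →
      Tendsto (fun n : ℕ => height l (X n) / n) atTop (𝓝 0) := by
  by_cases h1 : annealedLaw P 0 (transientEvent l) = 0
  swap
  · filter_upwards [hP.ae_mem_transientEvent_or hl h1] with X hX hX1 hX2
    exact absurd hX (not_or.2 ⟨hX1, hX2⟩)
  by_cases h2 : annealedLaw P 0 (transientEvent (-l)) = 0
  swap
  · filter_upwards [hP.ae_mem_transientEvent_or (neg_ne_zero.2 hl) h2] with X hX hX1 hX2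
    rw [neg_neg] at hX
    exact absurd hX (not_or.2 ⟨hX2, hX1⟩)
  filter_upwards [hP.ae_eventually_height_le hl h1,
    hP.ae_eventually_height_le (neg_ne_zero.2 hl) h2] with X hX1 hX2 _ _
  rw [Metric.tendsto_nhds]
  intro ε hε
  filter_upwards [hX1 (ε / 2) (by positivity), hX2 (ε / 2) (by positivity),
    eventually_gt_atTop 0] with n h3 h4 hn
  have hn' : (0 : ℝ) < n := by exact_mod_cast hn
  rw [height_neg_dir] at h4
  rw [Real.dist_0_eq_abs, abs_lt]
  constructor
  · rw [lt_div_iff₀ hn']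
    nlinarith
  · rw [div_lt_iff₀ hn']
    nlinarith

/-! ### The velocity -/

theorem HasVelocity.tendsto_height {X : Path d} {w : EuclideanSpace ℝ (Fin d)}
    (h : HasVelocity X w) (l : EuclideanSpace ℝ (Fin d)) :
    Tendsto (fun n : ℕ => height l (X n) / n) atTop (𝓝 (inner ℝ w l)) := by
  have h1 : Tendsto (fun n : ℕ => inner ℝ ((n : ℝ)⁻¹ • toReal (X n)) l) atTop
      (𝓝 (inner ℝ w l)) := h.inner tendsto_const_nhds
  refine h1.congr fun n => ?_
  rw [real_inner_smul_left, height, div_eq_inv_mul]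

theorem HasVelocity.mem_transientEvent {X : Path d} {w l : EuclideanSpace ℝ (Fin d)}
    (h : HasVelocity X w) (hl : 0 < inner ℝ w l) : X ∈ transientEvent l := by
  rw [RWRE.mem_transientEvent]
  refine ((h.tendsto_height l).pos_mul_atTop hl tendsto_natCast_atTop_atTop).congr' ?_
  filter_upwards [eventually_gt_atTop 0] with n hn
  have hn' : (n : ℝ) ≠ 0 := by exact_mod_cast hn.ne'
  field_simp

theorem height_le_of_mem_walks {l : EuclideanSpace ℝ (Fin d)} {X : Path d} (hX : X ∈ walks d)
    (n : ℕ) : height l (X n) ≤ ‖l‖ * n := by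
  induction n with
  | zero => simp [hX.1, height_zero]
  | succ n ih =>
    push_cast
    linarith [height_succ_le (l := l) hX n]

/-- The speed on the event of transience in direction `l`, for a unit vector `l`. -/
theorem IsElliptic.exists_speed_mem_Icc [IsProbabilityMeasure P] {κ : ENNReal}
    (hP : IsElliptic P κ) {l : EuclideanSpace ℝ (Fin d)} (hl : ‖l‖ = 1) :
    ∃ v ∈ Set.Icc (0 : ℝ) 1, ∀ᵐ X ∂(annealedLaw P 0), X ∈ transientEvent l →
      Tendsto (fun n : ℕ => height l (X n) / n) atTop (𝓝 v) := by
  obtain ⟨v, hv⟩ := hP.exists_speed (l := l)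
    (norm_ne_zero_iff.1 (by rw [hl]; exact one_ne_zero))
  have hmem : ∀ᵐ X ∂(annealedLaw P 0), X ∈ transientEvent l → v ∈ Set.Icc (0 : ℝ) 1 := by
    filter_upwards [hv, annealedLaw_ae_walks] with X hX hwalk htr
    constructor
    · refine ge_of_tendsto (hX htr) ?_
      filter_upwards [(RWRE.mem_transientEvent.1 htr).eventually_ge_atTop 0] with n hn
      positivity
    · refine le_of_tendsto' (hX htr) fun n => ?_
      refine div_le_one_of_le₀ ?_ (Nat.cast_nonneg n)
      simpa [hl] using height_le_of_mem_walks (l := l) hwalk n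
  by_cases hvI : v ∈ Set.Icc (0 : ℝ) 1
  · exact ⟨v, hvI, hv⟩
  -- A value outside `[0, 1]` can only occur if `A_l` is null, and then any value serves.
  · refine ⟨0, by simp, ?_⟩
    filter_upwards [hmem] with X hX htr
    exact absurd (hX htr) hvI

theorem IsElliptic.ae_exists_hasVelocity [IsProbabilityMeasure P] {κ : ENNReal}
    (hP : IsElliptic P κ) :
    ∀ᵐ X ∂(annealedLaw P 0), ∃ w : EuclideanSpace ℝ (Fin d), HasVelocity X w := by
  have hcoord : ∀ i : Fin d, ∀ᵐ X ∂(annealedLaw P 0),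
      ∃ c : ℝ, Tendsto (fun n : ℕ => (n : ℝ)⁻¹ * (X n i : ℝ)) atTop (𝓝 c) := by
    intro i
    set l : EuclideanSpace ℝ (Fin d) := EuclideanSpace.single i 1 with hl
    have hl0 : l ≠ 0 := by simp [hl]
    have hh : ∀ x : Site d, height l x = x i := by
      intro x
      rw [height, hl, EuclideanSpace.inner_single_right]
      simp [toReal]
    obtain ⟨a, ha⟩ := hP.exists_speed hl0
    obtain ⟨b, hb⟩ := hP.exists_speed (neg_ne_zero.2 hl0)
    filter_upwards [ha, hb, hP.ae_tendsto_zero_or hl0] with X h1 h2 h3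
    have hex : ∃ c : ℝ, Tendsto (fun n : ℕ => height l (X n) / n) atTop (𝓝 c) := by
      by_cases hX1 : X ∈ transientEvent l
      · exact ⟨a, h1 hX1⟩
      by_cases hX2 : X ∈ transientEvent (-l)
      · refine ⟨-b, (h2 hX2).neg.congr fun n => ?_⟩
        rw [height_neg_dir, neg_div, neg_neg]
      · exact ⟨0, h3 hX1 hX2⟩
    obtain ⟨c, hc⟩ := hex
    exact ⟨c, hc.congr fun n => by rw [hh, div_eq_inv_mul]⟩
  filter_upwards [ae_all_iff.2 hcoord] with X hX
  choose c hc using hX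
  refine ⟨WithLp.toLp 2 c, ?_⟩
  exact ((PiLp.continuous_toLp 2 _).tendsto c).comp (tendsto_pi_nhds.2 hc)

/-- Two vectors whose inner products with every vector agree as soon as both are positive are
collinear. -/
theorem mem_span_of_inner_eq {E : Type*} [NormedAddCommGroup E] [InnerProductSpace ℝ E] {w z : E}
    (hw : w ≠ 0)
    (h : ∀ l : E, 0 < inner ℝ w l → 0 < inner ℝ z l → inner ℝ w l = inner ℝ z l) :
    z ∈ Submodule.span ℝ {w} := by
  rcases eq_or_ne z 0 with rfl | hz
  · exact Submodule.zero_mem _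
  rcases eq_or_ne w z with rfl | hwz
  · exact Submodule.mem_span_singleton_self _
  have hw' : 0 < ‖w‖ := norm_pos_iff.2 hw
  have hz' : 0 < ‖z‖ := norm_pos_iff.2 hz
  by_cases hanti : inner ℝ w (-z) = ‖w‖ * ‖-z‖
  · rw [inner_eq_norm_mul_iff_real, norm_neg] at hanti
    rw [Submodule.mem_span_singleton]
    refine ⟨-(‖w‖⁻¹ * ‖z‖), ?_⟩
    rw [neg_smul, mul_smul, hanti, smul_smul, inv_mul_cancel₀ hw'.ne', one_smul, neg_neg]
  exfalso
  have hlt : 0 < inner ℝ w z + ‖w‖ * ‖z‖ := by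
    have h1 := real_inner_le_norm w (-z)
    have h2 := lt_of_le_of_ne h1 hanti
    rw [inner_neg_right, norm_neg] at h2
    linarith
  -- A bisector of `w` and `z`: both inner products are positive multiples of `⟪w, z⟫ + ‖w‖ * ‖z‖`,
  -- which is positive as the vectors are not opposite. Moving `l₀` slightly along `w - z` keeps
  -- them positive; comparing the two equalities gives `t * ‖w - z‖ ^ 2 = 0`.
  set l₀ : E := ‖z‖ • w + ‖w‖ • z with hl₀
  have hA : 0 < inner ℝ w l₀ := by
    rw [hl₀, inner_add_right, real_inner_smul_right, real_inner_smul_right,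
      real_inner_self_eq_norm_mul_norm]
    nlinarith
  have hB : 0 < inner ℝ z l₀ := by
    rw [hl₀, inner_add_right, real_inner_smul_right, real_inner_smul_right,
      real_inner_self_eq_norm_mul_norm, real_inner_comm]
    nlinarith
  have hev : ∀ᶠ t : ℝ in 𝓝[>] 0, 0 < inner ℝ w (l₀ + t • (w - z)) ∧
      0 < inner ℝ z (l₀ + t • (w - z)) := by
    have hc : ∀ x : E, 0 < inner ℝ x l₀ →
        ∀ᶠ t : ℝ in 𝓝 0, 0 < inner ℝ x (l₀ + t • (w - z)) := by
      intro x hx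
      have hcont : Continuous fun t : ℝ => inner ℝ x (l₀ + t • (w - z)) := by fun_prop
      refine (hcont.tendsto 0).eventually_const_lt ?_
      simpa using hx
    exact ((hc w hA).and (hc z hB)).filter_mono nhdsWithin_le_nhds
  obtain ⟨t, ⟨ht1, ht2⟩, ht⟩ := (hev.and self_mem_nhdsWithin).exists
  have e1 := h _ ht1 ht2
  have e0 := h _ hA hB
  have e2 : inner ℝ (w - z) (t • (w - z)) = 0 := by
    rw [inner_add_right w l₀, inner_add_right z l₀] at e1
    rw [inner_sub_left]
    linarith
  rw [real_inner_smul_right, mul_eq_zero, inner_self_eq_zero, sub_eq_zero] at e2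
  exact e2.elim (fun h => (Set.mem_Ioi.1 ht).ne' h) hwz

/-- The velocities are almost surely collinear. -/
theorem IsElliptic.exists_ae_collinear [IsProbabilityMeasure P] {κ : ENNReal}
    (hP : IsElliptic P κ) (hd : 0 < d) :
    ∃ ν : EuclideanSpace ℝ (Fin d), ‖ν‖ = 1 ∧
      ∀ᵐ X ∂(annealedLaw P 0), ∃ t : ℝ, HasVelocity X (t • ν) := by
  by_cases h0 : ∀ᵐ X ∂(annealedLaw P 0), HasVelocity X (0 : EuclideanSpace ℝ (Fin d))
  · refine ⟨EuclideanSpace.single ⟨0, hd⟩ 1, by simp, ?_⟩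
    filter_upwards [h0] with X hX
    exact ⟨0, by rwa [zero_smul]⟩
  have hspeed : ∀ l : EuclideanSpace ℝ (Fin d), ∃ v : ℝ, l ≠ 0 → ∀ᵐ X ∂(annealedLaw P 0),
      X ∈ transientEvent l → Tendsto (fun n : ℕ => height l (X n) / n) atTop (𝓝 v) := by
    intro l
    by_cases hl : l = 0
    · exact ⟨0, fun h => absurd hl h⟩
    · obtain ⟨v, hv⟩ := hP.exists_speed hl
      exact ⟨v, fun _ => hv⟩
  choose v hv using hspeed
  -- The null set for the speed depends on the direction, so only countably many directions can be
  -- used at once; continuity of the inner product does the rest.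
  let D : ℕ → EuclideanSpace ℝ (Fin d) := TopologicalSpace.denseSeq _
  have hD : ∀ᵐ X ∂(annealedLaw P 0), ∀ k, D k ≠ 0 → X ∈ transientEvent (D k) →
      Tendsto (fun n : ℕ => height (D k) (X n) / n) atTop (𝓝 (v (D k))) := by
    refine ae_all_iff.2 fun k => ?_
    by_cases hk : D k = 0
    · exact Eventually.of_forall fun X h => absurd hk h
    · filter_upwards [hv (D k) hk] with X hX _ using hX
  -- `Y` is one reference path with nonzero velocity `w` and all the almost sure properties; every
  -- other typical path is compared with it.
  obtain ⟨Y, hY0, ⟨w, hYw⟩, hYD⟩ :=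
    ((not_eventually.1 h0).and_eventually (hP.ae_exists_hasVelocity.and hD)).exists
  have hw : w ≠ 0 := by
    rintro rfl
    exact hY0 hYw
  have hwn : 0 < ‖w‖ := norm_pos_iff.2 hw
  refine ⟨‖w‖⁻¹ • w, by rw [norm_smul, norm_inv, norm_norm, inv_mul_cancel₀ hwn.ne'], ?_⟩
  filter_upwards [hP.ae_exists_hasVelocity, hD] with X hXz hXD
  obtain ⟨z, hXz⟩ := hXz
  have hdense : ∀ l : EuclideanSpace ℝ (Fin d), 0 < inner ℝ w l → 0 < inner ℝ z l →
      inner ℝ w l = inner ℝ z l := by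
    intro l h1 h2
    by_contra hne
    have hopen : IsOpen {l : EuclideanSpace ℝ (Fin d) |
        0 < inner ℝ w l ∧ 0 < inner ℝ z l ∧ inner ℝ w l ≠ inner ℝ z l} := by
      have c1 : Continuous fun l : EuclideanSpace ℝ (Fin d) => inner ℝ w l := by fun_prop
      have c2 : Continuous fun l : EuclideanSpace ℝ (Fin d) => inner ℝ z l := by fun_prop
      exact (isOpen_lt continuous_const c1).inter
        ((isOpen_lt continuous_const c2).inter (isOpen_ne_fun c1 c2))
    obtain ⟨_, ⟨h3, h4, h5⟩, k, rfl⟩ :=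
      (TopologicalSpace.denseRange_denseSeq (EuclideanSpace ℝ (Fin d))).inter_open_nonempty _ hopen
        ⟨l, h1, h2, hne⟩
    have hk : D k ≠ 0 := by
      intro hk
      change 0 < inner ℝ w (D k) at h3
      rw [hk, inner_zero_right] at h3
      exact lt_irrefl _ h3
    refine h5 ?_
    rw [tendsto_nhds_unique (hYw.tendsto_height (D k)) (hYD k hk (hYw.mem_transientEvent h3)),
      tendsto_nhds_unique (hXz.tendsto_height (D k)) (hXD k hk (hXz.mem_transientEvent h4))]
  obtain ⟨c, hc⟩ := Submodule.mem_span_singleton.1 (mem_span_of_inner_eq hw hdense)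
  refine ⟨c * ‖w‖, ?_⟩
  rwa [smul_smul, mul_assoc, mul_inv_cancel₀ hwn.ne', mul_one, hc]

theorem notMem_transientEvent_neg {X : Path d} {l : EuclideanSpace ℝ (Fin d)}
    (h : X ∈ transientEvent l) : X ∉ transientEvent (-l) := by
  intro h'
  rw [mem_transientEvent_neg] at h'
  obtain ⟨n, h1, h2⟩ := (((RWRE.mem_transientEvent.1 h).eventually_gt_atTop 0).and
    (h'.eventually_lt_atBot 0)).exists
  linarith

end RWRE

/-! ### The limiting velocity and its at most two values -/

theorem mainTheorem5 (d : ℕ) (hd : 2 ≤ d) (P : Measure (RWRE.Env d)) [IsProbabilityMeasure P]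
    (hiid : RWRE.IsIID P) (hue : RWRE.IsUniformlyElliptic P) :
    ∃ ν : EuclideanSpace ℝ (Fin d), ‖ν‖ = 1 ∧
      ∃ v₁ ∈ Set.Icc (0 : ℝ) 1, ∃ v₂ ∈ Set.Icc (0 : ℝ) 1,
        (∀ᵐ X ∂(RWRE.annealedLaw P 0), RWRE.HasVelocity X
          ((RWRE.transientEvent ν).indicator (fun _ => v₁ • ν) X -
            (RWRE.transientEvent (-ν)).indicator (fun _ => v₂ • ν) X)) ∧
        ∃ w₁ ∈ Submodule.span ℝ {ν}, ∃ w₂ ∈ Submodule.span ℝ {ν},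
          ∀ᵐ X ∂(RWRE.annealedLaw P 0), RWRE.HasVelocity X w₁ ∨ RWRE.HasVelocity X w₂ := by
  obtain ⟨κ, h0, h1, hκ⟩ := hue.exists_ennreal
  have hP : RWRE.IsElliptic P κ := ⟨hiid, h0, h1, hκ⟩
  obtain ⟨ν, hν, hcol⟩ := hP.exists_ae_collinear (by omega)
  have hν0 : ν ≠ 0 := norm_ne_zero_iff.1 (by rw [hν]; exact one_ne_zero)
  have hself : ∀ t : ℝ, inner ℝ (t • ν) ν = t := by
    intro t
    rw [real_inner_smul_left, real_inner_self_eq_norm_sq, hν]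
    simp
  obtain ⟨v₁, hv₁, hs₁⟩ := hP.exists_speed_mem_Icc hν
  obtain ⟨v₂, hv₂, hs₂⟩ := hP.exists_speed_mem_Icc (l := -ν) (by rwa [norm_neg])
  have hval₁ : ∀ᵐ X ∂(RWRE.annealedLaw P 0), X ∈ RWRE.transientEvent ν →
      RWRE.HasVelocity X (v₁ • ν) := by
    filter_upwards [hs₁, hcol] with X hX ⟨t, ht⟩ htr
    have := tendsto_nhds_unique (ht.tendsto_height ν) (hX htr)
    rwa [← this, hself]
  have hval₂ : ∀ᵐ X ∂(RWRE.annealedLaw P 0), X ∈ RWRE.transientEvent (-ν) →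
      RWRE.HasVelocity X (-(v₂ • ν)) := by
    filter_upwards [hs₂, hcol] with X hX ⟨t, ht⟩ htr
    have := tendsto_nhds_unique (ht.tendsto_height (-ν)) (hX htr)
    rwa [← this, inner_neg_right, hself, neg_smul, neg_neg]
  have hval₀ : ∀ᵐ X ∂(RWRE.annealedLaw P 0), X ∉ RWRE.transientEvent ν →
      X ∉ RWRE.transientEvent (-ν) → RWRE.HasVelocity X 0 := by
    filter_upwards [hP.ae_tendsto_zero_or hν0, hcol] with X hX ⟨t, ht⟩ htr htr'
    have := tendsto_nhds_unique (ht.tendsto_height ν) (hX htr htr')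
    rw [hself] at this
    rwa [this, zero_smul] at ht
  refine ⟨ν, hν, v₁, hv₁, v₂, hv₂, ?_, ?_⟩
  · filter_upwards [hval₁, hval₂, hval₀] with X h1 h2 h3
    by_cases hX : X ∈ RWRE.transientEvent ν
    · rw [Set.indicator_of_mem hX, Set.indicator_of_notMem (RWRE.notMem_transientEvent_neg hX),
        sub_zero]
      exact h1 hX
    by_cases hX' : X ∈ RWRE.transientEvent (-ν)
    · rw [Set.indicator_of_notMem hX, Set.indicator_of_mem hX', zero_sub]
      exact h2 hX'
    · rw [Set.indicator_of_notMem hX, Set.indicator_of_notMem hX', sub_zero]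
      exact h3 hX hX'
  -- The formula allows three values, including zero off both events. If both events are null only
  -- zero remains; otherwise their union has full probability and the separate value zero drops out.
  · by_cases hnull : RWRE.annealedLaw P 0 (RWRE.transientEvent ν) = 0 ∧
        RWRE.annealedLaw P 0 (RWRE.transientEvent (-ν)) = 0
    · refine ⟨0, Submodule.zero_mem _, 0, Submodule.zero_mem _, ?_⟩
      filter_upwards [hval₀, measure_eq_zero_iff_ae_notMem.1 hnull.1,
        measure_eq_zero_iff_ae_notMem.1 hnull.2] with X h h' h''
      exact Or.inl (h h' h'')
    · refine ⟨v₁ • ν, Submodule.smul_mem _ _ (Submodule.mem_span_singleton_self ν), -(v₂ • ν),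
        Submodule.neg_mem _ (Submodule.smul_mem _ _ (Submodule.mem_span_singleton_self ν)), ?_⟩
      have hor : ∀ᵐ X ∂(RWRE.annealedLaw P 0),
          X ∈ RWRE.transientEvent ν ∨ X ∈ RWRE.transientEvent (-ν) := by
        rcases not_and_or.1 hnull with h | h
        · exact hP.ae_mem_transientEvent_or hν0 h
        · filter_upwards [hP.ae_mem_transientEvent_or (neg_ne_zero.2 hν0) h] with X hX
          rw [neg_neg] at hX
          exact hX.symm
      filter_upwards [hor, hval₁, hval₂] with X hX h1 h2
      exact hX.imp h1 h2
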